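/- **Setting.** For $x\in\mathbb R$ let $|x|_T=\min_{m\in\mathbb Z}|x-2\pi m|$. Let $U$ be an $N$-qubit unitary with eigenstates $|\phi_j\rangle$ of phases $\phi_j\in[0,2\pi)$ and let $|\Psi\rangle$ be an input state. Write $A(\phi)$ for the probability of the phase $\phi$ in $|\Psi\rangle$. Fix $A>0$ and $n_\phi$, and assume that exactly $n_\phi$ phases have nonzero probability and that each of these probabilities exceeds $A$. For $\chi\in\mathbb R$ the shifted unitary $Ue^{-i\chi}$ has phases $(\phi_j-\chi)\bmod 2\pi\in[0,2\pi)$, and real powers of it are taken with these phases. A set-valued estimator of the phases *solves the multiple eigenvalue estimation problem with accuracy error $\delta$* if it always outputs a nonempty set of at most $n_\phi$ numbers and, for every phase $\phi$ of nonzero probability, the root mean square of the $|\cdot|_T$-distance from $\phi$ to the closest output number is at most $\delta$. **Extraction subroutine** $\mathrm{Ext}(V,\epsilon,p)$, for $V$ a real power of a shifted $U$, an error $0<\epsilon<A/3$ with $L=2\pi/\epsilon\in\mathbb N$, and a confidence $p$. Let $K=\lceil c_K\epsilon^{-1}\ln^2(\epsilon^{-1})\rceil$ and $M=\lceil c_M|\ln(1-p)|\,\epsilon^{-4}\ln^b(\epsilon^{-1})\rceil$,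 where $c_K,c_M,b$ are fixed constants. (i) For $\mathsf k=1,\dots,K$ run each of the two single-control-qubit circuits with controlled $V^{\mathsf k}$ ($X$- and $Y$-measurement of the control) $M$ times; the mean $\pm1$ outcomes give an estimate $\tilde g(\mathsf k)$ of $g(\mathsf k)=\langle\Psi|V^{\mathsf k}|\Psi\rangle$. Put $\tilde g(0)=1$, $\tilde g(-\mathsf k)=\overline{\tilde g(\mathsf k)}$. (ii) For $l=0,\dots,L-1$ put $\tilde b_l=\sum_{|\mathsf k|\le K}\tilde g(\mathsf k)\tilde f^l(\mathsf k)$, with $\tilde f^l(\mathsf k)$ the Fourier coefficients of the $2\pi$-periodic extension of $f^l(\phi)=\frac{2a}{\epsilon}\int_{l\epsilon-\epsilon/2}^{l\epsilon+\epsilon/2}h\big(\tfrac2\epsilon(\phi-\phi')\big)d\phi'$, where $h(x)=e^{-1/(1-x^2)}$ for $|x|<1$, $h=0$ otherwise, and $a=(\int h)^{-1}$. (iii) Let $S=\{l:\tilde b_l\ge A/3\}$; starting at the smallest $l\notin S$, go once around $\mathbb Z/L$ and remove $l$ from $S$ if $l$ and $l-1$ are both still in $S$. Return $\{l\epsilon\}_{l\in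 S}$. **Algorithm.** Parameters $\epsilon_0,\epsilon,\alpha>0,\gamma>2$, target $\delta_c$; $p(k)=1-e^{-\alpha}(k\delta_c/\pi)^\gamma$. 1. $E=\mathrm{Ext}(U,\epsilon_0,p(1))$. If $E$ is empty or $|E|>n_\phi$, return $\{0\}$. Otherwise let $\zeta$ maximize $\min_{x\in E}|x-\zeta|_T$, let $d_\zeta$ be this maximum, $\chi=\zeta+d_\zeta/2-8\epsilon_0$, and replace $U$ by $Ue^{-i\chi}$ and every $x\in E$ by $(x-\chi)\bmod 2\pi$. Set $d=0$, $k=1$. 2. While $k<2\epsilon/\delta_c$: increase $d$ by $1$, choose a multiplier $\kappa$ as below and replace $k$ by $k\kappa$, so that $k=k_d=\prod_{d'\le d}\kappa_{d'}$. For $d=1$, choose $\kappa\in[3n_\phi,3n_\phi+1]$ such that all distinct $x,y\in E$ satisfy $|\kappa x-\kappa y|_T>4\epsilon_0(1+\kappa)$ or $|x-y|_T<\pi/\kappa$. For $d\ge2$, choose $\kappa\in[2,3]$ such that (with $k$ the new order) all distinct $x,y\in E$ satisfy $|kx-ky|_T>4\epsilon(1+\kappa)$ or $|x-y|_T<(\pi-2\epsilon(1+\kappa))/k$.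 Let $\Theta=\mathrm{Ext}(U^{k},\epsilon,p(k))$ (with the shifted $U$). Leave the loop with the current $E$ if some $x\in E$ has $|kx-\theta|_T>2\epsilon(1+\kappa)$ for all $\theta\in\Theta$, or some $\theta\in\Theta$ has this for all $x\in E$, or $|\Theta|>n_\phi$. Otherwise, for each $\theta\in\Theta$ let $x\in E$ and $m\in\{0,\dots,\lfloor k\rfloor-1\}$ minimize $|x-(\theta+2\pi m)/k|_T$, and let $E'$ be the set of the numbers $(\theta+2\pi m)/k$. If some element of $E'$ lies in $[0,\pi/k)\cup(\pi(2\lfloor k\rfloor-1)/k,2\pi]$, leave the loop with $E$; otherwise replace $E$ by $E'$. 3. Return $\{(x+\chi)\bmod2\pi : x\in E\}$. All open choices ($\zeta$, multipliers, ties) are made by an arbitrary fixed rule depending on the current data; a multiplier must be valid whenever a valid one exists. **Cost.** A run of a circuit with power $r$ of the unitary costs $\lfloor r\rfloor+wM$, where $M$ is the number of repetitions and $w\ge0$ is the overhead constant for fractional powers ($w=0$ counts whole applications only). $T$ is the expected total cost over all runs. **Theorem.** There are constants $c_K,c_M>0$, $b\in\mathbb N$ and exponents $m,D\in\mathbb N$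 such that for all $\alpha>0$, $\gamma>2$ there are $C_1,C_2,C_3>0$ with the following properties. (a) Let $A>0$, let $n_\phi$ be as above, and let $$0<\epsilon_0=\epsilon<\tfrac A3,\qquad \epsilon_0\le\frac{2\pi}{300n_\phi^4},\qquad \epsilon\le\frac{2\pi}{300n_\phi^2},\qquad \frac{2\pi}{\epsilon}\in\mathbb N .$$ Then for every $0<\delta_c<\pi$, every $w\ge0$ and every rule for the open choices, the algorithm solves the multiple eigenvalue estimation problem with accuracy error $\delta=C_1\delta_c$, at total expected quantum cost $$T\le C_2\,(\epsilon^{-6}+w\,\epsilon^{-9})\,\ln^m(\epsilon^{-1})\;\delta^{-1}.$$ (b) The constant is polynomial in $n_\phi$ and $1/A$: for all $n_\phi\ge1$ and $A>0$ with $n_\phi A\le1$ there are $\epsilon_0,\epsilon$ as in (a) with $C_2(\epsilon^{-6}+w\epsilon^{-9})\ln^m(\epsilon^{-1})\le C_3(1+w)(n_\phi+1/A)^D$ for all $w\ge0$. -/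

import Mathlib

open Real
open scoped ENNReal

namespace HeisenbergQPE

/-! ### Phase distance on the circle -/

/-- `|x|_T`, the distance from `x` to the nearest multiple of `2π`; it lies in `[0, π]`. -/
noncomputable def circNorm (x : ℝ) : ℝ := ‖(x : AddCircle (2 * π))‖

/-- `x mod 2π`, the representative in `[0, 2π)`. -/
noncomputable def circMod (x : ℝ) : ℝ := toIcoMod Real.two_pi_pos 0 x

/-! ### The unitary, the input state, and the phase estimation circuits -/

/-- The state space of `N` qubits. -/
abbrev QState (N : ℕ) : Type := EuclideanSpace ℂ (Fin (2 ^ N))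

/-- An `N`-qubit unitary `U` with its eigenstates labelled by their phases in `[0, 2π)` (phases may
repeat), and a normalized input state `Ψ`. -/
structure QPESystem (N : ℕ) where
  /-- the unitary -/
  U : QState N ≃ₗᵢ[ℂ] QState N
  /-- an orthonormal basis of eigenstates -/
  basis : OrthonormalBasis (Fin (2 ^ N)) ℂ (QState N)
  /-- the eigenphases -/
  phase : Fin (2 ^ N) → ℝ
  phase_mem : ∀ j, phase j ∈ Set.Ico 0 (2 * π)
  eigen : ∀ j, U (basis j) = Complex.exp (Complex.I * (phase j : ℂ)) • basis j
  /-- the input state -/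
  Ψ : QState N
  norm_state : ‖Ψ‖ = 1

namespace QPESystem

variable {N : ℕ} (S : QPESystem N)

/-- The probability of the phase `x` in the input state: the squared norm of the component of `Ψ`
in the eigenspace of `e ^ (i x)`. -/
noncomputable def weight (x : ℝ) : ℝ :=
  ∑ j ∈ Finset.univ.filter (fun j => S.phase j = x), ‖inner ℂ (S.basis j) S.Ψ‖ ^ 2

/-- The phases that occur in the input state with nonzero probability. -/
noncomputable def phases : Finset ℝ :=
  (Finset.univ.image S.phase).filter (fun x => S.weight x ≠ 0)

/-- The promise on the input: exactly `n` phases have nonzero probability, and each of these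
probabilities exceeds `A`. -/
def Promise (A : ℝ) (n : ℕ) : Prop :=
  S.phases.card = n ∧ ∀ x ∈ S.phases, A < S.weight x

/-- `(U e ^ (-i χ)) ^ k Ψ` for a shift `χ` and a real power `k`: the unitary `U e ^ (-i χ)` has the
eigenstates of `U`, with the phases `φ_j - χ mod 2π` in `[0, 2π)`. -/
noncomputable def evolved (χ k : ℝ) : QState N :=
  ∑ j, (Complex.exp (Complex.I * ((k * circMod (S.phase j - χ) : ℝ) : ℂ)) *
    inner ℂ (S.basis j) S.Ψ) • S.basis j

theorem norm_evolved (χ k : ℝ) : ‖S.evolved χ k‖ = 1 := by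
  have h1 : ∀ i, ‖inner ℂ (S.basis i) (S.evolved χ k)‖ ^ 2
      = ‖inner ℂ (S.basis i) S.Ψ‖ ^ 2 := by
    intro i
    have : inner ℂ (S.basis i) (S.evolved χ k)
        = Complex.exp (Complex.I * ((k * circMod (S.phase i - χ) : ℝ) : ℂ)) *
          inner ℂ (S.basis i) S.Ψ := by
      unfold evolved
      exact S.basis.orthonormal.inner_right_fintype _ i
    rw [this, norm_mul, mul_comm Complex.I, Complex.norm_exp_ofReal_mul_I, one_mul]
  have h2 := S.basis.sum_sq_norm_inner_right (S.evolved χ k)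
  simp_rw [h1] at h2
  rw [S.basis.sum_sq_norm_inner_right, S.norm_state] at h2
  have h3 : 0 ≤ ‖S.evolved χ k‖ := norm_nonneg _
  nlinarith

/-- The phase factor that the control qubit picks up before it is measured in the `X` basis
(`false`: left circuit, measurement in the `X` basis; `true`: right circuit, measurement in the
`Y` basis). -/
def axisFactor : Bool → ℂ
  | false => 1
  | true => Complex.I

/-- The sign `+1` (`true`) or `-1` (`false`) of a measurement outcome. -/
def sign : Bool → ℝ
  | true => 1
  | false => -1

/-- The probability of outcome `sign o` on the control qubit of the single-control phase estimation
circuit with controlled `(U e ^ (-i χ)) ^ k`. For `χ = 0` it equals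
`(1 ± ∑ j, A_j cos (k φ_j)) / 2` for the left circuit and `(1 ∓ ∑ j, A_j sin (k φ_j)) / 2` for the
right one. -/
noncomputable def outcomeProb (χ k : ℝ) (axis o : Bool) : ℝ :=
  ‖(1 / 2 : ℂ) • (S.Ψ + ((sign o : ℂ) * axisFactor axis) • S.evolved χ k)‖ ^ 2

theorem outcomeProb_sum (χ k : ℝ) (axis : Bool) :
    ∑ o, ENNReal.ofReal (S.outcomeProb χ k axis o) = 1 := by
  have hp : ∀ o, 0 ≤ S.outcomeProb χ k axis o := fun o => sq_nonneg _
  rw [← ENNReal.ofReal_sum_of_nonneg (fun o _ => hp o)]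
  have hv : ‖axisFactor axis • S.evolved χ k‖ = 1 := by
    rw [norm_smul, S.norm_evolved]
    cases axis <;> simp [axisFactor]
  have hpar := parallelogram_law_with_norm ℂ S.Ψ (axisFactor axis • S.evolved χ k)
  rw [hv, S.norm_state] at hpar
  have : ∑ o, S.outcomeProb χ k axis o = 1 := by
    simp only [Fintype.sum_bool, outcomeProb, sign, norm_smul, mul_pow]
    simp only [Complex.ofReal_one, one_mul, Complex.ofReal_neg, neg_mul, neg_smul,
      ← sub_eq_add_neg]
    have h2 : ‖(1 / 2 : ℂ)‖ = 1 / 2 := by norm_num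
    rw [h2]
    linarith
  rw [this, ENNReal.ofReal_one]

/-- One run of the circuit. -/
noncomputable def coin (χ k : ℝ) (axis : Bool) : PMF Bool :=
  PMF.ofFintype (fun o => ENNReal.ofReal (S.outcomeProb χ k axis o)) (S.outcomeProb_sum χ k axis)

end QPESystem

/-- The joint law of independent random variables with laws `p i`. -/
noncomputable def prodPMF {ι α : Type} [Fintype ι] [DecidableEq ι] [Fintype α]
    (p : ι → PMF α) : PMF (ι → α) :=
  PMF.ofFintype (fun x => ∏ i, p i (x i)) (by
    have h := Finset.prod_univ_sum (fun _ : ι => (Finset.univ : Finset α)) (fun i a => p i a)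
    rw [Fintype.piFinset_univ] at h
    rw [← h]
    refine Finset.prod_eq_one fun i _ => ?_
    rw [← tsum_fintype (L := .unconditional _)]
    exact (p i).tsum_coe)

/-! ### Phase function estimation -/

/-- The data of one dense sampling of the phase function at the points `1, …, K`, with `M`
repetitions of each of the two circuits at each point. -/
abbrev Shots (K M : ℕ) : Type := Fin K × Bool × Fin M → Bool

/-- The law of the data for `V = (U e ^ (-i χ)) ^ k`: independent runs of the circuits with
controlled `V ^ 1, …, V ^ K`. -/
noncomputable def sampleShots {N : ℕ} (S : QPESystem N) (χ k : ℝ) (K M : ℕ) : PMF (Shots K M) :=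
  prodPMF fun i => S.coin χ (k * ((i.1 : ℕ) + 1)) i.2.1

/-- The quantum cost of sampling the data. A run of a circuit with power `r` costs
`⌊r⌋ + w * M`, where `w * M` is the allowance for implementing the fractional part of the power
(as `M ≥ 1`, it covers any constant overhead per run; `w = 0` counts only whole applications). -/
noncomputable def samplingCost (w k : ℝ) (K M : ℕ) : ℝ :=
  ∑ i : Fin K, 2 * (M : ℝ) * (⌊k * ((i : ℕ) + 1)⌋₊ + w * M)

/-- The estimate of the phase function at the point `i + 1`; the mean outcome of the right circuit
estimates minus the imaginary part. -/
noncomputable def phaseFunEstimate {K M : ℕ} (x : Shots K M) (i : Fin K) : ℂ :=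
  (((∑ m, QPESystem.sign (x (i, false, m))) / M : ℝ) : ℂ) -
    Complex.I * (((∑ m, QPESystem.sign (x (i, true, m))) / M : ℝ) : ℂ)

/-! ### The time-series solution of the quantum eigenvalue estimation problem -/

/-- The number of bins `⌈2π / ε⌉`. -/
noncomputable def numBins (ε : ℝ) : ℕ := ⌈2 * π / ε⌉₊

/-- The bump `exp (-1 / (1 - x²))` on `(-1, 1)`, zero elsewhere. -/
noncomputable def bumpKernel (x : ℝ) : ℝ := if |x| < 1 then exp (-(1 - x ^ 2)⁻¹) else 0

/-- The normalization constant of the bump (about `2.252`). -/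
noncomputable def bumpConst : ℝ := (∫ x in (-1 : ℝ)..1, bumpKernel x)⁻¹

/-- The approximate indicator function of the bin `[(l - 1) ε, (l + 1) ε]` (to be extended
periodically). -/
noncomputable def binFun (ε : ℝ) (l : ℕ) (φ : ℝ) : ℝ :=
  2 * bumpConst / ε *
    ∫ φ' in ((l : ℝ) * ε - ε / 2)..((l : ℝ) * ε + ε / 2), bumpKernel (2 / ε * (φ - φ'))

/-- The `k`-th Fourier coefficient of the `2π`-periodic extension of `binFun ε l`. -/
noncomputable def binCoeff (ε : ℝ) (l k : ℕ) : ℂ :=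
  (1 / (2 * π) : ℝ) *
    ∫ φ in (((l : ℝ) - 1) * ε)..(((l : ℝ) + 1) * ε),
      (binFun ε l φ : ℂ) * Complex.exp (-(Complex.I * ((k * φ : ℝ) : ℂ)))

/-- The estimate of the weight of bin `l`: the Fourier series `∑ g(k) f_l(k)` over `|k| ≤ K` with
`g(k)` replaced by its estimates, `g(0) = 1`, and `g(-k)`, `f_l(-k)` the complex conjugates of
`g(k)`, `f_l(k)`. -/
noncomputable def binEstimate (ε : ℝ) {K M : ℕ} (x : Shots K M) (l : ℕ) : ℝ :=
  (binCoeff ε l 0).re +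
    2 * (∑ i : Fin K, phaseFunEstimate x i * binCoeff ε l ((i : ℕ) + 1)).re

/-- The parameters of the subroutine: constants in the signal length and the number of repetitions. -/
structure SamplingParams where
  /-- constant of the signal length -/
  cK : ℝ
  /-- constant of the number of repetitions -/
  cM : ℝ
  /-- power of the logarithm in the number of repetitions -/
  b : ℕ
  cK_pos : 0 < cK
  cM_pos : 0 < cM

/-- The signal length `K = ⌈cK ε⁻¹ ln² (ε⁻¹)⌉`. -/
noncomputable def SamplingParams.signalLength (Q : SamplingParams) (ε : ℝ) : ℕ :=
  ⌈Q.cK * ε⁻¹ * log ε⁻¹ ^ 2⌉₊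

/-- The number of repetitions `M = ⌈cM |ln (1 - p)| ε⁻⁴ ln ^ b (ε⁻¹)⌉`. -/
noncomputable def SamplingParams.repetitions (Q : SamplingParams) (ε p : ℝ) : ℕ :=
  ⌈Q.cM * |log (1 - p)| * ε⁻¹ ^ 4 * log ε⁻¹ ^ Q.b⌉₊

/-! ### Conservative eigenvalue extraction -/

/-- The bins with estimated weight at least `A / 3`. -/
noncomputable def heavyBins (A ε : ℝ) (bt : ℕ → ℝ) : Finset ℕ :=
  (Finset.range (numBins ε)).filter fun l => A / 3 ≤ bt l

/-- Pruning of a set of bins out of `L` cyclically ordered ones: start at the smallest index outside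
the set, go once around the circle, and remove an index if its predecessor is still there. -/
noncomputable def prune (L : ℕ) (T : Finset ℕ) : Finset ℕ :=
  (List.range L).foldl
    (fun T' i =>
      let l := (sInf {m : ℕ | m ∉ T} + i) % L
      if l ∈ T' ∧ (l + (L - 1)) % L ∈ T' then T'.erase l else T') T

/-- The extracted phase estimates `l ε`. -/
noncomputable def extractPhases (A ε : ℝ) (bt : ℕ → ℝ) : Finset ℝ :=
  (prune (numBins ε) (heavyBins A ε bt)).image fun l : ℕ => (l : ℝ) * ε

/-- One call of the extraction subroutine for `V = (U e ^ (-i χ)) ^ k` with error parameter `ε`,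
probability bound `A` and confidence `p`. -/
noncomputable def extraction (Q : SamplingParams) {N : ℕ} (S : QPESystem N) (A χ k ε p : ℝ) :
    PMF (Finset ℝ) :=
  (sampleShots S χ k (Q.signalLength ε) (Q.repetitions ε p)).map
    fun x => extractPhases A ε (binEstimate ε x)

/-- The quantum cost of one call of the extraction subroutine. -/
noncomputable def extractionCost (Q : SamplingParams) (w k ε p : ℝ) : ℝ :=
  samplingCost w k (Q.signalLength ε) (Q.repetitions ε p)

/-! ### The adaptive multi-order algorithm -/

/-- The requirements on the error parameters for `n` phases of probability more than `A`: both obey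
the bounds of the algorithm and of the extraction subroutine, they are equal, and the bins of width
`ε` tile the circle. -/
structure AdmissibleErrors (n : ℕ) (A ε₀ ε : ℝ) : Prop where
  pos : 0 < ε
  pos_init : 0 < ε₀
  le_init : ε₀ ≤ 2 * π / (300 * (n : ℝ) ^ 4)
  le : ε ≤ 2 * π / (300 * (n : ℝ) ^ 2)
  lt_init : ε₀ < A / 3
  lt : ε < A / 3
  eq : ε₀ = ε
  tile : ∃ L : ℕ, (L : ℝ) * ε = 2 * π

/-- The confidence `1 - e ^ (-α) (k δc / π) ^ γ` at order `k`. -/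
noncomputable def confidence (α γ δc k : ℝ) : ℝ := 1 - exp (-α) * (k * δc / π) ^ γ

/-- The distance from the point `z` of the circle to the set `E`. -/
noncomputable def gapAt (E : Finset ℝ) (z : ℝ) : ℝ := sInf ((fun x => circNorm (x - z)) '' (E : Set ℝ))

/-- `κ` is a valid first multiplier `k₁` for the estimates `E`. -/
def ValidFirst (n : ℕ) (ε₀ : ℝ) (E : Finset ℝ) (κ : ℝ) : Prop :=
  κ ∈ Set.Icc (3 * (n : ℝ)) (3 * n + 1) ∧
    ∀ x ∈ E, ∀ y ∈ E, x ≠ y →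
      4 * ε₀ * (1 + κ) < circNorm (x * κ - y * κ) ∨ circNorm (x - y) < π / κ

/-- `κ` is a valid multiplier after order `k`, for the estimates `E`. -/
def ValidNext (ε k : ℝ) (E : Finset ℝ) (κ : ℝ) : Prop :=
  κ ∈ Set.Icc (2 : ℝ) 3 ∧
    ∀ x ∈ E, ∀ y ∈ E, x ≠ y →
      4 * ε * (1 + κ) < circNorm (x * k * κ - y * k * κ) ∨
        circNorm (x - y) < (π - 2 * ε * (1 + κ)) / (k * κ)

/-- The choices that the algorithm leaves open: the point in the middle of a largest gap, the
multipliers, and the ties in the matching step. A multiplier has to be valid whenever there is a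
valid one. -/
structure ChoiceRule (n : ℕ) (ε₀ ε : ℝ) where
  /-- the point farthest from the estimates -/
  zeta : Finset ℝ → ℝ
  zeta_mem : ∀ E, E.Nonempty → zeta E ∈ Set.Ico 0 (2 * π)
  zeta_max : ∀ E, E.Nonempty → ∀ z ∈ Set.Icc 0 (2 * π), gapAt E z ≤ gapAt E (zeta E)
  /-- the first multiplier -/
  first : Finset ℝ → ℝ
  first_valid : ∀ E, (∃ κ, ValidFirst n ε₀ E κ) → ValidFirst n ε₀ E (first E)
  /-- the multiplier after round `d`, at order `k` -/
  next : ℕ → ℝ → Finset ℝ → ℝ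
  next_valid : ∀ d k E, (∃ κ, ValidNext ε k E κ) → ValidNext ε k E (next d k E)
  /-- the integer in `{0, …, ⌊k⌋ - 1}` that matches the new estimate `θ` best with one of the old
  estimates `E` -/
  branch : ℝ → Finset ℝ → ℝ → ℕ
  branch_lt : ∀ k E θ, 1 ≤ k → E.Nonempty → branch k E θ < ⌊k⌋₊
  branch_min : ∀ k E θ, 1 ≤ k → E.Nonempty → ∃ x ∈ E, ∀ y ∈ E, ∀ m < ⌊k⌋₊,
    circNorm (x - (θ + 2 * π * branch k E θ) / k) ≤ circNorm (y - (θ + 2 * π * m) / k)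

/-- The test at order `k = k_d` with multiplier `κ = κ_d`: an old estimate in `E` has no new estimate
in `Θ` near it, or a new one has no old one near it. -/
def Mismatch (ε κ k : ℝ) (E Θ : Finset ℝ) : Prop :=
  (∃ x ∈ E, ∀ θ ∈ Θ, 2 * ε * (1 + κ) < circNorm (k * x - θ)) ∨
    (∃ θ ∈ Θ, ∀ x ∈ E, 2 * ε * (1 + κ) < circNorm (k * x - θ))

/-- Some estimate is too close to the branch cut at order `k`. -/
def NearCut (k : ℝ) (E : Finset ℝ) : Prop :=
  ∃ x ∈ E, x ∈ Set.Ico 0 (π / k) ∪ Set.Ioc (π * (2 * ⌊k⌋₊ - 1) / k) (2 * π)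

/-- The inputs of the algorithm. -/
structure AlgInput where
  /-- the number of phases -/
  n : ℕ
  /-- the probability bound -/
  A : ℝ
  /-- the error parameter of the initial round -/
  ε₀ : ℝ
  /-- the error parameter of the later rounds -/
  ε : ℝ
  /-- first constant in the confidence -/
  α : ℝ
  /-- second constant in the confidence -/
  γ : ℝ
  /-- the targeted final error -/
  δc : ℝ
  /-- the overhead constant in the cost of real powers -/
  w : ℝ

section algorithm
open Classical in
/-- The loop, entered after round `d` at order `k = k_d` with the (shifted) estimates `E` of that
round; it returns the final shifted estimates and the quantum cost. The first argument bounds the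
number of rounds. -/
noncomputable def adaptiveLoop (Q : SamplingParams) {N : ℕ} (S : QPESystem N) (I : AlgInput)
    (R : ChoiceRule I.n I.ε₀ I.ε) (χ : ℝ) : ℕ → ℕ → ℝ → Finset ℝ → PMF (Finset ℝ × ℝ)
  | 0, _, _, E => PMF.pure (E, 0)
  | fuel + 1, d, k, E =>
    if k < 2 * I.ε / I.δc then
      let κ := if d = 0 then R.first E else R.next d k E
      let k' := k * κ
      let p := confidence I.α I.γ I.δc k'
      let c := extractionCost Q I.w k' I.ε p
      (extraction Q S I.A χ k' I.ε p).bind fun Θ =>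
        if Mismatch I.ε κ k' E Θ ∨ I.n < Θ.card then PMF.pure (E, c)
        else
          let E' := Θ.image fun θ => (θ + 2 * π * R.branch k' E θ) / k'
          if NearCut k' E' then PMF.pure (E, c)
          else (adaptiveLoop Q S I R χ fuel (d + 1) k' E').map fun r => (r.1, c + r.2)
    else PMF.pure (E, 0)

open Classical in
/-- The adaptive multi-order phase estimation algorithm: the joint law of the set of estimates and of
the quantum cost. As the order starts at `1` and at least doubles in every round, at most
`⌈2 ε / δc⌉` rounds are needed. -/
noncomputable def adaptiveAlgorithm (Q : SamplingParams) {N : ℕ} (S : QPESystem N) (I : AlgInput)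
    (R : ChoiceRule I.n I.ε₀ I.ε) : PMF (Finset ℝ × ℝ) :=
  let p := confidence I.α I.γ I.δc 1
  let c := extractionCost Q I.w 1 I.ε₀ p
  (extraction Q S I.A 0 1 I.ε₀ p).bind fun Φ =>
    if Φ = ∅ ∨ I.n < Φ.card then PMF.pure ({0}, c)
    else
      let χ := R.zeta Φ + gapAt Φ (R.zeta Φ) / 2 - 8 * I.ε₀
      (adaptiveLoop Q S I R χ ⌈2 * I.ε / I.δc⌉₊ 0 1 (Φ.image fun x => circMod (x - χ))).map
        fun r => (r.1.image fun x => circMod (x + χ), c + r.2)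

end algorithm

/-! ### The multiple eigenvalue estimation problem -/

/-- The distance from the phase `x` to the closest estimate in the (nonempty) set `E`. -/
noncomputable def closestError (E : Finset ℝ) (x : ℝ) : ℝ :=
  sInf ((fun y => circNorm (y - x)) '' (E : Set ℝ))

/-- The accuracy error for the phase `x`: the root mean square of the distance from `x` to the closest
estimate. -/
noncomputable def rmsError (P : PMF (Finset ℝ × ℝ)) (x : ℝ) : ℝ≥0∞ :=
  (∑' r, P r * ENNReal.ofReal (closestError r.1 x ^ 2)) ^ (1 / 2 : ℝ)

/-- The expected quantum cost. -/
noncomputable def expectedCost (P : PMF (Finset ℝ × ℝ)) : ℝ≥0∞ :=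
  ∑' r, P r * ENNReal.ofReal r.2

/-- `P` solves the multiple eigenvalue estimation problem with accuracy error `δ`: the output is always
a nonempty set of at most `n` estimates, and every phase is estimated with accuracy error at most
`δ`. -/
def SolvesMEEP {N : ℕ} (S : QPESystem N) (n : ℕ) (δ : ℝ) (P : PMF (Finset ℝ × ℝ)) : Prop :=
  (∀ r ∈ P.support, r.1.Nonempty ∧ r.1.card ≤ n) ∧
    ∀ x ∈ S.phases, rmsError P x ≤ ENNReal.ofReal δ

end HeisenbergQPE

namespace HeisenbergQPE

/-! The extraction is first reduced to one likely event, `IsExtracted`: every phase has an estimate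
within `2ε`, every estimate has a phase within `ε`, and there are at most `n` estimates. The bump is
of Gevrey class 2. Bounding the Fourier tail by a decay of order about `ln ε⁻¹` shows that a signal
of length of order `ε⁻¹ ln² ε⁻¹` determines every bin weight up to a small multiple of `ε`. By
Chernoff and a union bound, all samples are accurate to order `1/K` outside an event of probability
`O(1 - p)`. Thresholding and pruning are then deterministic (`isExtracted_of_close`,
`exists_samplingParams`).

A valid multiplier exists because the bad ones in a unit interval have total measure below `1`
(`exists_separating_multiplier`). Validity makes the choice of branch unambiguous (`branch_eq`).
Hence a successful extraction turns estimates with error `O(ε/k)` into estimates with error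
`O(ε/(kκ))` and passes every test (`IsAccurate.newEstimates`, `IsAccurate.not_mismatch`). A failed
extraction either stops the loop or is consistent with the old estimates, and then moves them by at
most `3ε/k`. Since the orders at least double, these drifts sum geometrically: whatever happens
after order `k`, the output stays within `6ε/k` of the estimates held there
(`adaptiveLoop_support`), so within `8ε/k` of the phases if those estimates were accurate.

Failure at order `k' = kκ` has probability `O((k'δc/π)^γ)`, so it contributes `O(δc²
(k'δc/π)^(γ-2))` to the mean square error. As `γ > 2`, this is a geometric series dominated by the
last rounds, with sum `O(δc²)`. The cost at order `k` is, up to the `ε` factor, at most `δc⁻¹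
(√(kδc/π) + 1/k)`. Both terms sum geometrically, so no logarithm of `δc` survives. The sequence of
orders is random, so both sums are carried by potentials depending on the current order
(`exists_error_potential`, `exists_cost_potential`). The cost bound holds on every run.

For the polynomial dependence, `2π/ε` is taken of size `n⁴ + 1/A`. -/

/-! ### Distance and gaps on the circle. -/

theorem circNorm_nonneg (x : ℝ) : 0 ≤ circNorm x := norm_nonneg _

theorem circNorm_add_int_mul (x : ℝ) (m : ℤ) : circNorm (x + 2 * π * m) = circNorm x := by
  unfold circNorm
  congr 1
  have := AddCircle.coe_add_period (2 * π) x
  rw [AddCircle.coe_add]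
  have h : ((2 * π * m : ℝ) : AddCircle (2 * π)) = 0 := by
    rw [AddCircle.coe_eq_zero_iff]
    exact ⟨m, by simp [mul_comm]⟩
  rw [h, add_zero]

theorem circNorm_le_abs (x : ℝ) : circNorm x ≤ |x| :=
  QuotientAddGroup.norm_mk_le_norm

theorem circNorm_le_abs_sub (x : ℝ) (m : ℤ) : circNorm x ≤ |x - 2 * π * m| := by
  have := circNorm_le_abs (x - 2 * π * m)
  rwa [← circNorm_add_int_mul _ m, sub_add_cancel] at this

theorem exists_circNorm_eq (x : ℝ) : ∃ m : ℤ, circNorm x = |x - 2 * π * m| :=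
  ⟨round ((2 * π)⁻¹ * x), by rw [circNorm, AddCircle.norm_eq, mul_comm (2 * π) (round _ : ℝ)]⟩

theorem circNorm_le_iff {x r : ℝ} : circNorm x ≤ r ↔ ∃ m : ℤ, |x - 2 * π * m| ≤ r := by
  constructor
  · intro h
    obtain ⟨m, hm⟩ := exists_circNorm_eq x
    exact ⟨m, hm ▸ h⟩
  · rintro ⟨m, hm⟩
    exact (circNorm_le_abs_sub x m).trans hm

theorem circNorm_le_pi (x : ℝ) : circNorm x ≤ π := by
  have h := AddCircle.norm_le_half_period (p := 2 * π) (x := (x : AddCircle (2 * π)))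
    (by positivity)
  rw [abs_of_pos two_pi_pos] at h
  unfold circNorm
  linarith

theorem circNorm_neg (x : ℝ) : circNorm (-x) = circNorm x := by
  unfold circNorm
  rw [AddCircle.coe_neg, norm_neg]

theorem circNorm_sub_comm (x y : ℝ) : circNorm (x - y) = circNorm (y - x) := by
  rw [← circNorm_neg, neg_sub]

theorem circNorm_add_le (x y : ℝ) : circNorm (x + y) ≤ circNorm x + circNorm y := by
  unfold circNorm
  rw [AddCircle.coe_add]
  exact norm_add_le _ _

theorem circNorm_sub_le (x y z : ℝ) : circNorm (x - z) ≤ circNorm (x - y) + circNorm (y - z) := by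
  have := circNorm_add_le (x - y) (y - z)
  rwa [sub_add_sub_cancel] at this

theorem circMod_mem (x : ℝ) : circMod x ∈ Set.Ico 0 (2 * π) := by
  have := toIcoMod_mem_Ico two_pi_pos 0 x
  rwa [zero_add] at this

theorem exists_circMod_eq (x : ℝ) : ∃ m : ℤ, circMod x = x + 2 * π * m := by
  refine ⟨-toIcoDiv two_pi_pos 0 x, ?_⟩
  rw [circMod, ← self_sub_toIcoDiv_zsmul, zsmul_eq_mul]
  push_cast
  ring

theorem circNorm_circMod_sub (x y : ℝ) : circNorm (circMod x - y) = circNorm (x - y) := by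
  obtain ⟨m, hm⟩ := exists_circMod_eq x
  rw [hm, show x + 2 * π * m - y = (x - y) + 2 * π * m by ring, circNorm_add_int_mul]

theorem circNorm_sub_circMod (x y : ℝ) : circNorm (x - circMod y) = circNorm (x - y) := by
  rw [circNorm_sub_comm, circNorm_circMod_sub, circNorm_sub_comm]

/-- Two points of `[0, 2π]`, one of which is farther than `r` from both ends, are as close on the
circle as on the line if they are `r`-close on the circle. -/
theorem abs_sub_le_of_circNorm_le {x y r : ℝ} (h : circNorm (x - y) ≤ r)
    (hy : y ∈ Set.Icc 0 (2 * π)) (h₁ : r < x) (h₂ : x < 2 * π - r) : |x - y| ≤ r := by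
  obtain ⟨m, hm⟩ := circNorm_le_iff.1 h
  obtain ⟨hy0, hy1⟩ := hy
  have hpi := pi_pos
  rw [abs_le] at hm
  have hm1 : m < 1 := by
    by_contra hcon
    have : (1 : ℝ) ≤ m := by exact_mod_cast not_lt.1 hcon
    nlinarith
  have hm2 : -1 < m := by
    by_contra hcon
    have : (m : ℝ) ≤ -1 := by exact_mod_cast not_lt.1 hcon
    nlinarith
  have : m = 0 := by omega
  subst this
  rw [Int.cast_zero, mul_zero, sub_zero] at hm
  exact abs_le.2 hm

/-- Finitely many arcs of radius `r` cover the circle only if their total length is at least `2π`. -/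
theorem pi_le_card_mul_of_cover (E : Finset ℝ) {r : ℝ} (hr : 0 ≤ r)
    (h : ∀ z ∈ Set.Icc 0 (2 * π), ∃ x ∈ E, circNorm (x - z) ≤ r) : π ≤ E.card * r := by
  have : Fact (0 < 2 * π) := ⟨two_pi_pos⟩
  have hcov : (Set.univ : Set (AddCircle (2 * π))) ⊆
      ⋃ x ∈ E, Metric.closedBall (x : AddCircle (2 * π)) r := by
    intro z _
    induction z using QuotientAddGroup.induction_on with
    | H z =>
      obtain ⟨x, hx, hxz⟩ := h (circMod z) (Set.Ico_subset_Icc_self (circMod_mem z))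
      rw [circNorm_sub_circMod, circNorm_sub_comm] at hxz
      simp only [Set.mem_iUnion]
      refine ⟨x, hx, ?_⟩
      rw [Metric.mem_closedBall, dist_eq_norm]
      exact hxz
  have h1 := (MeasureTheory.measure_mono hcov).trans
    (MeasureTheory.measure_biUnion_finset_le (μ := MeasureTheory.volume) E
      (fun x => Metric.closedBall (x : AddCircle (2 * π)) r))
  rw [AddCircle.measure_univ] at h1
  have h2 : ∑ x ∈ E, MeasureTheory.volume (Metric.closedBall (x : AddCircle (2 * π)) r)
      ≤ ENNReal.ofReal (E.card * (2 * r)) := by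
    rw [ENNReal.ofReal_mul (by positivity), ENNReal.ofReal_natCast, ← nsmul_eq_mul]
    refine Finset.sum_le_card_nsmul _ _ _ fun x _ => ?_
    rw [AddCircle.volume_closedBall]
    exact ENNReal.ofReal_le_ofReal (min_le_right _ _)
  have h3 := h1.trans h2
  rw [ENNReal.ofReal_le_ofReal_iff (by positivity)] at h3
  linarith

theorem gapAt_le {E : Finset ℝ} {x : ℝ} (hx : x ∈ E) (z : ℝ) : gapAt E z ≤ circNorm (x - z) :=
  csInf_le ⟨0, by rintro _ ⟨y, _, rfl⟩; exact circNorm_nonneg _⟩ ⟨x, hx, rfl⟩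

theorem exists_gapAt_eq {E : Finset ℝ} (hE : E.Nonempty) (z : ℝ) :
    ∃ x ∈ E, gapAt E z = circNorm (x - z) := by
  have hfin : ((fun x => circNorm (x - z)) '' (E : Set ℝ)).Finite := E.finite_toSet.image _
  obtain ⟨x, hx, h⟩ := (hE.to_set.image _).csInf_mem hfin
  exact ⟨x, hx, h.symm⟩

theorem closestError_le {E : Finset ℝ} {y : ℝ} (hy : y ∈ E) (x : ℝ) :
    closestError E x ≤ circNorm (y - x) := gapAt_le hy x

theorem closestError_nonneg (E : Finset ℝ) (x : ℝ) : 0 ≤ closestError E x :=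
  Real.sInf_nonneg (by rintro _ ⟨y, _, rfl⟩; exact circNorm_nonneg _)

theorem closestError_le_pi {E : Finset ℝ} (x : ℝ) : closestError E x ≤ π := by
  rcases E.eq_empty_or_nonempty with rfl | ⟨y, hy⟩
  -- For the empty set the infimum is `0` by convention.
  · simp [closestError, pi_pos.le]
  · exact (closestError_le hy x).trans (circNorm_le_pi _)

/-- The largest gap between `n` points is at least `2π / n`. -/
theorem pi_div_le_gapAt {E : Finset ℝ} (hE : E.Nonempty) {n : ℕ} (hn : E.card ≤ n) {ζ : ℝ}
    (hζ : ∀ z ∈ Set.Icc 0 (2 * π), gapAt E z ≤ gapAt E ζ) : π ≤ n * gapAt E ζ := by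
  obtain ⟨x, -, hx⟩ := exists_gapAt_eq hE ζ
  have h0 : 0 ≤ gapAt E ζ := hx ▸ circNorm_nonneg _
  refine (pi_le_card_mul_of_cover E h0 fun z hz => ?_).trans
    (mul_le_mul_of_nonneg_right (by exact_mod_cast hn) h0)
  obtain ⟨y, hy, h⟩ := exists_gapAt_eq hE z
  exact ⟨y, hy, h ▸ hζ z hz⟩

/-! ### Existence of valid multipliers. -/

/-- The measure of the multipliers in a unit interval that bring `D` close to a multiple of `2π`. -/
theorem volume_circNorm_mul_le {D η : ℝ} (hD : 0 < D) (hη : 0 ≤ η) (a : ℝ) :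
    MeasureTheory.volume {κ : ℝ | κ ∈ Set.Icc a (a + 1) ∧ circNorm (D * κ) ≤ η}
      ≤ ENNReal.ofReal (η / π + 2 * η / D * (1 + η / π)) := by
  have hpi := pi_pos
  set lo : ℝ := (D * a - η) / (2 * π)
  set hi : ℝ := (D * (a + 1) + η) / (2 * π)
  -- Only the multiples `2πm` with `lo ≤ m ≤ hi` can be approached, at most `D/(2π) + η/π + 1` of
  -- them, and each excludes an interval of length `2η/D`.
  have hsub : {κ : ℝ | κ ∈ Set.Icc a (a + 1) ∧ circNorm (D * κ) ≤ η} ⊆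
      ⋃ m ∈ Finset.Icc ⌈lo⌉ ⌊hi⌋,
        Set.Icc ((2 * π * (m : ℝ) - η) / D) ((2 * π * (m : ℝ) + η) / D) := by
    rintro κ ⟨⟨h1, h2⟩, h3⟩
    obtain ⟨m, hm⟩ := circNorm_le_iff.1 h3
    rw [abs_le] at hm
    simp only [Set.mem_iUnion, Finset.mem_Icc, Set.mem_Icc]
    have h4 : D * a ≤ D * κ := by gcongr
    have h5 : D * κ ≤ D * (a + 1) := by gcongr
    refine ⟨m, ⟨Int.ceil_le.2 ?_, Int.le_floor.2 ?_⟩, ?_, ?_⟩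
    · rw [div_le_iff₀ (by positivity)]; linarith
    · rw [le_div_iff₀ (by positivity)]; linarith
    · rw [div_le_iff₀ hD]; linarith
    · rw [le_div_iff₀ hD]; linarith
  refine (MeasureTheory.measure_mono hsub).trans
    ((MeasureTheory.measure_biUnion_finset_le _ _).trans ?_)
  have hvol : ∀ m : ℤ, MeasureTheory.volume
      (Set.Icc ((2 * π * (m : ℝ) - η) / D) ((2 * π * (m : ℝ) + η) / D))
        = ENNReal.ofReal (2 * η / D) := by
    intro m
    rw [Real.volume_Icc]
    congr 1
    ring
  have hlohi : hi - lo = D / (2 * π) + η / π := by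
    simp only [hi, lo]
    field_simp
    ring
  have hcard : ((Finset.Icc ⌈lo⌉ ⌊hi⌋).card : ℝ) ≤ D / (2 * π) + η / π + 1 := by
    rw [Int.card_Icc]
    have hpos : 0 ≤ D / (2 * π) + η / π + 1 := by positivity
    have h6 : ((⌊hi⌋ + 1 - ⌈lo⌉ : ℤ) : ℝ) ≤ D / (2 * π) + η / π + 1 := by
      push_cast
      linarith [Int.floor_le hi, Int.le_ceil lo]
    rcases le_total 0 (⌊hi⌋ + 1 - ⌈lo⌉) with h | h
    · have : (((⌊hi⌋ + 1 - ⌈lo⌉).toNat : ℤ) : ℝ) = ((⌊hi⌋ + 1 - ⌈lo⌉ : ℤ) : ℝ) := by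
        rw [Int.toNat_of_nonneg h]
      rw [Int.cast_natCast] at this
      rwa [this]
    · rw [Int.toNat_of_nonpos h]
      simpa using hpos
  simp_rw [hvol]
  rw [Finset.sum_const, nsmul_eq_mul, ← ENNReal.ofReal_natCast,
    ← ENNReal.ofReal_mul (by positivity)]
  refine ENNReal.ofReal_le_ofReal ?_
  calc ((Finset.Icc ⌈lo⌉ ⌊hi⌋).card : ℝ) * (2 * η / D)
      ≤ (D / (2 * π) + η / π + 1) * (2 * η / D) := by gcongr
    _ = η / π + 2 * η / D * (1 + η / π) := by field_simp; ring

/-- Some multiplier in a unit interval separates all pairs of points that are not too close. -/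
theorem exists_separating_multiplier {E : Finset ℝ} {n : ℕ} (hn : E.card ≤ n) (a k : ℝ)
    {η D₀ : ℝ} (hη : 0 ≤ η) (hD₀ : 0 < D₀)
    (hsmall : (n : ℝ) * (n - 1) * (η / π + 2 * η / D₀ * (1 + η / π)) < 1) :
    ∃ κ ∈ Set.Icc a (a + 1), ∀ x ∈ E, ∀ y ∈ E, D₀ ≤ |x * k - y * k| →
      η < circNorm ((x * k - y * k) * κ) := by
  have hpi := pi_pos
  by_contra! hcon
  set β : ℝ := η / π + 2 * η / D₀ * (1 + η / π)
  have hβ : 0 ≤ β := by positivity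
  -- The absolute value makes the factor positive, as `volume_circNorm_mul_le` requires; the guard
  -- `D₀ ≤ _` leaves nothing bad for close pairs.
  let bad : ℝ × ℝ → Set ℝ := fun q =>
    {κ : ℝ | κ ∈ Set.Icc a (a + 1) ∧ (D₀ ≤ |q.1 * k - q.2 * k| ∧
      circNorm (|q.1 * k - q.2 * k| * κ) ≤ η)}
  have hcov : Set.Icc a (a + 1) ⊆ ⋃ q ∈ E.offDiag, bad q := by
    intro κ hκ
    obtain ⟨x, hx, y, hy, h1, h2⟩ := hcon κ hκ
    simp only [Set.mem_iUnion]
    refine ⟨(x, y), ?_, hκ, h1, ?_⟩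
    · rw [Finset.mem_offDiag]
      refine ⟨hx, hy, ?_⟩
      intro (h : x = y)
      rw [h, sub_self, abs_zero] at h1
      linarith
    · rcases abs_choice (x * k - y * k) with h | h
      · simpa only [h] using h2
      · simp only [h]
        rwa [neg_mul, circNorm_neg]
  have hbad : ∀ q ∈ E.offDiag, MeasureTheory.volume (bad q) ≤ ENNReal.ofReal β := by
    intro q _
    by_cases hq : D₀ ≤ |q.1 * k - q.2 * k|
    · refine (MeasureTheory.measure_mono ?_).trans
        ((volume_circNorm_mul_le (hD₀.trans_le hq) hη a).trans (ENNReal.ofReal_le_ofReal ?_))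
      · exact fun κ h => ⟨h.1, h.2.2⟩
      · simp only [β]
        gcongr
    · have : bad q = ∅ := Set.eq_empty_of_forall_notMem fun κ h => hq h.2.1
      rw [this]
      simp
  have h1 := (MeasureTheory.measure_mono hcov).trans
    ((MeasureTheory.measure_biUnion_finset_le (μ := MeasureTheory.volume) _ _).trans
      (Finset.sum_le_card_nsmul _ _ _ hbad))
  rw [Real.volume_Icc, nsmul_eq_mul, ← ENNReal.ofReal_natCast,
    ← ENNReal.ofReal_mul (by positivity), ENNReal.ofReal_le_ofReal_iff (by positivity),
    Finset.offDiag_card] at h1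
  have h2 : ((E.card * E.card - E.card : ℕ) : ℝ) ≤ n * (n - 1) := by
    rw [Nat.cast_sub (Nat.le_mul_self _)]
    push_cast
    have h3 : (E.card : ℝ) ≤ n := by exact_mod_cast hn
    rcases Nat.eq_zero_or_pos E.card with h | h
    · rw [h]
      rcases Nat.eq_zero_or_pos n with h' | h'
      · simp [h']
      · have : (1 : ℝ) ≤ n := by exact_mod_cast h'
        push_cast
        nlinarith
    · have : (1 : ℝ) ≤ E.card := by exact_mod_cast h
      nlinarith
  have h3 := mul_le_mul_of_nonneg_right h2 hβ
  linarith

theorem AdmissibleErrors.one_le {n : ℕ} {A ε₀ ε : ℝ} (h : AdmissibleErrors n A ε₀ ε) :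
    (1 : ℝ) ≤ n := by
  have h1 := h.le
  have h2 := h.pos
  rcases Nat.eq_zero_or_pos n with rfl | hn
  · simp at h1
    linarith
  · exact_mod_cast hn

theorem AdmissibleErrors.sq_mul_le {n : ℕ} {A ε₀ ε : ℝ} (h : AdmissibleErrors n A ε₀ ε) :
    (n : ℝ) ^ 2 * ε ≤ π / 150 := by
  have h1 := h.le
  have hn := h.one_le
  rw [le_div_iff₀ (by positivity)] at h1
  linarith

theorem AdmissibleErrors.pow_four_mul_le {n : ℕ} {A ε₀ ε : ℝ} (h : AdmissibleErrors n A ε₀ ε) :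
    (n : ℝ) ^ 4 * ε ≤ π / 150 := by
  have h1 := h.le_init
  have hn := h.one_le
  rw [le_div_iff₀ (by positivity), h.eq] at h1
  linarith

/-- Pairs closer than `π/κ` are exempt, so only distances of at least `π/(3n+1)` matter. With
tolerance of order `nε`, one pair excludes measure of order `n²ε`; over `n(n-1)` ordered pairs this
is of order `n⁴ε`, which is why `ε₀` must be small against `n⁻⁴`. -/
theorem exists_validFirst {n : ℕ} {A ε₀ ε : ℝ} (h : AdmissibleErrors n A ε₀ ε) {E : Finset ℝ}
    (hE : E.card ≤ n) : ∃ κ, ValidFirst n ε₀ E κ := by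
  have hpi := pi_pos
  have hn := h.one_le
  have hε := h.pos
  have h4 := h.pow_four_mul_le
  set x : ℝ := (n : ℝ)
  have hη0 : 4 * ε * (3 * x + 2) * x ^ 3 ≤ 2 * π / 15 := by
    calc 4 * ε * (3 * x + 2) * x ^ 3 ≤ 4 * ε * (5 * x) * x ^ 3 := by gcongr; linarith
      _ = 20 * (x ^ 4 * ε) := by ring
      _ ≤ 2 * π / 15 := by linarith
  have hη1 : 4 * ε * (3 * x + 2) / π ≤ 2 / 15 := by
    rw [div_le_iff₀ hpi]
    refine le_trans ?_ (hη0.trans (by linarith))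
    exact le_mul_of_one_le_right (by positivity) (one_le_pow₀ hn)
  obtain ⟨κ, hκ, hsep⟩ := exists_separating_multiplier hE (3 * x) 1
    (η := 4 * ε * (3 * x + 2)) (D₀ := π / (3 * x + 1)) (by positivity) (by positivity) (by
      have e1 : 2 * (4 * ε * (3 * x + 2)) / (π / (3 * x + 1)) =
          4 * ε * (3 * x + 2) / π * (2 * (3 * x + 1)) := by
        field_simp
      rw [e1]
      set t := 4 * ε * (3 * x + 2) / π with ht
      have ht0 : 0 ≤ t := by positivity
      have hb : t + t * (2 * (3 * x + 1)) * (1 + t) ≤ t * (11 * x) := by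
        have : t * (2 * (3 * x + 1)) * (1 + t) ≤ t * (2 * (3 * x + 1)) * (17 / 15) := by
          gcongr; linarith
        nlinarith
      have ht1 : t * (x - 1) * x ^ 2 ≤ 2 / 25 := by
        have e2 : t * (x - 1) * x ^ 2 * π ≤ 12 * (x ^ 4 * ε) := by
          have : t * π = 4 * ε * (3 * x + 2) := by rw [ht]; field_simp
          calc t * (x - 1) * x ^ 2 * π = (t * π) * ((x - 1) * x ^ 2) := by ring
            _ = 4 * ε * x ^ 2 * ((3 * x + 2) * (x - 1)) := by rw [this]; ring
            _ ≤ 4 * ε * x ^ 2 * (3 * x ^ 2) :=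
              mul_le_mul_of_nonneg_left (by nlinarith) (by positivity)
            _ = _ := by ring
        have e3 : t * (x - 1) * x ^ 2 * π ≤ 2 / 25 * π := by linarith
        exact le_of_mul_le_mul_right e3 hpi
      calc x * (x - 1) * (t + t * (2 * (3 * x + 1)) * (1 + t))
          ≤ x * (x - 1) * (t * (11 * x)) := by
            gcongr
        _ = 11 * (t * (x - 1) * x ^ 2) := by ring
        _ < 1 := by linarith)
  have hκ0 : 0 < κ := by linarith [hκ.1]
  refine ⟨κ, hκ, fun y hy z hz _ => ?_⟩
  by_contra! hcon
  have hd : π / (3 * x + 1) ≤ |y * 1 - z * 1| := by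
    rw [mul_one, mul_one]
    refine le_trans ?_ (hcon.2.trans (circNorm_le_abs _))
    exact div_le_div_of_nonneg_left hpi.le hκ0 hκ.2
  have h5 := hsep y hy z hz hd
  have h6 : 4 * ε₀ * (1 + κ) ≤ 4 * ε * (3 * x + 2) := by
    rw [h.eq]
    exact mul_le_mul_of_nonneg_left (by linarith [hκ.2]) (by positivity)
  have h7 := hcon.1
  rw [mul_one, mul_one, sub_mul] at h5
  linarith

/-- In the stretched coordinate `k x` the pairs that matter are at distance at least `(π - 8ε)/3 ≥
5π/16`, independently of `n` and `k`. With tolerance `16ε`, one pair excludes `O(ε)`, so smallness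
against `n⁻²` suffices. -/
theorem exists_validNext {n : ℕ} {A ε₀ ε : ℝ} (h : AdmissibleErrors n A ε₀ ε) {E : Finset ℝ}
    (hE : E.card ≤ n) {k : ℝ} (hk : 0 < k) : ∃ κ, ValidNext ε k E κ := by
  have hpi := pi_pos
  have hn := h.one_le
  have hε := h.pos
  have h2 := h.sq_mul_le
  set x : ℝ := (n : ℝ)
  have hε1 : ε ≤ π / 150 := le_trans (le_mul_of_one_le_left hε.le (one_le_pow₀ hn)) h2
  obtain ⟨κ, hκ, hsep⟩ := exists_separating_multiplier hE 2 k
    (η := 16 * ε) (D₀ := π / (16 / 5)) (by positivity) (by positivity) (by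
      have e1 : 2 * (16 * ε) / (π / (16 / 5)) = 16 * ε / π * (32 / 5) := by
        field_simp
        norm_num
      rw [e1]
      set t := 16 * ε / π with ht
      have ht0 : 0 ≤ t := by positivity
      have ht2 : x ^ 2 * t ≤ 16 / 150 := by
        rw [ht, ← mul_div_assoc, div_le_iff₀ hpi]
        linarith
      have ht1 : t ≤ 16 / 150 := le_trans (le_mul_of_one_le_left ht0 (one_le_pow₀ hn)) ht2
      have hb : t + t * (32 / 5) * (1 + t) ≤ t * (81 / 10) := by nlinarith
      calc x * (x - 1) * (t + t * (32 / 5) * (1 + t))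
          ≤ x * (x - 1) * (t * (81 / 10)) := by
            gcongr
        _ ≤ x ^ 2 * (t * (81 / 10)) := by gcongr; nlinarith
        _ = 81 / 10 * (x ^ 2 * t) := by ring
        _ < 1 := by linarith)
  have hκ' : κ ∈ Set.Icc (2 : ℝ) 3 := ⟨hκ.1, by linarith [hκ.2]⟩
  have hκ0 : 0 < κ := by linarith [hκ.1]
  refine ⟨κ, hκ', fun y hy z hz _ => ?_⟩
  by_contra! hcon
  have hd : π / (16 / 5) ≤ |y * k - z * k| := by
    rw [← sub_mul, abs_mul, abs_of_pos hk]
    have h8 := hcon.2.trans (circNorm_le_abs _)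
    rw [div_le_iff₀ (by positivity)] at h8
    have h9 : |y - z| * (k * κ) ≤ |y - z| * k * 3 := by
      rw [← mul_assoc]
      gcongr
      exact hκ'.2
    have h10 : 2 * ε * (1 + κ) ≤ 2 * ε * 4 := by
      gcongr
      linarith [hκ'.2]
    rw [div_le_iff₀ (by norm_num)]
    linarith
  have h5 := hsep y hy z hz hd
  have h6 : 4 * ε * (1 + κ) ≤ 16 * ε := by nlinarith [hκ'.2]
  have h7 := hcon.1
  rw [sub_mul] at h5
  linarith

/-! ### Pruning of cyclically adjacent bins. -/

theorem add_mod_injective {L s i j : ℕ} (hi : i < L) (hj : j < L) (h : (s + i) % L = (s + j) % L) :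
    i = j := by
  have : i ≡ j [MOD L] := Nat.ModEq.add_left_cancel' s h
  rwa [Nat.ModEq, Nat.mod_eq_of_lt hi, Nat.mod_eq_of_lt hj] at this

theorem succ_mod_add_pred_mod {L : ℕ} (hL : 0 < L) (m : ℕ) : ((m + 1) % L + (L - 1)) % L = m % L := by
  rw [Nat.mod_add_mod, show m + 1 + (L - 1) = m + L by omega, Nat.add_mod_right]

/-- The effect of the pruning of `T` on the first `i` indices after a start index `s`. -/
theorem prune_foldl_spec {L s : ℕ} {T : Finset ℕ} (hsL : s < L) {i : ℕ} (hi : i ≤ L) :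
    let T' := (List.range i).foldl
      (fun T' i =>
        let l := (s + i) % L
        if l ∈ T' ∧ (l + (L - 1)) % L ∈ T' then T'.erase l else T') T
    T' ⊆ T ∧ (∀ j, i ≤ j → j < L → (s + j) % L ∈ T → (s + j) % L ∈ T') ∧
      (∀ j, j + 1 < i → ¬ ((s + (j + 1)) % L ∈ T' ∧ (s + j) % L ∈ T')) ∧
      (∀ j, j + 1 < i → (s + (j + 1)) % L ∈ T → (s + (j + 1)) % L ∈ T' ∨ (s + j) % L ∈ T') := by
  have hL : 0 < L := by omega
  induction i with
  | zero => simp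
  | succ i ih =>
    obtain ⟨h1, h2, h3, h4⟩ := ih (by omega)
    rw [List.range_succ, List.foldl_append]
    simp only [List.foldl_cons, List.foldl_nil]
    generalize hT' : (List.range i).foldl
      (fun T' i =>
        let l := (s + i) % L
        if l ∈ T' ∧ (l + (L - 1)) % L ∈ T' then T'.erase l else T') T = T' at *
    have hpred : ∀ j, ((s + (j + 1)) % L + (L - 1)) % L = (s + j) % L := fun j =>
      succ_mod_add_pred_mod hL (s + j)
    by_cases hc : (s + i) % L ∈ T' ∧ ((s + i) % L + (L - 1)) % L ∈ T'
    · rw [if_pos hc]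
      have hne : ∀ j, j < L → j ≠ i → (s + j) % L ≠ (s + i) % L := fun j hj hji h =>
        hji (add_mod_injective hj (by omega) h)
      refine ⟨(Finset.erase_subset _ _).trans h1, fun j hj hjL hjT => ?_, fun j hj hjT => ?_,
        fun j hj hjT => ?_⟩
      · exact Finset.mem_erase.2 ⟨hne j hjL (by omega), h2 j (by omega) hjL hjT⟩
      · rcases Nat.lt_or_ge (j + 1) i with h | h
        · exact h3 j h ⟨Finset.mem_of_mem_erase hjT.1, Finset.mem_of_mem_erase hjT.2⟩
        · rw [show j + 1 = i by omega] at hjT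
          exact Finset.notMem_erase _ _ hjT.1
      · rcases Nat.lt_or_ge (j + 1) i with h | h
        · exact (h4 j h hjT).imp
            (fun h => Finset.mem_erase.2 ⟨hne _ (by omega) (by omega), h⟩)
            (fun h => Finset.mem_erase.2 ⟨hne _ (by omega) (by omega), h⟩)
        · obtain rfl : i = j + 1 := by omega
          right
          rw [hpred] at hc
          exact Finset.mem_erase.2 ⟨hne _ (by omega) (by omega), hc.2⟩
    · rw [if_neg hc]
      refine ⟨h1, fun j hj => h2 j (by omega), fun j hj hjT => ?_, fun j hj hjT => ?_⟩
      · rcases Nat.lt_or_ge (j + 1) i with h | h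
        · exact h3 j h hjT
        · obtain rfl : i = j + 1 := by omega
          exact hc ⟨hjT.1, by rw [hpred]; exact hjT.2⟩
      · rcases Nat.lt_or_ge (j + 1) i with h | h
        · exact h4 j h hjT
        · obtain rfl : i = j + 1 := by omega
          exact Or.inl (h2 _ le_rfl (by omega) hjT)

/-- The walk starts at an index `s` outside `T`. Every member of `T` is therefore visited after its
predecessor, including across the wrap from `L - 1` to `0`, and the predecessor's fate is settled
when the index is tested. No two neighbours survive, and an index is erased only next to a survivor.
-/
theorem prune_spec {L : ℕ} {T : Finset ℕ} (hT : T ⊆ Finset.range L) (hne : ∃ m < L, m ∉ T) :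
    prune L T ⊆ T ∧ (∀ l ∈ prune L T, (l + (L - 1)) % L ∉ prune L T) ∧
      ∀ l ∈ T, l ∈ prune L T ∨ (l + (L - 1)) % L ∈ prune L T := by
  obtain ⟨m, hmL, hm⟩ := hne
  have hs : sInf {m : ℕ | m ∉ T} ∉ T := Nat.sInf_mem (s := {m : ℕ | m ∉ T}) ⟨m, hm⟩
  have hsL : sInf {m : ℕ | m ∉ T} < L := (Nat.sInf_le (s := {m : ℕ | m ∉ T}) hm).trans_lt hmL
  obtain ⟨h1, -, h3, h4⟩ := prune_foldl_spec (T := T) hsL le_rfl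
  change prune L T ⊆ T at h1
  change ∀ j, j + 1 < L → ¬ (_ ∈ prune L T ∧ _ ∈ prune L T) at h3
  change ∀ j, j + 1 < L → _ ∈ T → _ ∈ prune L T ∨ _ ∈ prune L T at h4
  generalize sInf {m : ℕ | m ∉ T} = s at *
  have key : ∀ l ∈ T, ∃ j, j + 1 < L ∧ l = (s + (j + 1)) % L ∧
      (l + (L - 1)) % L = (s + j) % L := by
    intro l hl
    have hlL := Finset.mem_range.1 (hT hl)
    have hls : l ≠ s := fun h => hs (h ▸ hl)
    rcases Nat.lt_or_ge s l with h | h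
    · refine ⟨l - s - 1, by omega, ?_, ?_⟩
      · rw [show s + (l - s - 1 + 1) = l by omega, Nat.mod_eq_of_lt hlL]
      · rw [show l + (L - 1) = (s + (l - s - 1)) + L by omega, Nat.add_mod_right]
    · refine ⟨L + l - s - 1, by omega, ?_, ?_⟩
      · rw [show s + (L + l - s - 1 + 1) = l + L by omega, Nat.add_mod_right, Nat.mod_eq_of_lt hlL]
      · congr 1
        omega
  refine ⟨h1, fun l hl hl' => ?_, fun l hl => ?_⟩
  · obtain ⟨j, hj, hlj, hpj⟩ := key l (h1 hl)
    exact h3 j hj ⟨hlj ▸ hl, hpj ▸ hl'⟩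
  · obtain ⟨j, hj, hlj, hpj⟩ := key l hl
    rw [hpj, hlj]
    exact h4 j hj (hlj ▸ hl)

/-! ### Gevrey bounds for the bump. -/

theorem bumpKernel_eq : bumpKernel = fun x => expNegInvGlue (1 - x ^ 2) := by
  ext x
  have : |x| < 1 ↔ ¬ (1 - x ^ 2 ≤ 0) := by
    rw [← sq_lt_one_iff_abs_lt_one]
    constructor <;> intro h <;> linarith
  by_cases h : |x| < 1
  · rw [bumpKernel, if_pos h, expNegInvGlue, if_neg (this.1 h)]
  · rw [bumpKernel, if_neg h, expNegInvGlue, if_pos (not_not.1 fun hc => h (this.2 hc))]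

theorem contDiff_bumpKernel {n : ℕ∞} : ContDiff ℝ n bumpKernel := by
  rw [bumpKernel_eq]
  exact expNegInvGlue.contDiff.comp (contDiff_const.sub (contDiff_id.pow 2))

theorem continuous_bumpKernel : Continuous bumpKernel := (contDiff_bumpKernel (n := 0)).continuous

theorem bumpKernel_nonneg (x : ℝ) : 0 ≤ bumpKernel x := by
  rw [bumpKernel_eq]
  exact expNegInvGlue.nonneg _

theorem bumpKernel_neg (x : ℝ) : bumpKernel (-x) = bumpKernel x := by
  simp [bumpKernel]

theorem bumpKernel_of_one_le_abs {x : ℝ} (hx : 1 ≤ |x|) : bumpKernel x = 0 :=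
  if_neg (not_lt.2 hx)

/-- The holomorphic extension of the bump. -/
noncomputable def complexBump (z : ℂ) : ℂ := Complex.exp (-(1 - z ^ 2)⁻¹)

theorem one_sub_sq_ne_zero_of_re {z : ℂ} (hz : |z.re| < 1) : 1 - z ^ 2 ≠ 0 := by
  rw [abs_lt] at hz
  intro h
  have h1 : (1 - z) * (1 + z) = 0 := by rw [← h]; ring
  rcases mul_eq_zero.1 h1 with h | h
  · have := congrArg Complex.re h
    simp at this
    linarith [hz.2]
  · have := congrArg Complex.re h
    simp at this
    linarith [hz.1]

theorem differentiableAt_complexBump {z : ℂ} (hz : |z.re| < 1) :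
    DifferentiableAt ℂ complexBump z := by
  unfold complexBump
  refine DifferentiableAt.cexp (DifferentiableAt.neg (DifferentiableAt.inv ?_ ?_))
  · fun_prop
  · exact one_sub_sq_ne_zero_of_re hz

theorem isOpen_strip : IsOpen {z : ℂ | |z.re| < 1} :=
  isOpen_lt (continuous_abs.comp Complex.continuous_re) continuous_const

theorem differentiableOn_iteratedDeriv_complexBump (p : ℕ) :
    DifferentiableOn ℂ (iteratedDeriv p complexBump) {z : ℂ | |z.re| < 1} := by
  induction p with
  | zero =>
    rw [iteratedDeriv_zero]
    exact fun z hz => (differentiableAt_complexBump hz).differentiableWithinAt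
  | succ p ih =>
    rw [iteratedDeriv_succ]
    exact ih.deriv isOpen_strip

/-- Inside `(-1, 1)` the bump is the restriction of a function holomorphic on a strip, so its real
derivatives are complex ones and Cauchy's estimate applies. The induction differentiates an equality
of germs. -/
theorem iteratedDeriv_bumpKernel_eq (p : ℕ) {x : ℝ} (hx : |x| < 1) :
    iteratedDeriv p (fun x : ℝ => (bumpKernel x : ℂ)) x = iteratedDeriv p complexBump x := by
  induction p generalizing x with
  | zero =>
    rw [iteratedDeriv_zero, iteratedDeriv_zero, bumpKernel, if_pos hx, complexBump]
    push_cast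
    rfl
  | succ p ih =>
    rw [iteratedDeriv_succ, iteratedDeriv_succ]
    have hev : iteratedDeriv p (fun x : ℝ => (bumpKernel x : ℂ)) =ᶠ[nhds x]
        fun y : ℝ => iteratedDeriv p complexBump y := by
      filter_upwards [(isOpen_lt continuous_abs continuous_const).mem_nhds hx] with y hy
      exact ih hy
    rw [hev.deriv_eq]
    have hd : DifferentiableAt ℂ (iteratedDeriv p complexBump) x :=
      (differentiableOn_iteratedDeriv_complexBump p).differentiableAt
        (isOpen_strip.mem_nhds (by simpa using hx))
    exact hd.hasDerivAt.comp_ofReal.deriv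

/-- The real part of `(1 - z²)⁻¹` in terms of that of `(1 - z)⁻¹` near `x ∈ [0, 1)`. -/
theorem le_re_inv_one_sub_sq {x : ℝ} (hx : |x| < 1) {z : ℂ}
    (hz : ‖z - x‖ ≤ (1 - |x|) / 4) : 1 / (5 * (1 - |x|)) ≤ ((1 - z ^ 2)⁻¹).re := by
  -- For `w` in the disc of radius `d/4` about `d`, the real part of `w⁻¹` is at least
  -- `(3d/4)/(5d/4)² = 12/(25d)`, which exceeds `2/(5d)`.
  have aux : ∀ w : ℂ, 0 < w.re → ∀ d : ℝ, 0 < d → 3 * d / 4 ≤ w.re → ‖w‖ ≤ 5 * d / 4 →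
      2 / (5 * d) ≤ (w⁻¹).re := by
    intro w hw d hd h1 h2
    rw [Complex.inv_re, Complex.normSq_eq_norm_sq, div_le_div_iff₀ (by positivity)
      (pow_pos (norm_pos_iff.2 (by rintro rfl; simp at hw)) 2)]
    have h3 : ‖w‖ ^ 2 ≤ (5 * d / 4) ^ 2 := by gcongr
    nlinarith
  have aux0 : ∀ w : ℂ, 0 < w.re → 0 ≤ (w⁻¹).re := by
    intro w hw
    rw [Complex.inv_re]
    exact div_nonneg hw.le (Complex.normSq_nonneg _)
  set d := 1 - |x| with hd
  have hd0 : 0 < d := by linarith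
  have hre : |z.re - x| ≤ d / 4 := by
    have := Complex.abs_re_le_norm (z - x)
    simp only [Complex.sub_re, Complex.ofReal_re] at this
    exact this.trans hz
  rw [abs_le] at hre
  have hx1 := abs_lt.1 hx
  have hp : 0 < (1 - z).re := by
    simp only [Complex.sub_re, Complex.one_re]
    linarith [le_abs_self x]
  have hq : 0 < (1 + z).re := by
    simp only [Complex.add_re, Complex.one_re]
    linarith [neg_abs_le x]
  have hpz : (1 - z) ≠ 0 := by intro h; rw [h] at hp; simp at hp
  have hqz : (1 + z) ≠ 0 := by intro h; rw [h] at hq; simp at hq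
  -- Partial fractions: the pole nearer to `x` gives the lower bound, and the other term has
  -- nonnegative real part.
  have hdec : (1 - z ^ 2)⁻¹ = (1 / 2 : ℝ) * ((1 - z)⁻¹ + (1 + z)⁻¹) := by
    have : 1 - z ^ 2 ≠ 0 := by
      rw [show 1 - z ^ 2 = (1 - z) * (1 + z) by ring]
      exact mul_ne_zero hpz hqz
    push_cast
    rw [show 1 - z ^ 2 = (1 - z) * (1 + z) by ring]
    field_simp
    ring
  rw [hdec, Complex.re_ofReal_mul, Complex.add_re]
  have e : 1 / (5 * d) = 1 / 2 * (2 / (5 * d)) := by field_simp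
  rw [e]
  rcases le_total 0 x with h0 | h0
  · have habs : |x| = x := abs_of_nonneg h0
    have h1 : ‖1 - z‖ ≤ 5 * d / 4 := by
      calc ‖1 - z‖ = ‖((1 - x : ℝ) : ℂ) - (z - x)‖ := by push_cast; congr 1; ring
        _ ≤ ‖((1 - x : ℝ) : ℂ)‖ + ‖z - x‖ := norm_sub_le _ _
        _ ≤ d + d / 4 := by
          rw [Complex.norm_real, Real.norm_of_nonneg (by linarith)]
          linarith
        _ = 5 * d / 4 := by ring
    have := aux _ hp d hd0 (by simp only [Complex.sub_re, Complex.one_re]; linarith) h1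
    linarith [aux0 _ hq]
  · have habs : |x| = -x := abs_of_nonpos h0
    have h1 : ‖1 + z‖ ≤ 5 * d / 4 := by
      calc ‖1 + z‖ = ‖((1 + x : ℝ) : ℂ) + (z - x)‖ := by push_cast; congr 1; ring
        _ ≤ ‖((1 + x : ℝ) : ℂ)‖ + ‖z - x‖ := norm_add_le _ _
        _ ≤ d + d / 4 := by
          rw [Complex.norm_real, Real.norm_of_nonneg (by linarith)]
          linarith
        _ = 5 * d / 4 := by ring
    have := aux _ hq d hd0 (by simp only [Complex.add_re, Complex.one_re]; linarith) h1
    linarith [aux0 _ hp]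

/-- Cauchy's estimate on the circle of radius `d/4`, with `d` the distance to the poles, gives `p!
(4/d)^p exp(-1/(5d))`. The inequality `t^p/p! ≤ e^t` at `t = 1/(5d)` trades the singular factor
`d^(-p)` for a second factorial. -/
theorem norm_iteratedDeriv_complexBump_le (p : ℕ) {x : ℝ} (hx : |x| < 1) :
    ‖iteratedDeriv p complexBump x‖ ≤ 20 ^ p * (p.factorial : ℝ) ^ 2 := by
  set d := 1 - |x| with hd
  have hd0 : 0 < d := by linarith
  have hstrip : Metric.closedBall (x : ℂ) (d / 4) ⊆ {z : ℂ | |z.re| < 1} := by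
    intro z hz
    rw [mem_closedBall_iff_norm] at hz
    have h1 := (Complex.abs_re_le_norm (z - x)).trans hz
    simp only [Complex.sub_re, Complex.ofReal_re] at h1
    have h2 := abs_sub_abs_le_abs_sub z.re x
    simp only [Set.mem_ofPred_eq]
    linarith
  have hdc : DiffContOnCl ℂ complexBump (Metric.ball (x : ℂ) (d / 4)) := by
    refine DifferentiableOn.diffContOnCl fun z hz => ?_
    exact (differentiableAt_complexBump
      (hstrip (Metric.closure_ball_subset_closedBall hz))).differentiableWithinAt
  have hC : ∀ z ∈ Metric.sphere (x : ℂ) (d / 4), ‖complexBump z‖ ≤ exp (-(1 / (5 * d))) := by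
    intro z hz
    rw [mem_sphere_iff_norm] at hz
    rw [complexBump, Complex.norm_exp, Complex.neg_re, exp_le_exp, neg_le_neg_iff]
    exact le_re_inv_one_sub_sq hx hz.le
  refine (Complex.norm_iteratedDeriv_le_of_forall_mem_sphere_norm_le p (by positivity) hdc hC).trans
    ?_
  have hf := Real.pow_div_factorial_le_exp (1 / (5 * d)) (by positivity) p
  have hf0 : (0 : ℝ) < p.factorial := by exact_mod_cast p.factorial_pos
  rw [div_le_iff₀ hf0] at hf
  rw [div_pow, one_pow] at hf
  rw [exp_neg, div_pow]
  rw [div_le_iff₀ (by positivity)]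
  have h4 : (1 : ℝ) ≤ 20 ^ p * p.factorial * (d ^ p / 4 ^ p) * exp (1 / (5 * d)) := by
    have e : (20 : ℝ) ^ p = 4 ^ p * 5 ^ p := by rw [← mul_pow]; norm_num
    rw [div_le_iff₀ (by positivity), mul_pow] at hf
    have e2 : 20 ^ p * p.factorial * (d ^ p / 4 ^ p) * exp (1 / (5 * d)) =
        exp (1 / (5 * d)) * p.factorial * (5 ^ p * d ^ p) := by
      rw [e]; field_simp
    rw [e2]
    exact hf
  rw [← div_eq_mul_inv, div_le_iff₀ (exp_pos _)]
  calc (p.factorial : ℝ) = p.factorial * 1 := (mul_one _).symm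
    _ ≤ p.factorial * (20 ^ p * p.factorial * (d ^ p / 4 ^ p) * exp (1 / (5 * d))) := by gcongr
    _ = _ := by ring

theorem contDiff_bumpKernel_complex {n : ℕ∞} : ContDiff ℝ n (fun x : ℝ => (bumpKernel x : ℂ)) :=
  Complex.ofRealCLM.contDiff.comp contDiff_bumpKernel

/-- The bump is of Gevrey class `2`. -/
theorem norm_iteratedDeriv_bumpKernel_le (p : ℕ) (x : ℝ) :
    ‖iteratedDeriv p (fun x : ℝ => (bumpKernel x : ℂ)) x‖ ≤ 20 ^ p * (p.factorial : ℝ) ^ 2 := by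
  have hcl : IsClosed {x : ℝ | ‖iteratedDeriv p (fun x : ℝ => (bumpKernel x : ℂ)) x‖ ≤
      20 ^ p * (p.factorial : ℝ) ^ 2} := by
    refine isClosed_le (Continuous.norm ?_) continuous_const
    exact (contDiff_bumpKernel_complex (n := ⊤)).continuous_iteratedDeriv p
      (by exact_mod_cast le_top)
  -- The bound is a closed condition that holds off `±1`, so derivatives at these two points need no
  -- computation.
  have hdense : Dense ({1, -1} : Set ℝ)ᶜ := Set.Countable.dense_compl ℝ (Set.to_countable _)
  refine hcl.closure_subset_iff.2 ?_ (hdense x)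
  intro y hy
  simp only [Set.mem_compl_iff, Set.mem_insert_iff, Set.mem_singleton_iff, not_or] at hy
  rcases lt_trichotomy |y| 1 with h | h | h
  · rw [Set.mem_ofPred_eq, iteratedDeriv_bumpKernel_eq p h]
    exact norm_iteratedDeriv_complexBump_le p h
  · rcases eq_or_eq_neg_of_abs_eq h with h | h
    · exact absurd h hy.1
    · exact absurd h hy.2
  · have hev : (fun x : ℝ => (bumpKernel x : ℂ)) =ᶠ[nhds y] fun _ => 0 := by
      filter_upwards [(isOpen_lt continuous_const continuous_abs).mem_nhds h] with z hz
      rw [bumpKernel_of_one_le_abs (le_of_lt hz), Complex.ofReal_zero]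
    rw [Set.mem_ofPred_eq, hev.iteratedDeriv_eq p]
    have : iteratedDeriv p (fun _ : ℝ => (0 : ℂ)) y = 0 := by
      rw [iteratedDeriv_const]; simp
    rw [this, norm_zero]
    positivity

theorem support_bumpKernel_subset : Function.support bumpKernel ⊆ Set.Ioc (-1) 1 := by
  intro x hx
  have h : |x| < 1 := by
    by_contra h
    exact hx (bumpKernel_of_one_le_abs (not_lt.1 h))
  rw [abs_lt] at h
  exact ⟨h.1, h.2.le⟩

theorem intervalIntegrable_bumpKernel (a b : ℝ) :
    IntervalIntegrable bumpKernel MeasureTheory.volume a b :=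
  continuous_bumpKernel.intervalIntegrable a b

theorem hasCompactSupport_bumpKernel : HasCompactSupport bumpKernel := by
  refine HasCompactSupport.intro (isCompact_Icc (a := (-1 : ℝ)) (b := 1)) fun x hx => ?_
  by_contra h
  exact hx (Set.Ioc_subset_Icc_self (support_bumpKernel_subset h))

theorem integrable_bumpKernel : MeasureTheory.Integrable bumpKernel :=
  continuous_bumpKernel.integrable_of_hasCompactSupport hasCompactSupport_bumpKernel

theorem integral_bumpKernel_pos : 0 < ∫ x in (-1 : ℝ)..1, bumpKernel x := by
  refine intervalIntegral.intervalIntegral_pos_of_pos_on (intervalIntegrable_bumpKernel _ _)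
    (fun x hx => ?_) (by norm_num)
  rw [bumpKernel, if_pos (abs_lt.2 hx)]
  exact exp_pos _

theorem bumpConst_pos : 0 < bumpConst := inv_pos.2 integral_bumpKernel_pos

/-! ### The template of the bin functions and its Fourier transform. -/

/-- The approximate indicator function of `[-1, 1]` from which all bin functions arise by
an affine substitution. -/
noncomputable def binTemplate (s : ℝ) : ℝ := bumpConst * ∫ t in (s - 1)..(s + 1), bumpKernel t

theorem binFun_eq {ε : ℝ} (hε : 0 < ε) (l : ℕ) (φ : ℝ) :
    binFun ε l φ = binTemplate (2 / ε * (φ - l * ε)) := by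
  unfold binFun binTemplate
  have h : ∀ x : ℝ, bumpKernel (2 / ε * (φ - x)) = bumpKernel (2 / ε * φ - 2 / ε * x) := by
    intro x
    rw [mul_sub]
  simp_rw [h]
  rw [intervalIntegral.integral_comp_sub_mul _ (by positivity), smul_eq_mul]
  have e1 : 2 / ε * φ - 2 / ε * (l * ε + ε / 2) = 2 / ε * (φ - l * ε) - 1 := by
    field_simp; ring
  have e2 : 2 / ε * φ - 2 / ε * (l * ε - ε / 2) = 2 / ε * (φ - l * ε) + 1 := by
    field_simp; ring
  rw [e1, e2]
  field_simp

theorem binTemplate_nonneg (s : ℝ) : 0 ≤ binTemplate s :=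
  mul_nonneg bumpConst_pos.le
    (intervalIntegral.integral_nonneg (by linarith) fun x _ => bumpKernel_nonneg x)

theorem binTemplate_le_one (s : ℝ) : binTemplate s ≤ 1 := by
  unfold binTemplate bumpConst
  rw [inv_mul_le_iff₀ integral_bumpKernel_pos, mul_one,
    intervalIntegral.integral_eq_integral_of_support_subset support_bumpKernel_subset,
    intervalIntegral.integral_of_le (by linarith)]
  exact MeasureTheory.setIntegral_le_integral integrable_bumpKernel
    (Filter.Eventually.of_forall bumpKernel_nonneg)

theorem binTemplate_of_two_le_abs {s : ℝ} (hs : 2 ≤ |s|) : binTemplate s = 0 := by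
  unfold binTemplate
  rw [intervalIntegral.integral_congr (g := fun _ => (0 : ℝ)), intervalIntegral.integral_zero,
    mul_zero]
  intro x hx
  rw [Set.uIcc_of_le (by linarith)] at hx
  refine bumpKernel_of_one_le_abs ?_
  rcases le_abs.1 hs with h | h
  · exact le_abs.2 (Or.inl (by linarith [hx.1]))
  · exact le_abs.2 (Or.inr (by linarith [hx.2]))

/-- The window `[s - 1, s + 1]` contains `[0, 1]` or `[-1, 0]`, and each carries half the mass of
the even bump. -/
theorem half_le_binTemplate {s : ℝ} (hs : |s| ≤ 1) : 1 / 2 ≤ binTemplate s := by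
  have hsymm : ∫ t in (-1 : ℝ)..0, bumpKernel t = ∫ t in (0 : ℝ)..1, bumpKernel t := by
    have := intervalIntegral.integral_comp_neg (a := 0) (b := 1) bumpKernel
    simp only [bumpKernel_neg, neg_zero] at this
    exact this.symm
  have hsum := intervalIntegral.integral_add_adjacent_intervals
    (intervalIntegrable_bumpKernel (-1) 0) (intervalIntegrable_bumpKernel 0 1)
  rw [abs_le] at hs
  have hnn : 0 ≤ᵐ[MeasureTheory.volume.restrict (Set.Ioc (s - 1) (s + 1))] bumpKernel :=
    Filter.Eventually.of_forall bumpKernel_nonneg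
  have hhalf : (∫ x in (-1 : ℝ)..1, bumpKernel x) / 2 ≤ ∫ t in (s - 1)..(s + 1), bumpKernel t := by
    rcases le_total 0 s with h | h
    · have := intervalIntegral.integral_mono_interval (a := 0) (b := 1) (by linarith) zero_le_one
        (by linarith) hnn (intervalIntegrable_bumpKernel _ _)
      linarith
    · have := intervalIntegral.integral_mono_interval (a := -1) (b := 0) (by linarith)
        (by norm_num) (by linarith) hnn (intervalIntegrable_bumpKernel _ _)
      linarith
  unfold binTemplate bumpConst
  rw [le_inv_mul_iff₀ integral_bumpKernel_pos]
  linarith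

/-- The template as a complex-valued function. -/
noncomputable def binTemplateC (s : ℝ) : ℂ := (binTemplate s : ℂ)

theorem hasDerivAt_binTemplate (s : ℝ) :
    HasDerivAt binTemplate (bumpConst * (bumpKernel (s + 1) - bumpKernel (s - 1))) s := by
  have hF : ∀ u : ℝ, HasDerivAt (fun u => ∫ t in (0 : ℝ)..u, bumpKernel t) (bumpKernel u) u :=
    fun u => intervalIntegral.integral_hasDerivAt_right (intervalIntegrable_bumpKernel _ _)
      continuous_bumpKernel.stronglyMeasurable.stronglyMeasurableAtFilter
      continuous_bumpKernel.continuousAt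
  have heq : binTemplate = fun s => bumpConst *
      ((∫ t in (0 : ℝ)..(s + 1), bumpKernel t) - ∫ t in (0 : ℝ)..(s - 1), bumpKernel t) := by
    ext s
    unfold binTemplate
    rw [intervalIntegral.integral_interval_sub_left (intervalIntegrable_bumpKernel _ _)
      (intervalIntegrable_bumpKernel _ _)]
  rw [heq]
  exact ((HasDerivAt.comp_add_const s 1 (hF (s + 1))).sub
    (HasDerivAt.comp_sub_const s 1 (hF (s - 1)))).const_mul bumpConst

theorem deriv_binTemplateC : deriv binTemplateC = fun s : ℝ => (bumpConst : ℂ) *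
    ((fun x : ℝ => (bumpKernel x : ℂ)) (s + 1) - (fun x : ℝ => (bumpKernel x : ℂ)) (s - 1)) := by
  ext s
  have := (hasDerivAt_binTemplate s).ofReal_comp.deriv
  unfold binTemplateC
  rw [this]
  push_cast
  rfl

theorem contDiff_binTemplateC {n : ℕ∞} : ContDiff ℝ n binTemplateC := by
  refine ContDiff.of_le (n := ((⊤ : ℕ∞) : WithTop ℕ∞)) ?_ (by exact_mod_cast le_top)
  rw [contDiff_infty_iff_deriv]
  refine ⟨fun s => (hasDerivAt_binTemplate s).ofReal_comp.differentiableAt, ?_⟩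
  rw [deriv_binTemplateC]
  have h := contDiff_bumpKernel_complex (n := ⊤)
  exact contDiff_const.mul ((h.comp (contDiff_id.add contDiff_const)).sub
    (h.comp (contDiff_id.sub contDiff_const)))

theorem tsupport_binTemplateC_subset : tsupport binTemplateC ⊆ Set.Icc (-2) 2 := by
  refine closure_minimal (fun s hs => ?_) isClosed_Icc
  by_contra h
  refine hs ?_
  rw [binTemplateC, binTemplate_of_two_le_abs, Complex.ofReal_zero]
  by_contra h'
  exact h (abs_le.1 (not_le.1 h').le)

theorem iteratedDeriv_binTemplateC_of_notMem (p : ℕ) {s : ℝ} (hs : s ∉ Set.Icc (-2 : ℝ) 2) :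
    iteratedDeriv p binTemplateC s = 0 := by
  have h := (support_iteratedFDeriv_subset (𝕜 := ℝ) (f := binTemplateC) p).trans
    tsupport_binTemplateC_subset
  have h0 : iteratedFDeriv ℝ p binTemplateC s = 0 := by
    by_contra hc
    exact hs (h hc)
  rw [iteratedDeriv, h0]
  rfl

/-- The integral in the template uses up one derivative: order `p + 1` costs the Gevrey bound of
order `p`, once for each of the two shifted bumps. -/
theorem norm_iteratedDeriv_binTemplateC_le (p : ℕ) (s : ℝ) :
    ‖iteratedDeriv (p + 1) binTemplateC s‖ ≤ 2 * bumpConst * (20 ^ p * (p.factorial : ℝ) ^ 2) := by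
  have h := contDiff_bumpKernel_complex (n := ⊤)
  have hp : (p : WithTop ℕ∞) ≤ ((⊤ : ℕ∞) : WithTop ℕ∞) := by exact_mod_cast le_top
  have h1 : ContDiff ℝ p (fun s : ℝ => (fun x : ℝ => (bumpKernel x : ℂ)) (s + 1)) :=
    (h.comp (contDiff_id.add contDiff_const)).of_le hp
  have h2 : ContDiff ℝ p (fun s : ℝ => (fun x : ℝ => (bumpKernel x : ℂ)) (s - 1)) :=
    (h.comp (contDiff_id.sub contDiff_const)).of_le hp
  rw [iteratedDeriv_succ', deriv_binTemplateC]
  have e : iteratedDeriv p (fun s : ℝ => (bumpConst : ℂ) *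
      ((fun x : ℝ => (bumpKernel x : ℂ)) (s + 1) - (fun x : ℝ => (bumpKernel x : ℂ)) (s - 1))) s
      = (bumpConst : ℂ) * (iteratedDeriv p (fun x : ℝ => (bumpKernel x : ℂ)) (s + 1) -
        iteratedDeriv p (fun x : ℝ => (bumpKernel x : ℂ)) (s - 1)) := by
    rw [iteratedDeriv_const_mul_field]
    congr 1
    have := iteratedDeriv_fun_sub (x := s) h1.contDiffAt h2.contDiffAt
    rw [this]
    exact congrArg₂ (· - ·)
      (congrFun (iteratedDeriv_comp_add_const p (fun x : ℝ => (bumpKernel x : ℂ)) 1) s)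
      (congrFun (iteratedDeriv_comp_sub_const p (fun x : ℝ => (bumpKernel x : ℂ)) 1) s)
  rw [e, norm_mul, Complex.norm_real, Real.norm_of_nonneg bumpConst_pos.le]
  have hb := bumpConst_pos
  calc _ ≤ bumpConst * (20 ^ p * (p.factorial : ℝ) ^ 2 + 20 ^ p * (p.factorial : ℝ) ^ 2) := by
        gcongr
        exact (norm_sub_le _ _).trans (add_le_add (norm_iteratedDeriv_bumpKernel_le p _)
          (norm_iteratedDeriv_bumpKernel_le p _))
    _ = _ := by ring

theorem continuous_iteratedDeriv_binTemplateC (p : ℕ) :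
    Continuous (iteratedDeriv p binTemplateC) :=
  (contDiff_binTemplateC (n := ⊤)).continuous_iteratedDeriv p (by exact_mod_cast le_top)

theorem integrable_iteratedDeriv_binTemplateC (p : ℕ) :
    MeasureTheory.Integrable (iteratedDeriv p binTemplateC) := by
  refine (continuous_iteratedDeriv_binTemplateC p).integrable_of_hasCompactSupport ?_
  exact HasCompactSupport.intro (isCompact_Icc (a := (-2 : ℝ)) (b := 2))
    fun x hx => iteratedDeriv_binTemplateC_of_notMem p hx

open scoped FourierTransform in
theorem norm_fourier_le_of_support {f : ℝ → ℂ} {C : ℝ} (hC : ∀ s, ‖f s‖ ≤ C)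
    (hf : ∀ s ∉ Set.Icc (-2 : ℝ) 2, f s = 0) (v : ℝ) : ‖𝓕 f v‖ ≤ 4 * C := by
  rw [Real.fourier_real_eq]
  have : ∫ x, (Real.fourierChar (-(x * v))) • f x =
      ∫ x in Set.Icc (-2 : ℝ) 2, (Real.fourierChar (-(x * v))) • f x := by
    symm
    refine MeasureTheory.setIntegral_eq_integral_of_forall_compl_eq_zero fun x hx => ?_
    rw [hf x hx, smul_zero]
  rw [this]
  refine (MeasureTheory.norm_setIntegral_le_of_norm_le_const (C := C) ?_ ?_).trans_eq ?_
  · rw [Real.volume_Icc]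
    exact ENNReal.ofReal_lt_top
  · intro x _
    rw [Circle.norm_smul]
    exact hC x
  · rw [Real.volume_real_Icc]
    norm_num
    ring

open scoped FourierTransform in
theorem norm_fourier_binTemplateC_le (v : ℝ) : ‖𝓕 binTemplateC v‖ ≤ 4 := by
  have := norm_fourier_le_of_support (f := binTemplateC) (C := 1) (fun s => ?_) (fun s hs => ?_) v
  · linarith
  · rw [binTemplateC, Complex.norm_real, Real.norm_of_nonneg (binTemplate_nonneg s)]
    exact binTemplate_le_one s
  · have := iteratedDeriv_binTemplateC_of_notMem 0 hs
    rwa [iteratedDeriv_zero] at this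

-- Differentiating `p + 1` times multiplies the transform by `(2πiv)^(p+1)`, and the derivative
-- lives on an interval of length `4`. Leaving `p` free allows the order of decay to be optimized
-- later.
open scoped FourierTransform in
theorem norm_fourier_binTemplateC_mul_pow_le (p : ℕ) (v : ℝ) :
    (2 * π * |v|) ^ (p + 1) * ‖𝓕 binTemplateC v‖ ≤
      8 * bumpConst * (20 ^ p * (p.factorial : ℝ) ^ 2) := by
  have h := Real.fourier_iteratedDeriv (f := binTemplateC) (N := ⊤) (n := p + 1)
    contDiff_binTemplateC (fun n _ => integrable_iteratedDeriv_binTemplateC n) le_top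
  have h1 := norm_fourier_le_of_support (norm_iteratedDeriv_binTemplateC_le p)
    (fun s hs => iteratedDeriv_binTemplateC_of_notMem (p + 1) hs) v
  rw [h] at h1
  simp only [norm_smul, norm_pow, norm_mul, Complex.norm_real, Complex.norm_I, mul_one,
    Complex.norm_ofNat, Real.norm_eq_abs, abs_of_pos pi_pos] at h1
  linarith

/-! ### Fourier coefficients and Fourier series of the bin functions. -/

open scoped FourierTransform

/-- The bin function with its argument measured in full turns. -/
noncomputable def binTurns (ε : ℝ) (l : ℕ) (y : ℝ) : ℂ := binTemplateC (4 * π / ε * y + -(2 * l))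

theorem binTurns_eq {ε : ℝ} (hε : 0 < ε) (l : ℕ) (y : ℝ) :
    binTurns ε l y = (binFun ε l (2 * π * y) : ℂ) := by
  rw [binFun_eq hε, binTurns, binTemplateC]
  congr 2
  field_simp
  ring

/-- Affine change of variables: the position of the bin enters only through a unimodular factor, so
all bins obey the same bounds. -/
theorem norm_fourier_binTurns {ε : ℝ} (hε : 0 < ε) (l : ℕ) (w : ℝ) :
    ‖𝓕 (binTurns ε l) w‖ = ε / (4 * π) * ‖𝓕 binTemplateC (ε / (4 * π) * w)‖ := by
  have hpi := pi_pos
  set g : ℝ → ℂ := fun s => (𝐞 (-((s + 2 * l) * (ε / (4 * π)) * w))) • binTemplateC s with hg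
  have h1 : 𝓕 (binTurns ε l) w = ∫ y, g (4 * π / ε * y + -(2 * l)) := by
    rw [Real.fourier_real_eq]
    refine MeasureTheory.integral_congr_ae (Filter.Eventually.of_forall fun y => ?_)
    simp only [hg, binTurns]
    congr 4
    field_simp
    ring
  have h2 : ∫ s, g s = (𝐞 (-(2 * l * (ε / (4 * π)) * w))) • 𝓕 binTemplateC (ε / (4 * π) * w) := by
    rw [Real.fourier_real_eq, Circle.smul_def, smul_eq_mul, ← MeasureTheory.integral_const_mul]
    refine MeasureTheory.integral_congr_ae (Filter.Eventually.of_forall fun s => ?_)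
    simp only [hg, Circle.smul_def, smul_eq_mul]
    rw [← mul_assoc, ← Circle.coe_mul, ← AddChar.map_add_eq_mul]
    congr 3
    ring
  rw [h1, MeasureTheory.Measure.integral_comp_mul_left (fun x => g (x + -(2 * (l : ℝ)))),
    MeasureTheory.integral_add_right_eq_self g, h2, norm_smul, Circle.norm_smul,
    Real.norm_of_nonneg (by positivity), abs_of_pos (by positivity), inv_div]

theorem norm_fourier_binTurns_le {ε : ℝ} (hε : 0 < ε) (l : ℕ) (w : ℝ) :
    ‖𝓕 (binTurns ε l) w‖ ≤ ε / π := by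
  have hpi := pi_pos
  rw [norm_fourier_binTurns hε]
  calc ε / (4 * π) * ‖𝓕 binTemplateC (ε / (4 * π) * w)‖ ≤ ε / (4 * π) * 4 := by
        gcongr
        exact norm_fourier_binTemplateC_le _
    _ = ε / π := by field_simp

theorem norm_fourier_binTurns_le_pow {ε : ℝ} (hε : 0 < ε) (l p : ℕ) {w : ℝ} (hw : w ≠ 0) :
    ‖𝓕 (binTurns ε l) w‖ ≤ ε / (4 * π) *
      (8 * bumpConst * (20 ^ p * (p.factorial : ℝ) ^ 2)) * (2 / (ε * |w|)) ^ (p + 1) := by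
  have hpi := pi_pos
  have hw' : 0 < |w| := abs_pos.2 hw
  rw [norm_fourier_binTurns hε, mul_assoc (ε / (4 * π))]
  have h := norm_fourier_binTemplateC_mul_pow_le p (ε / (4 * π) * w)
  rw [abs_mul, abs_of_pos (show 0 < ε / (4 * π) by positivity),
    show 2 * π * (ε / (4 * π) * |w|) = ε * |w| / 2 by field_simp; ring] at h
  refine mul_le_mul_of_nonneg_left ?_ (by positivity)
  rw [show 2 / (ε * |w|) = (ε * |w| / 2)⁻¹ by rw [inv_div], inv_pow, ← div_eq_mul_inv,
    le_div_iff₀ (by positivity)]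
  linarith

/-- The interval of integration contains the whole support, so the coefficient of the periodic
extension is the transform on the line at an integer; measuring angles in turns matches the kernel
`e^(-2πiyk)`. -/
theorem binCoeff_eq {ε : ℝ} (hε : 0 < ε) (l k : ℕ) : binCoeff ε l k = 𝓕 (binTurns ε l) k := by
  have hpi := pi_pos
  set G : ℝ → ℂ := fun φ => (binFun ε l φ : ℂ) * Complex.exp (-(Complex.I * ((k * φ : ℝ) : ℂ)))
    with hG
  have h1 : 𝓕 (binTurns ε l) k = ∫ y, G (2 * π * y) := by
    rw [Real.fourier_real_eq]
    refine MeasureTheory.integral_congr_ae (Filter.Eventually.of_forall fun y => ?_)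
    simp only [hG]
    rw [binTurns_eq hε, Circle.smul_def, Real.fourierChar_apply, smul_eq_mul, mul_comm]
    congr 2
    push_cast
    ring
  have h2 : Function.support G ⊆ Set.Ioc (((l : ℝ) - 1) * ε) (((l : ℝ) + 1) * ε) := by
    intro φ hφ
    have hB : binTemplate (2 / ε * (φ - l * ε)) ≠ 0 := by
      intro h
      apply hφ
      simp only [hG]
      rw [binFun_eq hε, h, Complex.ofReal_zero, zero_mul]
    have hlt : |2 / ε * (φ - l * ε)| < 2 := by
      by_contra h
      exact hB (binTemplate_of_two_le_abs (not_lt.1 h))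
    rw [abs_mul, abs_of_pos (by positivity : 0 < 2 / ε), div_mul_eq_mul_div,
      div_lt_iff₀ hε] at hlt
    have := abs_lt.1 (show |φ - l * ε| < ε by linarith)
    exact ⟨by linarith [this.1], by linarith [this.2]⟩
  rw [binCoeff, h1, MeasureTheory.Measure.integral_comp_mul_left G,
    intervalIntegral.integral_eq_integral_of_support_subset h2, abs_of_pos (by positivity),
    Complex.real_smul, one_div]

/-- The function is real. This is what lets the terms `k` and `-k` be merged into twice a real part.
-/
theorem fourier_binTurns_neg {ε : ℝ} (l : ℕ) (w : ℝ) :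
    𝓕 (binTurns ε l) (-w) = (starRingEnd ℂ) (𝓕 (binTurns ε l) w) := by
  rw [Real.fourier_real_eq, Real.fourier_real_eq, ← integral_conj]
  refine MeasureTheory.integral_congr_ae (Filter.Eventually.of_forall fun y => ?_)
  simp only [Circle.smul_def, smul_eq_mul, map_mul]
  rw [← Circle.coe_inv_eq_conj, ← AddChar.map_neg_eq_inv, binTurns, binTemplateC,
    Complex.conj_ofReal]
  congr 3
  ring

theorem norm_binCoeff_le {ε : ℝ} (hε : 0 < ε) (l k : ℕ) : ‖binCoeff ε l k‖ ≤ ε / π := by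
  rw [binCoeff_eq hε]
  exact norm_fourier_binTurns_le hε l k

/-- The sum of the `2π`-translates of the bin function. -/
noncomputable def binPeriodic (ε : ℝ) (l : ℕ) (θ : ℝ) : ℝ := ∑' m : ℤ, binFun ε l (θ + 2 * π * m)

theorem binFun_nonneg {ε : ℝ} (hε : 0 < ε) (l : ℕ) (φ : ℝ) : 0 ≤ binFun ε l φ := by
  rw [binFun_eq hε]
  exact binTemplate_nonneg _

theorem binPeriodic_nonneg {ε : ℝ} (hε : 0 < ε) (l : ℕ) (θ : ℝ) : 0 ≤ binPeriodic ε l θ :=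
  tsum_nonneg fun _ => binFun_nonneg hε _ _

theorem abs_sub_lt_of_binFun_ne_zero {ε : ℝ} (hε : 0 < ε) {l : ℕ} {φ : ℝ} (h : binFun ε l φ ≠ 0) :
    |φ - l * ε| < ε := by
  rw [binFun_eq hε] at h
  have hlt : |2 / ε * (φ - l * ε)| < 2 := by
    by_contra h'
    exact h (binTemplate_of_two_le_abs (not_lt.1 h'))
  rw [abs_mul, abs_of_pos (by positivity : 0 < 2 / ε), div_mul_eq_mul_div, div_lt_iff₀ hε] at hlt
  linarith

theorem exists_abs_lt_of_binPeriodic_ne_zero {ε : ℝ} (hε : 0 < ε) {l : ℕ} {θ : ℝ}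
    (h : binPeriodic ε l θ ≠ 0) : ∃ m : ℤ, |θ + 2 * π * m - l * ε| < ε := by
  by_contra! hcon
  refine h ?_
  rw [binPeriodic]
  refine (tsum_congr fun m => ?_).trans tsum_zero
  by_contra hm
  exact (hcon m).not_gt (abs_sub_lt_of_binFun_ne_zero hε hm)

theorem summable_binFun {ε : ℝ} (hε : 0 < ε) (l : ℕ) (θ : ℝ) :
    Summable fun m : ℤ => binFun ε l (θ + 2 * π * m) := by
  have hpi := pi_pos
  refine summable_of_hasFiniteSupport ?_
  refine (Set.finite_Icc ⌊(l * ε - ε - θ) / (2 * π)⌋ ⌈(l * ε + ε - θ) / (2 * π)⌉).subset ?_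
  intro m hm
  have h := abs_lt.1 (abs_sub_lt_of_binFun_ne_zero hε hm)
  constructor
  · have : (⌊(l * ε - ε - θ) / (2 * π)⌋ : ℝ) ≤ m := by
      refine (Int.floor_le _).trans ?_
      rw [div_le_iff₀ (by positivity)]
      linarith [h.1]
    exact_mod_cast this
  · have : (m : ℝ) ≤ ⌈(l * ε + ε - θ) / (2 * π)⌉ := by
      refine le_trans ?_ (Int.le_ceil _)
      rw [le_div_iff₀ (by positivity)]
      linarith [h.2]
    exact_mod_cast this

theorem half_le_binPeriodic {ε : ℝ} (hε : 0 < ε) {l : ℕ} {θ : ℝ} {m : ℤ}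
    (h : |θ + 2 * π * m - l * ε| ≤ ε / 2) : 1 / 2 ≤ binPeriodic ε l θ := by
  refine le_trans ?_ ((summable_binFun hε l θ).le_tsum m fun _ _ => binFun_nonneg hε _ _)
  rw [binFun_eq hε]
  apply half_le_binTemplate
  rw [abs_mul, abs_of_pos (by positivity : 0 < 2 / ε), div_mul_eq_mul_div, div_le_iff₀ hε]
  linarith

theorem hasCompactSupport_binTurns {ε : ℝ} (hε : 0 < ε) (l : ℕ) :
    HasCompactSupport (binTurns ε l) := by
  have hpi := pi_pos
  refine HasCompactSupport.intro (isCompact_Icc (a := (((l : ℝ) - 1) * ε) / (2 * π))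
    (b := (((l : ℝ) + 1) * ε) / (2 * π))) fun y hy => ?_
  by_contra h
  rw [binTurns_eq hε, Complex.ofReal_eq_zero] at h
  have h := abs_lt.1 (abs_sub_lt_of_binFun_ne_zero hε h)
  refine hy ⟨?_, ?_⟩
  · rw [div_le_iff₀ (by positivity)]; linarith [h.1]
  · rw [le_div_iff₀ (by positivity)]; linarith [h.2]

theorem contDiff_binTurns (ε : ℝ) (l : ℕ) : ContDiff ℝ ((⊤ : ℕ∞) : WithTop ℕ∞) (binTurns ε l) :=
  (contDiff_binTemplateC (n := ⊤)).comp ((contDiff_const.mul contDiff_id).add contDiff_const)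

/-- Quadratic decay, the case `p = 1` of the bound above, is enough. -/
theorem summable_fourier_binTurns {ε : ℝ} (hε : 0 < ε) (l : ℕ) :
    Summable fun n : ℤ => 𝓕 (binTurns ε l) n := by
  have key : ∀ σ : ℝ, |σ| = 1 → Summable fun n : ℕ => 𝓕 (binTurns ε l) (σ * n) := by
    intro σ hσ
    refine Summable.of_norm_bounded_eventually_nat
      (g := fun n : ℕ => ε / (4 * π) * (8 * bumpConst * (20 ^ 1 * ((1 : ℕ).factorial : ℝ) ^ 2)) *
        (2 / ε) ^ 2 * (1 / (n : ℝ) ^ 2))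
      ((Real.summable_one_div_nat_pow.2 one_lt_two).mul_left _) ?_
    filter_upwards [Filter.eventually_gt_atTop 0] with n hn
    have hn' : (0 : ℝ) < n := by exact_mod_cast hn
    have hne : σ * n ≠ 0 := by
      rw [← abs_pos, abs_mul, hσ, one_mul]
      positivity
    refine (norm_fourier_binTurns_le_pow hε l 1 hne).trans_eq ?_
    have h1 : (2 / (ε * (n : ℝ))) ^ (1 + 1) = (2 / ε) ^ 2 * (1 / (n : ℝ) ^ 2) := by
      rw [div_pow, div_pow, mul_pow]
      field_simp
      ring
    rw [abs_mul, hσ, one_mul, abs_of_pos hn', h1, ← mul_assoc]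
  refine Summable.of_nat_of_neg ?_ ?_
  · simpa using key 1 (by simp)
  · simpa using key (-1) (by simp)

/-- The Fourier series of the periodized bin function. -/
theorem hasSum_binCoeff {ε : ℝ} (hε : 0 < ε) (l : ℕ) (θ : ℝ) :
    HasSum (fun k : ℕ => 2 * (Complex.exp (Complex.I * (((k + 1 : ℕ) * θ : ℝ) : ℂ)) *
      binCoeff ε l (k + 1)).re) (binPeriodic ε l θ - (binCoeff ε l 0).re) := by
  have hpi := pi_pos
  set g : ℤ → ℂ := fun n => 𝓕 (binTurns ε l) n *
    fourier n ((θ / (2 * π) : ℝ) : UnitAddCircle) with hg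
  have hsumm : Summable g := by
    refine Summable.of_norm_bounded (summable_fourier_binTurns hε l).norm fun n => ?_
    rw [hg, norm_mul, fourier_apply, Circle.norm_coe, mul_one]
  -- Poisson summation identifies the sum of translates with the Fourier series, pointwise in `θ`.
  have hpoisson := SchwartzMap.tsum_eq_tsum_fourier
    ((hasCompactSupport_binTurns hε l).toSchwartzMap (contDiff_binTurns ε l)) (θ / (2 * π))
  rw [SchwartzMap.fourier_coe] at hpoisson
  have hleft : ∑' n : ℤ, ((hasCompactSupport_binTurns hε l).toSchwartzMap (contDiff_binTurns ε l))
      (θ / (2 * π) + n) = (binPeriodic ε l θ : ℂ) := by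
    rw [binPeriodic, Complex.ofReal_tsum]
    refine tsum_congr fun m => ?_
    change binTurns ε l _ = _
    rw [binTurns_eq hε]
    congr 2
    field_simp
  rw [hleft] at hpoisson
  have hs : HasSum g (binPeriodic ε l θ : ℂ) := by
    rw [hpoisson]
    exact hsumm.hasSum
  -- Folding the sum over `ℤ` counts the term `n = 0` twice; dropping the first term removes both
  -- copies and leaves the total minus `g 0`.
  have h2 := (hasSum_nat_add_iff' (f := fun n : ℕ => g n + g (-n)) 1).2 hs.nat_add_neg
  simp only [Finset.range_one, Finset.sum_singleton] at h2
  have h3 := Complex.reCLM.hasSum h2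
  have hg0 : g 0 = binCoeff ε l 0 := by
    rw [hg, binCoeff_eq hε]
    simp
  convert h3 using 1
  · ext k
    have hgk : g ((k + 1 : ℕ) : ℤ) = Complex.exp (Complex.I * (((k + 1 : ℕ) * θ : ℝ) : ℂ)) *
        binCoeff ε l (k + 1) := by
      simp only [hg]
      rw [binCoeff_eq hε, fourier_coe_apply, mul_comm]
      congr 2
      push_cast
      field_simp
    have hgk' : g (-((k + 1 : ℕ) : ℤ)) = (starRingEnd ℂ) (g ((k + 1 : ℕ) : ℤ)) := by
      simp only [hg]
      rw [map_mul, fourier_neg]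
      congr 1
      push_cast
      exact fourier_binTurns_neg l _
    rw [hgk', Complex.reCLM_apply, Complex.add_re, Complex.conj_re, hgk]
    ring
  · rw [Complex.reCLM_apply]
    simp only [Nat.cast_zero, neg_zero]
    rw [hg0]
    simp

/-! ### The tail of the Fourier series. -/

theorem factorial_succ_sq_le (q : ℕ) :
    ((q + 1).factorial : ℝ) ^ 2 ≤ 4 ^ q * ((q : ℝ) ^ 2) ^ q := by
  have h1 : ((q + 1).factorial : ℝ) ≤ 2 ^ q * (q : ℝ) ^ q := by
    rw [Nat.factorial_succ]
    push_cast
    have h2 : (q.factorial : ℝ) ≤ (q : ℝ) ^ q := by exact_mod_cast Nat.factorial_le_pow q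
    have h3 : (q : ℝ) + 1 ≤ 2 ^ q := by exact_mod_cast (Nat.lt_two_pow_self (n := q))
    gcongr
  calc ((q + 1).factorial : ℝ) ^ 2 ≤ (2 ^ q * (q : ℝ) ^ q) ^ 2 := by gcongr
    _ = 4 ^ q * ((q : ℝ) ^ 2) ^ q := by
      rw [mul_pow, ← pow_mul, ← pow_mul, ← pow_mul, mul_comm q 2, pow_mul]
      norm_num

/-- A polynomial bound of arbitrary order on the tail of the Fourier series. -/
theorem norm_binCoeff_tail_le {ε : ℝ} (hε : 0 < ε) (l q : ℕ) {K : ℕ} (hK : 0 < K) (k : ℕ) :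
    ‖binCoeff ε l (k + K + 1)‖ ≤
      160 * bumpConst / π * ε⁻¹ * (160 * (q : ℝ) ^ 2 / (ε * K)) ^ q * (1 / ((k : ℝ) + 1) ^ 2) := by
  have hpi := pi_pos
  have hb := bumpConst_pos
  have hK' : (0 : ℝ) < K := by exact_mod_cast hK
  rw [binCoeff_eq hε]
  have hk : (0 : ℝ) < ((k + K + 1 : ℕ) : ℝ) := by positivity
  refine (norm_fourier_binTurns_le_pow hε l (q + 1) hk.ne').trans ?_
  rw [abs_of_pos hk]
  -- Of the `q + 2` powers, two provide summability in `k`; the other `q` are spent on `K`, where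
  -- they meet the `(q²)^q` coming from the factorials.
  have h1 : (2 / (ε * ((k + K + 1 : ℕ) : ℝ))) ^ (q + 1 + 1) ≤
      (2 / (ε * K)) ^ q * ((2 / ε) ^ 2 * (1 / ((k : ℝ) + 1) ^ 2)) := by
    rw [show q + 1 + 1 = q + 2 from rfl, pow_add]
    have h2 : (2 / ε) ^ 2 * (1 / ((k : ℝ) + 1) ^ 2) = (2 / (ε * ((k : ℝ) + 1))) ^ 2 := by
      rw [div_pow, div_pow, mul_pow]
      field_simp
    rw [h2]
    push_cast
    have hk0 : (0 : ℝ) ≤ k := Nat.cast_nonneg k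
    gcongr
    · linarith
    · linarith
  calc ε / (4 * π) * (8 * bumpConst * (20 ^ (q + 1) * ((q + 1).factorial : ℝ) ^ 2)) *
        (2 / (ε * ((k + K + 1 : ℕ) : ℝ))) ^ (q + 1 + 1)
      ≤ ε / (4 * π) * (8 * bumpConst * (20 ^ (q + 1) * (4 ^ q * ((q : ℝ) ^ 2) ^ q))) *
        ((2 / (ε * K)) ^ q * ((2 / ε) ^ 2 * (1 / ((k : ℝ) + 1) ^ 2))) := by
        gcongr
        exact factorial_succ_sq_le q
    _ = (ε / (4 * π) * (8 * bumpConst * 20) * (2 / ε) ^ 2) *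
        (20 ^ q * 4 ^ q * ((q : ℝ) ^ 2) ^ q * (2 / (ε * K)) ^ q) * (1 / ((k : ℝ) + 1) ^ 2) := by
        rw [pow_succ (20 : ℝ) q]
        ring
    _ = _ := by
        rw [← mul_pow, ← mul_pow, ← mul_pow]
        congr 2
        · field_simp
          norm_num
        · congr 1
          ring

/-- The tail of the Fourier series of the bin functions beyond the signal length is small. -/
theorem exists_binCoeff_tail_le : ∃ cK : ℝ, 0 < cK ∧ ∀ ε : ℝ, 0 < ε → 1 ≤ log ε⁻¹ →
    ∀ l K : ℕ, cK * ε⁻¹ * log ε⁻¹ ^ 2 ≤ K →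
      (Summable fun k : ℕ => ‖binCoeff ε l (k + K + 1)‖) ∧
        ∑' k : ℕ, ‖binCoeff ε l (k + K + 1)‖ ≤ ε / 8 := by
  have hpi := pi_pos
  have hb := bumpConst_pos
  have hS : Summable fun k : ℕ => 1 / ((k : ℝ) + 1) ^ 2 := by
    have := (summable_nat_add_iff 1).2 (Real.summable_one_div_nat_pow.2 one_lt_two)
    simpa using this
  set C := 160 * bumpConst / π * ∑' k : ℕ, 1 / ((k : ℝ) + 1) ^ 2 with hC
  have hC0 : 0 ≤ C := mul_nonneg (by positivity) (tsum_nonneg fun k => by positivity)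
  -- With `q ≤ 2ℓ` the ratio `160q²/(εK)` is at most `640ℓ²/(εK)`, and this constant pushes it below
  -- `e^(-(2+8C))`.
  refine ⟨640 * exp (2 + 8 * C), by positivity, fun ε hε hlog l K hK => ?_⟩
  set ℓ := log ε⁻¹ with hℓ
  have hℓ0 : 0 < ℓ := by linarith
  have hKpos : (0 : ℝ) < K := lt_of_lt_of_le (by positivity) hK
  have hKpos' : 0 < K := by exact_mod_cast hKpos
  -- The order of decay is about `ln ε⁻¹`. The `q`-th power of the ratio is then at most `ε²
  -- e^(-8C)`: one `ε` cancels the prefactor `ε⁻¹`, and `e^(-8C)` absorbs `C`.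
  set q := ⌈ℓ⌉₊ with hq
  have hq1 : ℓ ≤ q := Nat.le_ceil ℓ
  have hq2 : (q : ℝ) ≤ 2 * ℓ := by
    have := Nat.ceil_lt_add_one hℓ0.le
    linarith
  have hbound := norm_binCoeff_tail_le hε l q hKpos'
  have hsum := hS.mul_left (160 * bumpConst / π * ε⁻¹ * (160 * (q : ℝ) ^ 2 / (ε * K)) ^ q)
  have hsumm : Summable fun k : ℕ => ‖binCoeff ε l (k + K + 1)‖ :=
    Summable.of_nonneg_of_le (fun _ => norm_nonneg _) hbound hsum
  refine ⟨hsumm, (hsumm.tsum_le_tsum hbound hsum).trans ?_⟩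
  rw [tsum_mul_left]
  have hratio : 160 * (q : ℝ) ^ 2 / (ε * K) ≤ exp (-(2 + 8 * C)) := by
    rw [div_le_iff₀ (by positivity), exp_neg, ← div_eq_inv_mul, le_div_iff₀ (exp_pos _)]
    calc 160 * (q : ℝ) ^ 2 * exp (2 + 8 * C) ≤ 160 * (2 * ℓ) ^ 2 * exp (2 + 8 * C) := by gcongr
      _ = ε * (640 * exp (2 + 8 * C) * ε⁻¹ * ℓ ^ 2) := by field_simp; ring
      _ ≤ ε * K := by gcongr
  have hpow : (160 * (q : ℝ) ^ 2 / (ε * K)) ^ q ≤ ε ^ 2 * exp (-(8 * C)) := by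
    calc (160 * (q : ℝ) ^ 2 / (ε * K)) ^ q ≤ exp (-(2 + 8 * C)) ^ q := by gcongr
      _ = exp (-((2 + 8 * C) * q)) := by rw [← exp_nat_mul]; congr 1; ring
      _ ≤ exp (-(2 * ℓ + 8 * C)) := by
        rw [exp_le_exp, neg_le_neg_iff]
        nlinarith
      _ = ε ^ 2 * exp (-(8 * C)) := by
        rw [neg_add, exp_add]
        congr 1
        rw [hℓ, log_inv, show -(2 * -log ε) = (2 : ℕ) * log ε by push_cast; ring, exp_nat_mul,
          exp_log hε]
  have hC8 : C * exp (-(8 * C)) ≤ 1 / 8 := by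
    rw [exp_neg, ← div_eq_mul_inv, div_le_iff₀ (exp_pos _)]
    linarith [add_one_le_exp (8 * C)]
  calc 160 * bumpConst / π * ε⁻¹ * (160 * (q : ℝ) ^ 2 / (ε * K)) ^ q *
        ∑' k : ℕ, 1 / ((k : ℝ) + 1) ^ 2
      = C * ε⁻¹ * (160 * (q : ℝ) ^ 2 / (ε * K)) ^ q := by rw [hC]; ring
    _ ≤ C * ε⁻¹ * (ε ^ 2 * exp (-(8 * C))) := by gcongr
    _ = ε * (C * exp (-(8 * C))) := by field_simp
    _ ≤ ε * (1 / 8) := by gcongr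
    _ = ε / 8 := by ring

/-! ### Statistics of the circuits. -/

namespace QPESystem

variable {N : ℕ} (S : QPESystem N)

/-- The phase function `⟨Ψ, (U e ^ (-i χ)) ^ r Ψ⟩`. -/
noncomputable def phaseFun (χ r : ℝ) : ℂ :=
  ∑ j, ((‖inner ℂ (S.basis j) S.Ψ‖ ^ 2 : ℝ) : ℂ) *
    Complex.exp (Complex.I * ((r * circMod (S.phase j - χ) : ℝ) : ℂ))

theorem inner_evolved (χ r : ℝ) : inner ℂ S.Ψ (S.evolved χ r) = S.phaseFun χ r := by
  unfold evolved phaseFun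
  rw [inner_sum]
  refine Finset.sum_congr rfl fun j _ => ?_
  rw [inner_smul_right, mul_assoc, ← inner_conj_symm S.Ψ (S.basis j), Complex.mul_conj,
    Complex.normSq_eq_norm_sq, mul_comm]

theorem sum_sq_norm_inner : ∑ j, ‖inner ℂ (S.basis j) S.Ψ‖ ^ 2 = 1 := by
  rw [S.basis.sum_sq_norm_inner_right, S.norm_state, one_pow]

theorem norm_axisFactor (axis : Bool) : ‖axisFactor axis‖ = 1 := by
  cases axis <;> simp [axisFactor]

theorem norm_sign (o : Bool) : ‖(sign o : ℂ)‖ = 1 := by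
  cases o <;> simp [sign]

/-- Expanding the square leaves one interference term. The mean outcome is thus the real part of the
phase function for the `X` axis and minus its imaginary part for the `Y` axis. -/
theorem outcomeProb_eq (χ r : ℝ) (axis o : Bool) :
    S.outcomeProb χ r axis o = (1 + sign o * (axisFactor axis * S.phaseFun χ r).re) / 2 := by
  unfold outcomeProb
  rw [norm_smul, mul_pow, @norm_add_sq ℂ, norm_smul, S.norm_state, S.norm_evolved, norm_mul,
    norm_sign, norm_axisFactor, inner_smul_right, inner_evolved, mul_assoc]
  have h : RCLike.re ((sign o : ℂ) * (axisFactor axis * S.phaseFun χ r)) =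
      sign o * (axisFactor axis * S.phaseFun χ r).re := by
    rw [RCLike.re_eq_complex_re, Complex.re_ofReal_mul]
  rw [h]
  norm_num
  ring

theorem outcomeProb_nonneg (χ r : ℝ) (axis o : Bool) : 0 ≤ S.outcomeProb χ r axis o := sq_nonneg _

theorem toReal_coin (χ r : ℝ) (axis o : Bool) :
    (S.coin χ r axis o).toReal = S.outcomeProb χ r axis o := by
  rw [coin, PMF.ofFintype_apply, ENNReal.toReal_ofReal (S.outcomeProb_nonneg _ _ _ _)]

/-- The mean outcome of the circuit. -/
noncomputable def meanOutcome (χ r : ℝ) (axis : Bool) : ℝ :=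
  (axisFactor axis * S.phaseFun χ r).re

theorem abs_meanOutcome_le (χ r : ℝ) (axis : Bool) : |S.meanOutcome χ r axis| ≤ 1 := by
  have h1 := S.outcomeProb_nonneg χ r axis true
  have h2 := S.outcomeProb_nonneg χ r axis false
  rw [outcomeProb_eq] at h1 h2
  simp only [sign] at h1 h2
  rw [abs_le, meanOutcome]
  constructor <;> linarith

/-- The centred outcome is sub-Gaussian. -/
theorem coin_mgf_le (χ r : ℝ) (axis : Bool) {s : ℝ} (hs : |s| ≤ 1 / 2) :
    ∑ o, (S.coin χ r axis o).toReal * exp (s * (sign o - S.meanOutcome χ r axis)) ≤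
      exp (4 * s ^ 2) := by
  have hμ := S.abs_meanOutcome_le χ r axis
  have hp := S.outcomeProb_nonneg χ r axis
  set μ := S.meanOutcome χ r axis with hμdef
  -- The centred outcome is at most `2` in size, so the exponent is at most `1` and `e^y ≤ 1 + y +
  -- y²` applies; the linear term has mean zero.
  have hbound : ∀ o, exp (s * (sign o - μ)) ≤ 1 + s * (sign o - μ) + 4 * s ^ 2 := by
    intro o
    have h2 : |sign o - μ| ≤ 2 := by
      rw [abs_le] at hμ ⊢
      cases o <;> simp only [sign] <;> constructor <;> linarith
    have h3 : |s * (sign o - μ)| ≤ 1 := by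
      rw [abs_mul]
      calc |s| * |sign o - μ| ≤ 1 / 2 * 2 := by gcongr
        _ = 1 := by norm_num
    have h4 := (abs_le.1 (Real.abs_exp_sub_one_sub_id_le h3)).2
    have h5 : (s * (sign o - μ)) ^ 2 ≤ s ^ 2 * 2 ^ 2 := by
      rw [mul_pow]
      refine mul_le_mul_of_nonneg_left ?_ (sq_nonneg s)
      exact sq_le_sq' (by linarith [(abs_le.1 h2).1]) (abs_le.1 h2).2
    linarith
  calc ∑ o, (S.coin χ r axis o).toReal * exp (s * (sign o - μ))
      ≤ ∑ o, S.outcomeProb χ r axis o * (1 + s * (sign o - μ) + 4 * s ^ 2) := by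
        refine Finset.sum_le_sum fun o _ => ?_
        rw [toReal_coin]
        exact mul_le_mul_of_nonneg_left (hbound o) (hp o)
    _ = 4 * s ^ 2 + 1 := by
        simp only [Fintype.sum_bool, outcomeProb_eq, sign]
        rw [meanOutcome] at hμdef
        rw [← hμdef]
        ring
    _ ≤ exp (4 * s ^ 2) := add_one_le_exp _

end QPESystem

section chernoff

variable {ι α : Type} [Fintype ι] [DecidableEq ι] [Fintype α]

theorem toReal_prodPMF (p : ι → PMF α) (x : ι → α) :
    (prodPMF p x).toReal = ∏ i, (p i (x i)).toReal := by
  rw [prodPMF, PMF.ofFintype_apply, ENNReal.toReal_prod]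

/-- Independence in the form used for moment generating functions: the mean of a product of
one-coordinate functions factorizes. -/
theorem sum_prodPMF_mul_prod (p : ι → PMF α) (F : ι → α → ℝ) :
    ∑ x, (prodPMF p x).toReal * ∏ i, F i (x i) = ∏ i, ∑ a, (p i a).toReal * F i a := by
  rw [Finset.prod_univ_sum, Fintype.piFinset_univ]
  refine Finset.sum_congr rfl fun x _ => ?_
  rw [toReal_prodPMF, Finset.prod_mul_distrib]

theorem sum_toReal_eq_one (p : PMF α) : ∑ a, (p a).toReal = 1 := by
  have h := p.tsum_coe
  rw [tsum_fintype] at h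
  rw [← ENNReal.toReal_sum fun a _ => p.apply_ne_top a, h, ENNReal.toReal_one]

open Classical in
/-- Chernoff's bound for a sum of independent sub-Gaussian variables. -/
theorem prodPMF_chernoff (p : ι → PMF α) (Y : ι → α → ℝ) (B : Finset ι)
    (h : ∀ i ∈ B, ∀ s : ℝ, |s| ≤ 1 / 2 → ∑ a, (p i a).toReal * exp (s * Y i a) ≤ exp (4 * s ^ 2))
    {t : ℝ} (ht : 0 ≤ t) (ht4 : t ≤ 4) :
    ∑ x ∈ Finset.univ.filter (fun x : ι → α => B.card * t ≤ |∑ i ∈ B, Y i (x i)|),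
      (prodPMF p x).toReal ≤ 2 * exp (-(B.card * t ^ 2 / 16)) := by
  have key : ∀ s : ℝ, |s| ≤ 1 / 2 →
      ∑ x, (prodPMF p x).toReal * exp (s * ∑ i ∈ B, Y i (x i)) ≤ exp (B.card * (4 * s ^ 2)) := by
    intro s hs
    have h1 : ∀ x : ι → α, exp (s * ∑ i ∈ B, Y i (x i)) =
        ∏ i, (if i ∈ B then exp (s * Y i (x i)) else 1) := by
      intro x
      rw [Finset.mul_sum, exp_sum, Finset.prod_ite_mem, Finset.univ_inter]
    simp_rw [h1]
    rw [sum_prodPMF_mul_prod p (fun i a => if i ∈ B then exp (s * Y i a) else 1)]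
    have h2 : ∀ i, ∑ a, (p i a).toReal * (if i ∈ B then exp (s * Y i a) else 1) ≤
        if i ∈ B then exp (4 * s ^ 2) else 1 := by
      intro i
      by_cases hi : i ∈ B
      · simp only [if_pos hi]
        exact h i hi s hs
      · simp only [if_neg hi, mul_one]
        exact (sum_toReal_eq_one _).le
    refine (Finset.prod_le_prod (fun i _ => Finset.sum_nonneg fun a _ => ?_)
      fun i _ => h2 i).trans_eq ?_
    · refine mul_nonneg ENNReal.toReal_nonneg ?_
      split_ifs
      · exact (exp_pos _).le
      · exact zero_le_one
    · rw [Finset.prod_ite_mem, Finset.univ_inter, Finset.prod_const, ← exp_nat_mul]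
  -- The value `s = t/8` minimizes `4s² - st`, giving `-t²/16` per variable; it is admissible
  -- because `t ≤ 4`.
  have hk1 := key (t / 8) (by rw [abs_of_nonneg (by positivity)]; linarith)
  have hk2 := key (-(t / 8)) (by rw [abs_neg, abs_of_nonneg (by positivity)]; linarith)
  rw [neg_sq] at hk2
  have hmarkov : ∀ x : ι → α, B.card * t ≤ |∑ i ∈ B, Y i (x i)| →
      1 ≤ exp (-(t / 8 * (B.card * t))) * (exp (t / 8 * ∑ i ∈ B, Y i (x i)) +
        exp (-(t / 8) * ∑ i ∈ B, Y i (x i))) := by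
    intro x hx
    have hpos : ∀ y : ℝ, B.card * t ≤ y → 1 ≤ exp (-(t / 8 * (B.card * t))) * exp (t / 8 * y) := by
      intro y hy
      rw [← exp_add, one_le_exp_iff]
      have : t / 8 * (B.card * t) ≤ t / 8 * y := by gcongr
      linarith
    rw [mul_add]
    rcases le_abs.1 hx with hx | hx
    · have := hpos _ hx
      have h0 : 0 ≤ exp (-(t / 8 * (B.card * t))) * exp (-(t / 8) * ∑ i ∈ B, Y i (x i)) := by
        positivity
      linarith
    · have := hpos _ hx
      rw [show t / 8 * -∑ i ∈ B, Y i (x i) = -(t / 8) * ∑ i ∈ B, Y i (x i) by ring] at this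
      have h0 : 0 ≤ exp (-(t / 8 * (B.card * t))) * exp (t / 8 * ∑ i ∈ B, Y i (x i)) := by
        positivity
      linarith
  calc ∑ x ∈ Finset.univ.filter (fun x : ι → α => B.card * t ≤ |∑ i ∈ B, Y i (x i)|),
      (prodPMF p x).toReal
      ≤ ∑ x ∈ Finset.univ.filter (fun x : ι → α => B.card * t ≤ |∑ i ∈ B, Y i (x i)|),
        (prodPMF p x).toReal * (exp (-(t / 8 * (B.card * t))) *
          (exp (t / 8 * ∑ i ∈ B, Y i (x i)) + exp (-(t / 8) * ∑ i ∈ B, Y i (x i)))) := by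
        refine Finset.sum_le_sum fun x hx => ?_
        exact le_mul_of_one_le_right ENNReal.toReal_nonneg (hmarkov x (Finset.mem_filter.1 hx).2)
    _ ≤ ∑ x, (prodPMF p x).toReal * (exp (-(t / 8 * (B.card * t))) *
          (exp (t / 8 * ∑ i ∈ B, Y i (x i)) + exp (-(t / 8) * ∑ i ∈ B, Y i (x i)))) := by
        refine Finset.sum_le_sum_of_subset_of_nonneg (Finset.filter_subset _ _) fun x _ _ => ?_
        exact mul_nonneg ENNReal.toReal_nonneg (by positivity)
    _ = exp (-(t / 8 * (B.card * t))) *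
          (∑ x, (prodPMF p x).toReal * exp (t / 8 * ∑ i ∈ B, Y i (x i)) +
            ∑ x, (prodPMF p x).toReal * exp (-(t / 8) * ∑ i ∈ B, Y i (x i))) := by
        rw [← Finset.sum_add_distrib, Finset.mul_sum]
        refine Finset.sum_congr rfl fun x _ => ?_
        ring
    _ ≤ exp (-(t / 8 * (B.card * t))) *
          (exp (B.card * (4 * (t / 8) ^ 2)) + exp (B.card * (4 * (t / 8) ^ 2))) := by
        gcongr
    _ = 2 * exp (-(B.card * t ^ 2 / 16)) := by
        rw [← two_mul, mul_left_comm, ← exp_add]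
        congr 2
        ring

end chernoff

/-- The block of repetitions of one circuit at one point. -/
def shotBlock {K M : ℕ} (i : Fin K) (axis : Bool) : Finset (Fin K × Bool × Fin M) :=
  Finset.univ.map ⟨fun m => (i, axis, m), fun a b h => by simpa using h⟩

/-- The deviation of the total outcome of one circuit from its mean. -/
noncomputable def shotDeviation {N : ℕ} (S : QPESystem N) (χ k : ℝ) {K M : ℕ} (x : Shots K M)
    (i : Fin K) (axis : Bool) : ℝ :=
  ∑ m, (QPESystem.sign (x (i, axis, m)) - S.meanOutcome χ (k * ((i : ℕ) + 1)) axis)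

-- Union bound over the `2K` circuits, each with a two-sided tail, hence the factor `4K`.
open Classical in
theorem sum_sampleShots_deviation_le {N : ℕ} (S : QPESystem N) (χ k : ℝ) (K M : ℕ) {t : ℝ}
    (ht : 0 ≤ t) (ht4 : t ≤ 4) :
    ∑ x ∈ Finset.univ.filter
      (fun x : Shots K M => ∃ i axis, M * t ≤ |shotDeviation S χ k x i axis|),
      (sampleShots S χ k K M x).toReal ≤ 4 * K * exp (-(M * t ^ 2 / 16)) := by
  have h1 : ∀ (i : Fin K) (axis : Bool), ∑ x ∈ Finset.univ.filter
      (fun x : Shots K M => M * t ≤ |shotDeviation S χ k x i axis|),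
      (sampleShots S χ k K M x).toReal ≤ 2 * exp (-(M * t ^ 2 / 16)) := by
    intro i axis
    have := prodPMF_chernoff
      (fun i : Fin K × Bool × Fin M => S.coin χ (k * ((i.1 : ℕ) + 1)) i.2.1)
      (fun i o => QPESystem.sign o - S.meanOutcome χ (k * ((i.1 : ℕ) + 1)) i.2.1)
      (shotBlock i axis) (fun i _ s hs => S.coin_mgf_le _ _ _ hs) ht ht4
    simp only [shotBlock, Finset.card_map, Finset.card_univ, Fintype.card_fin, Finset.sum_map] at this
    exact this
  calc _ ≤ ∑ q : Fin K × Bool,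
        ∑ x ∈ Finset.univ.filter (fun x : Shots K M => M * t ≤ |shotDeviation S χ k x q.1 q.2|),
          (sampleShots S χ k K M x).toReal := by
        simp_rw [Finset.sum_filter]
        rw [Finset.sum_comm]
        refine Finset.sum_le_sum fun x _ => ?_
        split_ifs with h
        · obtain ⟨i, axis, h⟩ := h
          refine le_trans ?_ (Finset.single_le_sum (f := fun q : Fin K × Bool =>
            if M * t ≤ |shotDeviation S χ k x q.1 q.2| then (sampleShots S χ k K M x).toReal else 0)
            (fun q _ => ?_) (Finset.mem_univ (i, axis)))
          · rw [if_pos h]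
          · split_ifs
            · exact ENNReal.toReal_nonneg
            · exact le_rfl
        · refine Finset.sum_nonneg fun q _ => ?_
          split_ifs
          · exact ENNReal.toReal_nonneg
          · exact le_rfl
    _ ≤ ∑ q : Fin K × Bool, 2 * exp (-(M * t ^ 2 / 16)) := Finset.sum_le_sum fun q _ => h1 q.1 q.2
    _ = 4 * K * exp (-(M * t ^ 2 / 16)) := by
        rw [Finset.sum_const, nsmul_eq_mul, Finset.card_univ, Fintype.card_prod, Fintype.card_fin,
          Fintype.card_bool]
        push_cast
        ring

/-! ### From accurate bin weights to a conservative set of estimates. -/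

theorem numBins_mul {ε : ℝ} (hε : 0 < ε) (h : ∃ L : ℕ, (L : ℝ) * ε = 2 * π) :
    (numBins ε : ℝ) * ε = 2 * π := by
  obtain ⟨L, hL⟩ := h
  have : 2 * π / ε = L := by rw [← hL]; field_simp
  rw [numBins, this, Nat.ceil_natCast, hL]

/-- Every point of the circle lies in some bin. -/
theorem exists_bin {L : ℕ} {ε : ℝ} (hε : 0 < ε) (hL : (L : ℝ) * ε = 2 * π) (z : ℝ) :
    ∃ l < L, ∃ m : ℤ, |z + 2 * π * m - l * ε| ≤ ε / 2 := by
  have hL0 : 0 < L := by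
    rcases Nat.eq_zero_or_pos L with rfl | h
    · simp at hL
    · exact h
  have hL' : (0 : ℤ) < L := by exact_mod_cast hL0
  set r := round (z / ε) with hr
  have hround := abs_sub_round (z / ε)
  have h1 : |z - r * ε| ≤ ε / 2 := by
    have : z - r * ε = (z / ε - r) * ε := by field_simp
    rw [this, abs_mul, abs_of_pos hε]
    calc |z / ε - r| * ε ≤ 1 / 2 * ε := by gcongr
      _ = ε / 2 := by ring
  have h2 := Int.emod_nonneg r hL'.ne'
  refine ⟨(r % L).toNat, by have := Int.emod_lt_of_pos r hL'; omega, -(r / L), ?_⟩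
  have h3 : (((r % L).toNat : ℕ) : ℝ) = (r : ℝ) - L * ((r / L : ℤ) : ℝ) := by
    have : ((r % L).toNat : ℤ) = r - L * (r / L) := by
      rw [Int.toNat_of_nonneg h2, Int.emod_def]
    exact_mod_cast this
  rw [h3]
  have h4 : z + 2 * π * ((-(r / L) : ℤ) : ℝ) - ((r : ℝ) - L * ((r / L : ℤ) : ℝ)) * ε =
      z - r * ε := by
    rw [← hL]
    push_cast
    ring
  rwa [h4]

/-- The pruned set of bins is a conservative set of estimates for the points `pts`. -/
theorem prune_image_spec {L n : ℕ} {ε : ℝ} (hε : 0 < ε) (hL : (L : ℝ) * ε = 2 * π)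
    {pts : Finset ℝ} (hcard : pts.card ≤ n) (hn : n * (2 * ε) < π) {T : Finset ℕ}
    (hT : T ⊆ Finset.range L)
    (h₁ : ∀ p ∈ pts, ∃ l ∈ T, ∃ m : ℤ, |p + 2 * π * m - l * ε| ≤ ε / 2)
    (h₂ : ∀ l ∈ T, ∃ p ∈ pts, ∃ m : ℤ, |p + 2 * π * m - l * ε| < ε) :
    (∀ p ∈ pts, ∃ θ ∈ (prune L T).image (fun l : ℕ => (l : ℝ) * ε), circNorm (p - θ) ≤ 2 * ε) ∧
      (∀ θ ∈ (prune L T).image (fun l : ℕ => (l : ℝ) * ε), ∃ p ∈ pts, circNorm (p - θ) ≤ ε) ∧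
      ((prune L T).image (fun l : ℕ => (l : ℝ) * ε)).card ≤ n := by
  have hpi := pi_pos
  have hL0 : 0 < L := by
    rcases Nat.eq_zero_or_pos L with rfl | h
    · simp at hL
    · exact h
  have hcirc : ∀ (z : ℝ) (m : ℤ) (l : ℕ) (r : ℝ), |z + 2 * π * m - l * ε| ≤ r →
      circNorm (z - l * ε) ≤ r := by
    intro z m l r h
    rw [← circNorm_add_int_mul _ m]
    refine (circNorm_le_abs _).trans ?_
    rwa [show z - l * ε + 2 * π * m = z + 2 * π * m - l * ε by ring]
  -- If every bin were selected, arcs of radius `2ε` around at most `n` points would cover the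
  -- circle, against `2nε < π`. So the pruning walk has a proper starting point.
  have hne : ∃ m < L, m ∉ T := by
    by_contra! hall
    have := pi_le_card_mul_of_cover pts (r := 2 * ε) (by positivity) fun z _ => by
      obtain ⟨l, hl, m, hm⟩ := exists_bin hε hL z
      obtain ⟨p, hp, m', hm'⟩ := h₂ l (hall l hl)
      refine ⟨p, hp, (circNorm_sub_le p (l * ε) z).trans ?_⟩
      have e1 := hcirc z m l _ hm
      have e2 := hcirc p m' l _ hm'.le
      rw [circNorm_sub_comm] at e1
      linarith
    have h3 : (pts.card : ℝ) * (2 * ε) ≤ n * (2 * ε) := by gcongr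
    linarith
  obtain ⟨hp1, hp2, hp3⟩ := prune_spec hT hne
  have hpred : ∀ l : ℕ, circNorm (l * ε - (((l + (L - 1)) % L : ℕ) : ℝ) * ε) ≤ ε := by
    intro l
    have hdm := Nat.mod_add_div (l + (L - 1)) L
    have : (((l + (L - 1)) % L : ℕ) : ℝ) = l + L - 1 - L * (((l + (L - 1)) / L : ℕ) : ℝ) := by
      have h5 : ((((l + (L - 1)) % L : ℕ) + L * ((l + (L - 1)) / L) : ℕ) : ℝ) = (l : ℝ) + (L - 1) := by
        rw [hdm]
        push_cast [Nat.cast_sub (show 1 ≤ L from hL0)]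
        ring
      push_cast at h5 ⊢
      linarith
    rw [this]
    generalize (l + (L - 1)) / L = q
    have e : (l : ℝ) * ε - (l + L - 1 - L * (q : ℝ)) * ε = ε + 2 * π * (((q : ℤ) - 1 : ℤ) : ℝ) := by
      rw [← hL]
      push_cast
      ring
    rw [e, circNorm_add_int_mul]
    exact (circNorm_le_abs _).trans_eq (abs_of_pos hε)
  refine ⟨fun p hp => ?_, fun θ hθ => ?_, Finset.card_image_le.trans (le_trans ?_ hcard)⟩
  · obtain ⟨l, hl, m, hm⟩ := h₁ p hp
    have e1 := hcirc p m l _ hm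
    rcases hp3 l hl with h | h
    · exact ⟨_, Finset.mem_image_of_mem _ h, by linarith⟩
    · refine ⟨_, Finset.mem_image_of_mem _ h, (circNorm_sub_le p (l * ε) _).trans ?_⟩
      linarith [hpred l]
  · obtain ⟨l, hl, rfl⟩ := Finset.mem_image.1 hθ
    obtain ⟨p, hp, m, hm⟩ := h₂ l (hp1 hl)
    exact ⟨p, hp, hcirc p m l _ hm.le⟩
  -- Assigning to each surviving bin a point within `ε` is injective: two bins sharing a point have
  -- centres less than `2ε` apart, so they are cyclic neighbours, which pruning excludes.
  · choose! f hf g hg using h₂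
    refine Finset.card_le_card_of_injOn f (fun l hl => hf l (hp1 hl)) ?_
    have hadj : ∀ l ∈ prune L T, ∀ l' ∈ prune L T, f l = f l' → l < l' → False := by
      intro l hl l' hl' hff hll
      have a1 := abs_lt.1 (hg l (hp1 hl))
      have a2 := abs_lt.1 (hg l' (hp1 hl'))
      rw [hff] at a1
      have hlL := Finset.mem_range.1 (hT (hp1 hl))
      have hlL' := Finset.mem_range.1 (hT (hp1 hl'))
      set q : ℤ := g l' - g l with hq
      have hq' : (g l' : ℝ) = q + g l := by rw [hq]; push_cast; ring
      rw [hq'] at a2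
      rw [← hL] at a1 a2
      have b1 : ((l' : ℝ) - l - L * q) * ε < 2 * ε := by linarith [a1.1, a1.2, a2.1, a2.2]
      have b2 : -2 * ε < ((l' : ℝ) - l - L * q) * ε := by linarith [a1.1, a1.2, a2.1, a2.2]
      have c1 := lt_of_mul_lt_mul_right b1 hε.le
      have c2 := lt_of_mul_lt_mul_right b2 hε.le
      have d1 : (l' : ℤ) - l - L * q < 2 := by exact_mod_cast c1
      have d2 : -2 < (l' : ℤ) - l - L * q := by exact_mod_cast c2
      have hL3 : (L : ℤ) > 0 := by exact_mod_cast hL0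
      have q1 : q < 2 := by
        by_contra hc
        have : (L : ℤ) * 2 ≤ L * q := mul_le_mul_of_nonneg_left (not_lt.1 hc) hL3.le
        have : (L : ℤ) < 2 := by omega
        omega
      have q0 : -1 < q := by
        by_contra hc
        have : (L : ℤ) * q ≤ L * (-1) := mul_le_mul_of_nonneg_left (by omega) hL3.le
        omega
      have hq01 : q = 0 ∨ q = 1 := by omega
      -- Here `q = 0` means consecutive indices, and `q = 1` the pair `0`, `L - 1` across the wrap.
      rcases hq01 with h | h
      · rw [h] at d1 d2
        have : l' = l + 1 := by omega
        refine hp2 l' hl' ?_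
        rw [this, show l + 1 + (L - 1) = l + L by omega, Nat.add_mod_right, Nat.mod_eq_of_lt hlL]
        exact hl
      · rw [h] at d1 d2
        have e0 : l = 0 := by omega
        have e1 : l' = L - 1 := by omega
        refine hp2 l hl ?_
        rw [e0, zero_add, Nat.mod_eq_of_lt (by omega), ← e1]
        exact hl'
    intro l hl l' hl' hff
    rcases lt_trichotomy l l' with h | h | h
    · exact (hadj l hl l' hl' hff h).elim
    · exact h
    · exact (hadj l' hl' l hl hff.symm h).elim

/-- The phases of nonzero probability of the shifted unitary. -/
noncomputable def shiftedPhases {N : ℕ} (S : QPESystem N) (χ : ℝ) : Finset ℝ :=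
  S.phases.image fun x => circMod (x - χ)

/-- `Θ` is a conservative set of estimates of the phases `k φ`, `φ ∈ Ph`. -/
def IsExtracted (Ph : Finset ℝ) (n : ℕ) (ε k : ℝ) (Θ : Finset ℝ) : Prop :=
  (∀ φ ∈ Ph, ∃ θ ∈ Θ, circNorm (k * φ - θ) ≤ 2 * ε) ∧
    (∀ θ ∈ Θ, ∃ φ ∈ Ph, circNorm (k * φ - θ) ≤ ε) ∧ Θ.card ≤ n

/-- The weight of a bin. -/
noncomputable def binWeight {N : ℕ} (S : QPESystem N) (χ k ε : ℝ) (l : ℕ) : ℝ :=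
  ∑ j, ‖inner ℂ (S.basis j) S.Ψ‖ ^ 2 * binPeriodic ε l (k * circMod (S.phase j - χ))

/-- The bin nearest to a phase has weight at least `A/2`, so its estimate is at least `A/2 - ε/2 ≥
A/3`. Conversely an estimate of `A/3` forces true weight at least `A/3 - ε/2 > 0`, so some phase is
within `ε` of the bin centre. This is where `ε < A/3` enters. -/
theorem isExtracted_of_close {N : ℕ} {S : QPESystem N} {n : ℕ} {A ε₀ ε : ℝ}
    (hadm : AdmissibleErrors n A ε₀ ε) (hS : S.Promise A n) (χ k : ℝ) {bt : ℕ → ℝ}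
    (hbt : ∀ l, |bt l - binWeight S χ k ε l| ≤ ε / 2) :
    IsExtracted (shiftedPhases S χ) n ε k (extractPhases A ε bt) := by
  have hpi := pi_pos
  have hε := hadm.pos
  have hεA := hadm.lt
  have hL := numBins_mul hε hadm.tile
  have hn := hadm.one_le
  have hterm : ∀ l j, 0 ≤ ‖inner ℂ (S.basis j) S.Ψ‖ ^ 2 *
      binPeriodic ε l (k * circMod (S.phase j - χ)) := fun l j =>
    mul_nonneg (sq_nonneg _) (binPeriodic_nonneg hε _ _)
  set pts := (shiftedPhases S χ).image (fun φ => k * φ) with hpts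
  have hcard : pts.card ≤ n :=
    Finset.card_image_le.trans (Finset.card_image_le.trans hS.1.le)
  have hsmall : (n : ℝ) * (2 * ε) < π := by
    have h1 := hadm.sq_mul_le
    nlinarith
  have h₁ : ∀ p ∈ pts, ∃ l ∈ heavyBins A ε bt, ∃ m : ℤ, |p + 2 * π * m - l * ε| ≤ ε / 2 := by
    intro p hp
    obtain ⟨φ, hφ, rfl⟩ := Finset.mem_image.1 hp
    obtain ⟨x, hx, rfl⟩ := Finset.mem_image.1 hφ
    obtain ⟨l, hl, m, hm⟩ := exists_bin hε hL (k * circMod (x - χ))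
    refine ⟨l, ?_, m, hm⟩
    rw [heavyBins, Finset.mem_filter, Finset.mem_range]
    refine ⟨hl, ?_⟩
    have h2 := half_le_binPeriodic hε hm
    have h3 : S.weight x * (1 / 2) ≤ binWeight S χ k ε l := by
      unfold QPESystem.weight binWeight
      rw [Finset.sum_mul]
      refine le_trans (Finset.sum_le_sum fun j hj => ?_) (Finset.sum_le_sum_of_subset_of_nonneg
        (Finset.filter_subset (fun j => S.phase j = x) Finset.univ) fun j _ _ => hterm l j)
      rw [(Finset.mem_filter.1 hj).2]
      exact mul_le_mul_of_nonneg_left h2 (sq_nonneg _)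
    have h4 := hS.2 x hx
    have h5 := (abs_le.1 (hbt l)).1
    linarith
  have h₂ : ∀ l ∈ heavyBins A ε bt, ∃ p ∈ pts, ∃ m : ℤ, |p + 2 * π * m - l * ε| < ε := by
    intro l hl
    have h1 := (Finset.mem_filter.1 hl).2
    have h2 := (abs_le.1 (hbt l)).2
    have h3 : 0 < binWeight S χ k ε l := by linarith
    obtain ⟨j, -, hj⟩ := Finset.exists_ne_zero_of_sum_ne_zero h3.ne'
    have hw := left_ne_zero_of_mul hj
    obtain ⟨m, hm⟩ := exists_abs_lt_of_binPeriodic_ne_zero hε (right_ne_zero_of_mul hj)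
    refine ⟨_, Finset.mem_image_of_mem _ (Finset.mem_image_of_mem _ ?_), m, hm⟩
    rw [QPESystem.phases, Finset.mem_filter]
    refine ⟨Finset.mem_image_of_mem _ (Finset.mem_univ _), ?_⟩
    refine (lt_of_lt_of_le (lt_of_le_of_ne (sq_nonneg _) hw.symm) ?_).ne'
    exact Finset.single_le_sum (f := fun j => ‖inner ℂ (S.basis j) S.Ψ‖ ^ 2)
      (fun _ _ => sq_nonneg _) (Finset.mem_filter.2 ⟨Finset.mem_univ j, rfl⟩)
  obtain ⟨r1, r2, r3⟩ := prune_image_spec hε hL hcard hsmall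
    (Finset.filter_subset (fun l => A / 3 ≤ bt l) _) h₁ h₂
  refine ⟨fun φ hφ => r1 _ (Finset.mem_image_of_mem _ hφ), fun θ hθ => ?_, r3⟩
  obtain ⟨p, hp, h⟩ := r2 θ hθ
  obtain ⟨φ, hφ, rfl⟩ := Finset.mem_image.1 hp
  exact ⟨φ, hφ, h⟩

/-- The extracted estimates lie in `[0, 2π)`, whatever the data. -/
theorem extractPhases_mem {A ε : ℝ} (hε : 0 < ε) (hL : ∃ L : ℕ, (L : ℝ) * ε = 2 * π)
    {bt : ℕ → ℝ} {θ : ℝ} (hθ : θ ∈ extractPhases A ε bt) : θ ∈ Set.Ico 0 (2 * π) := by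
  obtain ⟨l, hl, rfl⟩ := Finset.mem_image.1 hθ
  -- The fold only erases, so this holds even for data that select every bin.
  have hsub : prune (numBins ε) (heavyBins A ε bt) ⊆ heavyBins A ε bt := by
    unfold prune
    generalize List.range (numBins ε) = Ls
    have : ∀ T' : Finset ℕ, T' ⊆ heavyBins A ε bt → (Ls.foldl
      (fun T' i =>
        let l := (sInf {m : ℕ | m ∉ heavyBins A ε bt} + i) % numBins ε
        if l ∈ T' ∧ (l + (numBins ε - 1)) % numBins ε ∈ T' then T'.erase l else T') T') ⊆
        heavyBins A ε bt := by
      induction Ls with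
      | nil => exact fun T' h => h
      | cons a Ls ih =>
        intro T' h
        rw [List.foldl_cons]
        refine ih _ ?_
        dsimp only
        split_ifs
        · exact (Finset.erase_subset _ _).trans h
        · exact h
    exact this _ subset_rfl
  have hlt := Finset.mem_range.1 (Finset.mem_filter.1 (hsub hl)).1
  refine ⟨by positivity, ?_⟩
  rw [← numBins_mul hε hL]
  gcongr

/-! ### Means of nonnegative functions under a probability mass function. -/

section mean

variable {α β : Type*}

/-- The mean of a nonnegative function. -/
noncomputable def mean (P : PMF α) (f : α → ℝ≥0∞) : ℝ≥0∞ := ∑' a, P a * f a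

theorem mean_bind (P : PMF α) (g : α → PMF β) (f : β → ℝ≥0∞) :
    mean (P.bind g) f = mean P fun a => mean (g a) f := by
  unfold mean
  simp_rw [PMF.bind_apply, ← ENNReal.tsum_mul_right, ← ENNReal.tsum_mul_left]
  rw [ENNReal.tsum_comm]
  simp_rw [mul_assoc]

theorem mean_pure (a : α) (f : α → ℝ≥0∞) : mean (PMF.pure a) f = f a := by
  unfold mean
  rw [tsum_eq_single a fun b hb => by rw [PMF.pure_apply_of_ne _ _ hb, zero_mul],
    PMF.pure_apply_self, one_mul]

theorem mean_map (P : PMF α) (h : α → β) (f : β → ℝ≥0∞) : mean (P.map h) f = mean P (f ∘ h) := by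
  rw [← PMF.bind_pure_comp, mean_bind]
  simp_rw [Function.comp_def, mean_pure]

theorem mean_le_of_support {P : PMF α} {f : α → ℝ≥0∞} {c : ℝ≥0∞} (h : ∀ a ∈ P.support, f a ≤ c) :
    mean P f ≤ c := by
  calc mean P f ≤ ∑' a, P a * c := by
        refine ENNReal.tsum_le_tsum fun a => ?_
        by_cases ha : P a = 0
        · rw [ha, zero_mul, zero_mul]
        · exact mul_le_mul_right (h a ((P.mem_support_iff a).2 ha)) _
    _ = c := by rw [ENNReal.tsum_mul_right, P.tsum_coe, one_mul]

open Classical in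
/-- A mean is bounded through the values on a likely event and on its complement. -/
theorem mean_le_add_mul {P : PMF α} {f : α → ℝ≥0∞} {c₁ c₂ β : ℝ≥0∞} (G : α → Prop)
    (hG : mean P (fun a => if G a then 0 else 1) ≤ β) (h₁ : ∀ a ∈ P.support, G a → f a ≤ c₁)
    (h₂ : ∀ a ∈ P.support, f a ≤ c₂) : mean P f ≤ c₁ + c₂ * β := by
  calc mean P f ≤ ∑' a, (P a * c₁ + c₂ * (P a * if G a then 0 else 1)) := by
        refine ENNReal.tsum_le_tsum fun a => ?_
        by_cases ha : P a = 0
        · rw [ha, zero_mul]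
          exact zero_le
        · have ha' := (P.mem_support_iff a).2 ha
          split_ifs with hg
          · rw [mul_zero, mul_zero, add_zero]
            exact mul_le_mul_right (h₁ a ha' hg) _
          · rw [mul_one, mul_comm c₂]
            exact le_add_left (mul_le_mul_right (h₂ a ha') _)
    _ = c₁ + c₂ * mean P (fun a => if G a then 0 else 1) := by
        rw [ENNReal.tsum_add, ENNReal.tsum_mul_right, P.tsum_coe, one_mul, ENNReal.tsum_mul_left]
        rfl
    _ ≤ c₁ + c₂ * β := by gcongr

end mean

/-! ### Failure probability of the extraction. -/

theorem norm_phaseFun_le {N : ℕ} (S : QPESystem N) (χ r : ℝ) : ‖S.phaseFun χ r‖ ≤ 1 := by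
  unfold QPESystem.phaseFun
  refine (norm_sum_le _ _).trans ?_
  rw [← S.sum_sq_norm_inner]
  refine Finset.sum_le_sum fun j _ => ?_
  rw [norm_mul, mul_comm Complex.I, Complex.norm_exp_ofReal_mul_I, mul_one, Complex.norm_real,
    Real.norm_of_nonneg (sq_nonneg _)]

/-- The Fourier series of the weight of a bin. -/
theorem hasSum_binWeight {N : ℕ} (S : QPESystem N) (χ k : ℝ) {ε : ℝ} (hε : 0 < ε) (l : ℕ) :
    HasSum (fun i : ℕ => 2 * (S.phaseFun χ (k * (i + 1)) * binCoeff ε l (i + 1)).re)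
      (binWeight S χ k ε l - (binCoeff ε l 0).re) := by
  have h := hasSum_sum (s := Finset.univ) fun j _ =>
    (hasSum_binCoeff hε l (k * circMod (S.phase j - χ))).mul_left
      (‖inner ℂ (S.basis j) S.Ψ‖ ^ 2)
  have e₁ : (fun i : ℕ => 2 * (S.phaseFun χ (k * (i + 1)) * binCoeff ε l (i + 1)).re) =
      fun i : ℕ => ∑ j, ‖inner ℂ (S.basis j) S.Ψ‖ ^ 2 *
        (2 * (Complex.exp (Complex.I * (((i + 1 : ℕ) * (k * circMod (S.phase j - χ)) : ℝ) : ℂ)) *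
          binCoeff ε l (i + 1)).re) := by
    ext i
    unfold QPESystem.phaseFun
    rw [Finset.sum_mul, Complex.re_sum, Finset.mul_sum]
    refine Finset.sum_congr rfl fun j _ => ?_
    rw [mul_assoc, Complex.re_ofReal_mul, mul_left_comm]
    congr 7
    push_cast
    ring
  have e₂ : binWeight S χ k ε l - (binCoeff ε l 0).re = ∑ j, ‖inner ℂ (S.basis j) S.Ψ‖ ^ 2 *
      (binPeriodic ε l (k * circMod (S.phase j - χ)) - (binCoeff ε l 0).re) := by
    simp_rw [mul_sub]
    rw [Finset.sum_sub_distrib, ← Finset.sum_mul, S.sum_sq_norm_inner, one_mul]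
    rfl
  rw [e₁, e₂]
  exact h

theorem norm_phaseFunEstimate_sub_le {N : ℕ} (S : QPESystem N) (χ k : ℝ) {K M : ℕ} (hM : 0 < M)
    {x : Shots K M} {t : ℝ} {i : Fin K}
    (hx : ∀ axis, |shotDeviation S χ k x i axis| ≤ M * t) :
    ‖phaseFunEstimate x i - S.phaseFun χ (k * ((i : ℕ) + 1))‖ ≤ 2 * t := by
  have hM' : (0 : ℝ) < M := by exact_mod_cast hM
  set g := S.phaseFun χ (k * ((i : ℕ) + 1)) with hg
  have hdev : ∀ axis, (∑ m, QPESystem.sign (x (i, axis, m))) / M =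
      S.meanOutcome χ (k * ((i : ℕ) + 1)) axis + shotDeviation S χ k x i axis / M := by
    intro axis
    rw [shotDeviation, Finset.sum_sub_distrib, Finset.sum_const, Finset.card_univ,
      Fintype.card_fin, nsmul_eq_mul]
    field_simp
    ring
  have h1 : S.meanOutcome χ (k * ((i : ℕ) + 1)) false = g.re := by
    simp [QPESystem.meanOutcome, QPESystem.axisFactor, hg]
  have h2 : S.meanOutcome χ (k * ((i : ℕ) + 1)) true = -g.im := by
    simp [QPESystem.meanOutcome, QPESystem.axisFactor, hg]
  have e : phaseFunEstimate x i - g = ((shotDeviation S χ k x i false / M : ℝ) : ℂ) -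
      Complex.I * ((shotDeviation S χ k x i true / M : ℝ) : ℂ) := by
    rw [phaseFunEstimate, hdev, hdev, h1, h2]
    apply Complex.ext <;> simp
  have hb : ∀ axis, |shotDeviation S χ k x i axis / M| ≤ t := by
    intro axis
    rw [abs_div, abs_of_pos hM', div_le_iff₀ hM', mul_comm]
    exact hx axis
  rw [e]
  refine (norm_sub_le _ _).trans ?_
  rw [norm_mul, Complex.norm_I, one_mul, Complex.norm_real, Complex.norm_real, norm_eq_abs,
    norm_eq_abs]
  linarith [hb false, hb true]

/-- The bin weights are estimated accurately if all mean outcomes are. -/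
theorem abs_binEstimate_sub_le {N : ℕ} (S : QPESystem N) (χ k : ℝ) {ε : ℝ} (hε : 0 < ε)
    {K M : ℕ} (hK : 0 < K) (hM : 0 < M) (l : ℕ)
    (hsumm : Summable fun i : ℕ => ‖binCoeff ε l (i + K + 1)‖)
    (htail : ∑' i : ℕ, ‖binCoeff ε l (i + K + 1)‖ ≤ ε / 8) {x : Shots K M}
    (hx : ∀ i axis, |shotDeviation S χ k x i axis| ≤ M * (1 / (16 * K))) :
    |binEstimate ε x l - binWeight S χ k ε l| ≤ ε / 2 := by
  have hK' : (0 : ℝ) < K := by exact_mod_cast hK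
  set f : ℕ → ℝ := fun i => 2 * (S.phaseFun χ (k * (i + 1)) * binCoeff ε l (i + 1)).re with hf
  have h1 := (hasSum_nat_add_iff' K).2 (hasSum_binWeight S χ k hε l)
  -- Half of the error budget goes to truncating the Fourier series.
  have h2 : ‖∑' i, f (i + K)‖ ≤ ε / 4 := by
    refine (tsum_of_norm_bounded (hsumm.mul_left 2).hasSum fun i => ?_).trans ?_
    · rw [hf, norm_mul, Real.norm_ofNat]
      refine mul_le_mul_of_nonneg_left ?_ zero_le_two
      refine (Complex.abs_re_le_norm _).trans ?_
      rw [norm_mul]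
      exact mul_le_of_le_one_left (norm_nonneg _) (norm_phaseFun_le S _ _)
    · rw [tsum_mul_left]
      linarith
  rw [h1.tsum_eq, Finset.sum_range] at h2
  -- The other half goes to sampling: each of `K` terms is off by at most twice `2/(16K)` times
  -- `ε/π`.
  have h3 : |∑ i : Fin K, 2 * (phaseFunEstimate x i * binCoeff ε l ((i : ℕ) + 1)).re -
      ∑ i : Fin K, f i| ≤ ε / 4 := by
    rw [← Finset.sum_sub_distrib]
    refine (Finset.abs_sum_le_sum_abs _ _).trans ?_
    have h4 : ∀ i : Fin K, |2 * (phaseFunEstimate x i * binCoeff ε l ((i : ℕ) + 1)).re - f i| ≤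
        ε / (4 * K) := by
      intro i
      have e : 2 * (phaseFunEstimate x i * binCoeff ε l ((i : ℕ) + 1)).re - f i =
          2 * ((phaseFunEstimate x i - S.phaseFun χ (k * ((i : ℕ) + 1))) *
            binCoeff ε l ((i : ℕ) + 1)).re := by
        rw [hf, sub_mul, Complex.sub_re]
        ring
      rw [e, abs_mul, abs_two]
      calc 2 * |((phaseFunEstimate x i - S.phaseFun χ (k * ((i : ℕ) + 1))) *
            binCoeff ε l ((i : ℕ) + 1)).re|
          ≤ 2 * ((2 * (1 / (16 * K))) * (ε / π)) := by
            gcongr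
            refine (Complex.abs_re_le_norm _).trans ?_
            rw [norm_mul]
            gcongr
            · exact norm_phaseFunEstimate_sub_le S χ k hM (hx i)
            · exact norm_binCoeff_le hε _ _
        _ = ε / (4 * K) * (1 / π) := by field_simp; norm_num
        _ ≤ ε / (4 * K) * 1 := by
            gcongr
            rw [div_le_one pi_pos]
            linarith [pi_gt_three]
        _ = ε / (4 * K) := mul_one _
    calc _ ≤ ∑ i : Fin K, ε / (4 * K) := Finset.sum_le_sum fun i _ => h4 i
      _ = ε / 4 := by
        rw [Finset.sum_const, Finset.card_univ, Fintype.card_fin, nsmul_eq_mul]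
        field_simp
  have h5 : binEstimate ε x l = (binCoeff ε l 0).re +
      ∑ i : Fin K, 2 * (phaseFunEstimate x i * binCoeff ε l ((i : ℕ) + 1)).re := by
    rw [binEstimate, Complex.re_sum, Finset.mul_sum]
  rw [norm_eq_abs, abs_le] at h2
  rw [abs_le] at h3 ⊢
  rw [h5]
  constructor <;> linarith [h2.1, h2.2, h3.1, h3.2]

theorem sq_log_le {y : ℝ} (hy : 1 ≤ y) : log y ^ 2 ≤ 4 * y := by
  have h0 : 0 < √y := Real.sqrt_pos.2 (by linarith)
  have h1 : log y = 2 * log √y := by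
    rw [Real.log_sqrt (by linarith)]
    ring
  have h2 := Real.log_le_sub_one_of_pos h0
  have h3 : 0 ≤ log y := Real.log_nonneg hy
  calc log y ^ 2 ≤ (2 * √y) ^ 2 := by
        gcongr
        linarith
    _ = 4 * y := by rw [mul_pow, Real.sq_sqrt (by linarith)]; norm_num

theorem AdmissibleErrors.le_pi_div {n : ℕ} {A ε₀ ε : ℝ} (h : AdmissibleErrors n A ε₀ ε) :
    ε ≤ π / 150 :=
  (le_mul_of_one_le_left h.pos.le (one_le_pow₀ h.one_le)).trans h.sq_mul_le

theorem AdmissibleErrors.one_le_log {n : ℕ} {A ε₀ ε : ℝ} (h : AdmissibleErrors n A ε₀ ε) :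
    1 ≤ log ε⁻¹ := by
  have h1 := h.le_pi_div
  have h2 := pi_lt_four
  rw [Real.le_log_iff_exp_le (inv_pos.2 h.pos)]
  refine exp_one_lt_d9.le.trans ?_
  rw [le_inv_comm₀ (by norm_num) h.pos]
  refine (h1.trans ?_)
  norm_num
  linarith

/-- The number of repetitions puts `Λ ε⁻²` in the exponent, more than the needed `Λ`. With `X = ε⁻²`
the excess absorbs the prefactor of the union bound, so the failure constant is independent of `ε`.
-/
theorem mul_exp_neg_le {α Λ X : ℝ} (hα : 0 < α) (hΛ : α ≤ Λ) (hX : 1 ≤ X) :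
    X * exp (-(Λ * X)) ≤ (1 + 1 / α) * exp (-Λ) := by
  have h1 : X ≤ (1 + 1 / α) * exp (Λ * (X - 1)) := by
    have h2 : 1 + α * (X - 1) ≤ exp (Λ * (X - 1)) := by
      have := add_one_le_exp (Λ * (X - 1))
      have : α * (X - 1) ≤ Λ * (X - 1) := by gcongr
      linarith
    calc X ≤ (1 + 1 / α) * (1 + α * (X - 1)) := by
          have e : (1 + 1 / α) * (1 + α * (X - 1)) = X + 1 / α + α * (X - 1) := by
            field_simp
            ring
          have : 0 ≤ 1 / α := by positivity
          have : 0 ≤ α * (X - 1) := mul_nonneg hα.le (by linarith)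
          linarith
      _ ≤ _ := by gcongr
  calc X * exp (-(Λ * X)) ≤ (1 + 1 / α) * exp (Λ * (X - 1)) * exp (-(Λ * X)) := by gcongr
    _ = (1 + 1 / α) * exp (-Λ) := by
      rw [mul_assoc, ← exp_add]
      congr 2
      ring

open Classical in
/-- With suitable constants, the extraction subroutine fails with probability of the order of
`1 - p`. -/
theorem exists_samplingParams : ∃ (Q : SamplingParams) (C : ℝ), 0 < C ∧ ∀ α : ℝ, 0 < α →
    ∀ (n : ℕ) (A ε₀ ε : ℝ), AdmissibleErrors n A ε₀ ε → ∀ (N : ℕ) (S : QPESystem N),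
      S.Promise A n → ∀ χ k p : ℝ, α ≤ |log (1 - p)| →
        mean (extraction Q S A χ k ε p)
          (fun Θ => if IsExtracted (shiftedPhases S χ) n ε k Θ then 0 else 1) ≤
          ENNReal.ofReal (C * (1 + 1 / α) * exp (-|log (1 - p)|)) := by
  obtain ⟨cK, hcK, htail⟩ := exists_binCoeff_tail_le
  -- With tolerance `t = 1/(16K)` the Chernoff exponent `Mt²/16` is `M/(4096K²)`; the square of the
  -- bound on `K` explains `(cK + 1)²` and the logarithmic power `4`.
  refine ⟨⟨cK, 4096 * (cK + 1) ^ 2, 4, hcK, by positivity⟩, 16 * (cK + 1), by positivity, ?_⟩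
  intro α hα n A ε₀ ε hadm N S hS χ k p hp
  have hε := hadm.pos
  have hlog := hadm.one_le_log
  set Q : SamplingParams := ⟨cK, 4096 * (cK + 1) ^ 2, 4, hcK, by positivity⟩ with hQ
  set ℓ := log ε⁻¹ with hℓ
  set Λ := |log (1 - p)| with hΛ
  set K := Q.signalLength ε with hKdef
  set M := Q.repetitions ε p with hMdef
  have hΛ0 : 0 < Λ := hα.trans_le hp
  have hε1 : 1 ≤ ε⁻¹ := by
    rw [one_le_inv₀ hε]
    linarith [hadm.le_pi_div, pi_lt_four]
  have hK1 : cK * ε⁻¹ * ℓ ^ 2 ≤ K := Nat.le_ceil _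
  have hℓ1 : 1 ≤ ℓ ^ 2 := one_le_pow₀ hlog
  have hK2 : (K : ℝ) ≤ (cK + 1) * ε⁻¹ * ℓ ^ 2 := by
    have h1 : (K : ℝ) < cK * ε⁻¹ * ℓ ^ 2 + 1 := Nat.ceil_lt_add_one (by positivity)
    nlinarith [one_le_mul_of_one_le_of_one_le hε1 hℓ1]
  have hM1 : 4096 * (cK + 1) ^ 2 * Λ * ε⁻¹ ^ 4 * ℓ ^ 4 ≤ M := Nat.le_ceil _
  have hK0 : (0 : ℝ) < K := lt_of_lt_of_le (by positivity) hK1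
  have hM0 : (0 : ℝ) < M := lt_of_lt_of_le (by positivity) hM1
  have hKn : 0 < K := by exact_mod_cast hK0
  have hMn : 0 < M := by exact_mod_cast hM0
  rw [extraction, mean_map]
  have hgood : ∀ x : Shots K M,
      ¬ (∃ i axis, M * (1 / (16 * (K : ℝ))) ≤ |shotDeviation S χ k x i axis|) →
      IsExtracted (shiftedPhases S χ) n ε k (extractPhases A ε (binEstimate ε x)) := by
    intro x hx
    push Not at hx
    refine isExtracted_of_close hadm hS χ k fun l => ?_
    obtain ⟨h1, h2⟩ := htail ε hε hlog l K hK1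
    exact abs_binEstimate_sub_le S χ k hε hKn hMn l h1 h2 fun i axis => (hx i axis).le
  have ht4 : 1 / (16 * (K : ℝ)) ≤ 4 := by
    rw [div_le_iff₀ (by positivity)]
    have : (1 : ℝ) ≤ K := by exact_mod_cast hKn
    linarith
  have hdev := sum_sampleShots_deviation_le S χ k K M (t := 1 / (16 * K)) (by positivity) ht4
  have hbound : mean (sampleShots S χ k K M) ((fun Θ : Finset ℝ =>
      if IsExtracted (shiftedPhases S χ) n ε k Θ then (0 : ℝ≥0∞) else 1) ∘
        fun x => extractPhases A ε (binEstimate ε x)) ≤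
      ENNReal.ofReal (∑ x ∈ Finset.univ.filter
        (fun x : Shots K M => ∃ i axis, M * (1 / (16 * (K : ℝ))) ≤ |shotDeviation S χ k x i axis|),
        (sampleShots S χ k K M x).toReal) := by
    rw [mean, tsum_fintype, ENNReal.ofReal_sum_of_nonneg fun _ _ => ENNReal.toReal_nonneg,
      Finset.sum_filter]
    refine Finset.sum_le_sum fun x _ => ?_
    by_cases hx : ∃ i axis, M * (1 / (16 * (K : ℝ))) ≤ |shotDeviation S χ k x i axis|
    · rw [if_pos hx, ENNReal.ofReal_toReal (PMF.apply_ne_top _ _)]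
      refine mul_le_of_le_one_right' ?_
      rw [Function.comp_apply]
      split_ifs
      · exact zero_le_one
      · exact le_rfl
    · rw [if_neg hx, Function.comp_apply, if_pos (hgood x hx), mul_zero]
  refine hbound.trans (ENNReal.ofReal_le_ofReal (hdev.trans ?_))
  have hexp : Λ * ε⁻¹ ^ 2 ≤ M * (1 / (16 * (K : ℝ))) ^ 2 / 16 := by
    have e : M * (1 / (16 * (K : ℝ))) ^ 2 / 16 = M / (4096 * K ^ 2) := by field_simp; norm_num
    rw [e, le_div_iff₀ (by positivity)]
    calc Λ * ε⁻¹ ^ 2 * (4096 * (K : ℝ) ^ 2)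
        ≤ Λ * ε⁻¹ ^ 2 * (4096 * ((cK + 1) * ε⁻¹ * ℓ ^ 2) ^ 2) := by gcongr
      _ = 4096 * (cK + 1) ^ 2 * Λ * ε⁻¹ ^ 4 * ℓ ^ 4 := by ring
      _ ≤ M := hM1
  have hX : 1 ≤ ε⁻¹ ^ 2 := one_le_pow₀ hε1
  calc 4 * (K : ℝ) * exp (-(M * (1 / (16 * (K : ℝ))) ^ 2 / 16))
      ≤ 4 * ((cK + 1) * ε⁻¹ * (4 * ε⁻¹)) * exp (-(Λ * ε⁻¹ ^ 2)) := by
        gcongr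
        refine hK2.trans ?_
        gcongr
        exact sq_log_le hε1
    _ = 16 * (cK + 1) * (ε⁻¹ ^ 2 * exp (-(Λ * ε⁻¹ ^ 2))) := by ring
    _ ≤ 16 * (cK + 1) * ((1 + 1 / α) * exp (-Λ)) := by
        exact mul_le_mul_of_nonneg_left (mul_exp_neg_le hα hp hX) (by positivity)
    _ = 16 * (cK + 1) * (1 + 1 / α) * exp (-Λ) := by ring

/-! ### One round of the loop. -/

/-- The invariant of the loop: there are between one and `n` estimates, and they stay away from the
branch cut. -/
structure LoopInv (n : ℕ) (ε k : ℝ) (E : Finset ℝ) : Prop where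
  one_le : 1 ≤ k
  nonempty : E.Nonempty
  card_le : E.card ≤ n
  lower : ∀ x ∈ E, π / n / 2 + 6 * ε / k ≤ x
  upper : ∀ x ∈ E, x ≤ 2 * π - 3 / 2 * (π / n) + 16 * ε - 6 * ε / k

/-- The properties of the next multiplier that the analysis of a round needs. -/
structure IsMultiplier (n : ℕ) (ε k : ℝ) (E : Finset ℝ) (κ : ℝ) : Prop where
  two_le : 2 ≤ κ
  three_mul_le : 3 * (n : ℝ) ≤ k * κ
  small : 2 * ε * (1 + κ) ≤ π / 15
  sep : ∀ x ∈ E, ∀ y ∈ E, x ≠ y → 2 * (2 * ε * (1 + κ)) < circNorm (k * κ * x - k * κ * y) ∨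
    circNorm (x - y) < π / (k * κ)

theorem AdmissibleErrors.mul_le {n : ℕ} {A ε₀ ε : ℝ} (h : AdmissibleErrors n A ε₀ ε) :
    n * ε ≤ π / 150 := by
  have h1 := h.sq_mul_le
  have h2 := h.one_le
  have h3 := h.pos
  nlinarith [mul_nonneg (mul_nonneg (zero_le_one.trans h2) (sub_nonneg.2 h2)) h3.le]

theorem AdmissibleErrors.le_div {n : ℕ} {A ε₀ ε : ℝ} (h : AdmissibleErrors n A ε₀ ε) :
    ε ≤ π / n / 150 := by
  have h1 := h.mul_le
  have h2 := h.one_le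
  rw [div_div, le_div_iff₀ (by positivity)]
  linarith

theorem ValidFirst.isMultiplier {n : ℕ} {A ε₀ ε κ : ℝ} (h : AdmissibleErrors n A ε₀ ε)
    {E : Finset ℝ} (hκ : ValidFirst n ε₀ E κ) : IsMultiplier n ε 1 E κ := by
  have hn := h.one_le
  have hε := h.pos
  obtain ⟨⟨h1, h2⟩, h3⟩ := hκ
  refine ⟨by linarith, by linarith, ?_, fun x hx y hy hxy => ?_⟩
  · have := h.mul_le
    nlinarith
  · have := h3 x hx y hy hxy
    rw [h.eq] at this
    rw [one_mul, mul_comm κ x, mul_comm κ y]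
    refine this.imp_left fun h => ?_
    linarith

theorem ValidNext.isMultiplier {n : ℕ} {A ε₀ ε k κ : ℝ} (h : AdmissibleErrors n A ε₀ ε)
    {E : Finset ℝ} (hk : 3 * (n : ℝ) ≤ k) (hκ : ValidNext ε k E κ) : IsMultiplier n ε k E κ := by
  have hn := h.one_le
  have hε := h.pos
  obtain ⟨⟨h1, h2⟩, h3⟩ := hκ
  have h4 := h.le_pi_div
  refine ⟨h1, by nlinarith, by nlinarith, fun x hx y hy hxy => ?_⟩
  refine (h3 x hx y hy hxy).imp (fun h => ?_) (fun h => h.trans_le ?_)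
  · rw [show k * κ * x - k * κ * y = x * k * κ - y * k * κ by ring]
    linarith
  · have : 0 < k * κ := by nlinarith
    gcongr
    have : 0 ≤ 2 * ε * (1 + κ) := by positivity
    linarith

/-- The branch chosen for a new estimate is the one that matches any old estimate near it. -/
theorem branch_eq {n : ℕ} {A ε₀ ε k κ : ℝ} (h : AdmissibleErrors n A ε₀ ε)
    (R : ChoiceRule n ε₀ ε) {E : Finset ℝ} (hE : LoopInv n ε k E) (hκ : IsMultiplier n ε k E κ)
    {x θ : ℝ} (hx : x ∈ E) (hθ : θ ∈ Set.Ico 0 (2 * π)) {m : ℤ}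
    (hm : |k * κ * x - θ - 2 * π * m| ≤ 2 * ε * (1 + κ)) :
    (R.branch (k * κ) E θ : ℤ) = m := by
  have hpi := pi_pos
  have hε := h.pos
  have hn := h.one_le
  have hk := hE.one_le
  have hκ2 := hκ.two_le
  have hk3 := hκ.three_mul_le
  have hη := hκ.small
  have hsep := hκ.sep
  have hεa := h.le_div
  set a : ℝ := π / n with ha
  set k' := k * κ with hk'
  set η := 2 * ε * (1 + κ) with hηd
  have hna : n * a = π := by rw [ha]; field_simp
  have ha0 : 0 < a := by positivity
  have hη0 : 0 < η := by positivity
  have hk'0 : 0 < k' := by positivity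
  have hk'1 : 1 ≤ k' := by linarith
  have hk'a : 3 * π ≤ k' * a := by
    calc 3 * π = 3 * n * a := by rw [mul_assoc, hna]
      _ ≤ k' * a := by gcongr
  have hηa : η / k' ≤ a / 45 := by
    rw [div_le_iff₀ hk'0]
    linarith
  have hπa : π / k' ≤ a / 3 := by
    rw [div_le_iff₀ hk'0]
    linarith
  have h6 : 0 ≤ 6 * ε / k := by positivity
  have hlo : ∀ y ∈ E, a / 2 ≤ y := fun y hy => by linarith [hE.lower y hy]
  have hhi : ∀ y ∈ E, y ≤ 2 * π - 3 / 2 * a + 16 * ε := fun y hy => by linarith [hE.upper y hy]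
  have hmabs := abs_le.1 hm
  -- The lower margin and `k' ≥ 3n` give `k'x ≥ 3π/2`, while a negative `m` would force `k'x < η`.
  have hm0 : 0 ≤ m := by
    have h1 : k' * (a / 2) ≤ k' * x := by gcongr; exact hlo x hx
    have h2 : (-1 : ℝ) < m := by
      by_contra hc
      have : 2 * π * m ≤ 2 * π * (-1) := by
        gcongr
        exact not_lt.1 hc
      linarith [hθ.2, hmabs.2]
    have : -1 < m := by exact_mod_cast h2
    omega
  obtain ⟨m', rfl⟩ := Int.eq_ofNat_of_zero_le hm0
  -- The upper margin, about `3π/(2n)`, yields `m' + 1 ≤ k'`. So `m'` is among the candidates of the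
  -- branch rule.
  have hmlt : m' < ⌊k'⌋₊ := by
    refine Nat.le_floor ?_
    have h1 : k' * x ≤ k' * (2 * π - 3 / 2 * a + 16 * ε) := by gcongr; exact hhi x hx
    have h2 : k' * (16 * ε) ≤ k' * (16 * (a / 150)) := by gcongr
    have h3 := hmabs.1
    have h4 : 2 * π * ((m' : ℝ) + 1) ≤ 2 * π * k' := by
      push_cast at h3
      linarith [hθ.1]
    have := le_of_mul_le_mul_left h4 (by positivity)
    push_cast
    exact this
  set b := R.branch k' E θ with hb
  have hblt : b < ⌊k'⌋₊ := R.branch_lt k' E θ hk'1 hE.nonempty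
  obtain ⟨x', hx', hmin⟩ := R.branch_min k' E θ hk'1 hE.nonempty
  rw [← hb] at hmin
  have hscale : ∀ y : ℝ, ∀ c : ℕ, k' * (y - (θ + 2 * π * c) / k') = k' * y - θ - 2 * π * c := by
    intro y c
    field_simp
    ring
  have hxz : |x - (θ + 2 * π * m') / k'| ≤ η / k' := by
    rw [le_div_iff₀ hk'0, ← abs_of_pos hk'0, ← abs_mul, mul_comm, abs_of_pos hk'0, hscale]
    push_cast at hm
    exact hm
  have hzb : (θ + 2 * π * b) / k' ∈ Set.Icc 0 (2 * π) := by
    have h1 : ((b : ℝ) + 1) ≤ k' := by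
      have : ((b + 1 : ℕ) : ℝ) ≤ k' := (Nat.le_floor_iff hk'0.le).1 hblt
      push_cast at this
      exact this
    have h2 : 2 * π * ((b : ℝ) + 1) ≤ 2 * π * k' := by gcongr
    refine ⟨div_nonneg (by have := hθ.1; positivity) hk'0.le, ?_⟩
    rw [div_le_iff₀ hk'0]
    linarith [hθ.2]
  -- Candidate `m'` achieves `η/k'`, so the minimizer does at least as well at its own `x'`; the
  -- margins turn circle distance into distance on the line.
  have hx'z : |x' - (θ + 2 * π * b) / k'| ≤ η / k' := by
    refine abs_sub_le_of_circNorm_le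
      ((hmin x hx m' hmlt).trans ((circNorm_le_abs _).trans hxz)) hzb ?_ ?_
    · linarith [hlo x' hx']
    · linarith [hhi x' hx']
  -- Modulo `2π`, both `k'x` and `k'x'` are within `η` of `θ`. A separation above `2η` is thus
  -- impossible, and the other alternative of a valid multiplier must hold.
  have hxx' : |x - x'| < π / k' := by
    by_cases hne : x = x'
    · rw [hne, sub_self, abs_zero]
      positivity
    · rcases hsep x hx x' hx' hne with h1 | h1
      · exfalso
        have e : k' * x - k' * x' = (k' * x - θ - 2 * π * m') - (k' * x' - θ - 2 * π * b) +
            2 * π * ((m' - b : ℤ) : ℝ) := by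
          push_cast
          ring
        rw [e, circNorm_add_int_mul] at h1
        have h2 := (circNorm_le_abs _).trans
          (abs_sub (k' * x - θ - 2 * π * m') (k' * x' - θ - 2 * π * b))
        rw [← hscale x' b, abs_mul, abs_of_pos hk'0] at h2
        have h3 : k' * |x' - (θ + 2 * π * b) / k'| ≤ η := by
          rw [le_div_iff₀ hk'0] at hx'z
          linarith
        rw [← hscale x' b] at h1
        push_cast at hm
        linarith
      · refine (abs_sub_le_of_circNorm_le le_rfl ?_ ?_ ?_).trans_lt h1
        · exact ⟨by linarith [hlo x' hx'], by linarith [hhi x' hx']⟩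
        · linarith [hlo x hx]
        · linarith [hhi x hx]
  -- The two candidates lie within `η/k'` of points less than `π/k'` apart, so `2π|b - m'| < π + 2η
  -- < 2π`.
  have hfin : |2 * π * ((b : ℝ) - m')| < 2 * π := by
    have e : 2 * π * ((b : ℝ) - m') =
        k' * ((x - (θ + 2 * π * m') / k') - (x' - (θ + 2 * π * b) / k') - (x - x')) := by
      field_simp
      ring
    rw [e, abs_mul, abs_of_pos hk'0]
    have h1 := abs_sub ((x - (θ + 2 * π * m') / k') - (x' - (θ + 2 * π * b) / k')) (x - x')
    have h2 := abs_sub (x - (θ + 2 * π * m') / k') (x' - (θ + 2 * π * b) / k')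
    have h3 : k' * (π / k') = π := by field_simp
    have h4 : k' * (η / k') = η := by field_simp
    calc _ ≤ k' * (η / k' + η / k' + |x - x'|) := by
          gcongr
          linarith
      _ < k' * (η / k' + η / k' + π / k') := by gcongr
      _ ≤ 2 * π := by linarith
  rw [abs_mul, abs_of_pos two_pi_pos] at hfin
  have h1 : |(b : ℝ) - m'| < 1 := by
    by_contra hc
    nlinarith [not_lt.1 hc]
  have h2 : |(b : ℤ) - m'| < 1 := by exact_mod_cast h1
  have := Int.abs_lt_one_iff.1 h2
  omega

/-- The new estimates that result from the estimates `Θ` at order `k'`. -/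
noncomputable def newEstimates {n : ℕ} {ε₀ ε : ℝ} (R : ChoiceRule n ε₀ ε) (k' : ℝ)
    (E Θ : Finset ℝ) : Finset ℝ :=
  Θ.image fun θ => (θ + 2 * π * R.branch k' E θ) / k'

theorem mul_newEstimate_sub {n : ℕ} {A ε₀ ε k κ : ℝ} (h : AdmissibleErrors n A ε₀ ε)
    (R : ChoiceRule n ε₀ ε) {E : Finset ℝ} (hE : LoopInv n ε k E) (hκ : IsMultiplier n ε k E κ)
    {x θ y : ℝ} (hx : x ∈ E) (hθ : θ ∈ Set.Ico 0 (2 * π)) {m : ℤ}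
    (hm : |k * κ * x - θ - 2 * π * m| ≤ 2 * ε * (1 + κ)) :
    k * κ * (y - (θ + 2 * π * R.branch (k * κ) E θ) / (k * κ)) = k * κ * y - θ - 2 * π * m := by
  have hb := branch_eq h R hE hκ hx hθ hm
  have hb' : (R.branch (k * κ) E θ : ℝ) = m := by exact_mod_cast hb
  have hk := hE.one_le
  have hκ2 := hκ.two_le
  have : k * κ ≠ 0 := by positivity
  rw [hb']
  field_simp
  ring

/-- If the test does not detect a mismatch, the new estimates are close to the old ones. -/
theorem newEstimates_close {n : ℕ} {A ε₀ ε k κ : ℝ} (h : AdmissibleErrors n A ε₀ ε)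
    (R : ChoiceRule n ε₀ ε) {E Θ : Finset ℝ} (hE : LoopInv n ε k E)
    (hκ : IsMultiplier n ε k E κ) (hΘ : ∀ θ ∈ Θ, θ ∈ Set.Ico 0 (2 * π))
    (hmis : ¬ Mismatch ε κ (k * κ) E Θ) :
    (∀ x ∈ E, ∃ z ∈ newEstimates R (k * κ) E Θ, |x - z| ≤ 3 * ε / k) ∧
      ∀ z ∈ newEstimates R (k * κ) E Θ, ∃ x ∈ E, |x - z| ≤ 3 * ε / k := by
  have hk := hE.one_le
  have hκ2 := hκ.two_le
  have hε := h.pos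
  have hk'0 : 0 < k * κ := by positivity
  unfold Mismatch at hmis
  push Not at hmis
  obtain ⟨h1, h2⟩ := hmis
  have key : ∀ x ∈ E, ∀ θ ∈ Θ, circNorm (k * κ * x - θ) ≤ 2 * ε * (1 + κ) →
      |x - (θ + 2 * π * R.branch (k * κ) E θ) / (k * κ)| ≤ 3 * ε / k := by
    intro x hx θ hθ hc
    obtain ⟨m, hm⟩ := circNorm_le_iff.1 hc
    have e := mul_newEstimate_sub (y := x) h R hE hκ hx (hΘ θ hθ) hm
    have h3 : k * κ * |x - (θ + 2 * π * R.branch (k * κ) E θ) / (k * κ)| ≤ 2 * ε * (1 + κ) := by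
      rw [← abs_of_pos hk'0, ← abs_mul, abs_of_pos hk'0, e]
      exact hm
    -- Because `κ ≥ 2`.
    have h4 : 2 * ε * (1 + κ) ≤ k * κ * (3 * ε / k) := by
      have : k * κ * (3 * ε / k) = 3 * ε * κ := by field_simp
      rw [this]
      nlinarith
    exact le_of_mul_le_mul_left (h3.trans h4) hk'0
  refine ⟨fun x hx => ?_, fun z hz => ?_⟩
  · obtain ⟨θ, hθ, hc⟩ := h1 x hx
    exact ⟨_, Finset.mem_image_of_mem _ hθ, key x hx θ hθ hc⟩
  · obtain ⟨θ, hθ, rfl⟩ := Finset.mem_image.1 hz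
    obtain ⟨x, hx, hc⟩ := h2 θ hθ
    exact ⟨x, hx, key x hx θ hθ hc⟩

/-- The slack `6ε/k` in the margins pays for all later drift: one round uses at most `3ε/k`, and
since `κ ≥ 2` what remains is still at least `6ε/(kκ)`. Only the passed tests are used, so the
invariant survives undetected failures. -/
theorem LoopInv.newEstimates {n : ℕ} {A ε₀ ε k κ : ℝ} (h : AdmissibleErrors n A ε₀ ε)
    (R : ChoiceRule n ε₀ ε) {E Θ : Finset ℝ} (hE : LoopInv n ε k E)
    (hκ : IsMultiplier n ε k E κ) (hΘ : ∀ θ ∈ Θ, θ ∈ Set.Ico 0 (2 * π))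
    (hmis : ¬ Mismatch ε κ (k * κ) E Θ) (hcard : Θ.card ≤ n) :
    LoopInv n ε (k * κ) (newEstimates R (k * κ) E Θ) := by
  have hk := hE.one_le
  have hκ2 := hκ.two_le
  have hε := h.pos
  obtain ⟨h1, h2⟩ := newEstimates_close h R hE hκ hΘ hmis
  have h3 : 6 * ε / (k * κ) ≤ 3 * ε / k := by
    rw [div_le_div_iff₀ (by positivity) (by positivity)]
    have : 0 ≤ ε * k := by positivity
    nlinarith
  have h4 : 6 * ε / k = 3 * ε / k + 3 * ε / k := by ring
  refine ⟨by nlinarith, ?_, Finset.card_image_le.trans hcard, fun z hz => ?_, fun z hz => ?_⟩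
  · obtain ⟨x, hx⟩ := hE.nonempty
    obtain ⟨z, hz, -⟩ := h1 x hx
    exact ⟨z, hz⟩
  · obtain ⟨x, hx, hxz⟩ := h2 z hz
    have := hE.lower x hx
    linarith [(abs_le.1 hxz).2]
  · obtain ⟨x, hx, hxz⟩ := h2 z hz
    have := hE.upper x hx
    linarith [(abs_le.1 hxz).1]

/-- At order `k ≥ 3n` the forbidden zone reaches at most `π/(3n)` above `0` and `π/n` below `2π`,
while the margins exceed `π/(2n)` and `3π/(2n) - 16ε`. Thus this test never stops a run whose
estimates obey the invariant. -/
theorem LoopInv.not_nearCut {n : ℕ} {A ε₀ ε k : ℝ} (h : AdmissibleErrors n A ε₀ ε)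
    {E : Finset ℝ} (hE : LoopInv n ε k E) (hk3 : 3 * (n : ℝ) ≤ k) : ¬ NearCut k E := by
  have hpi := pi_pos
  have hε := h.pos
  have hn := h.one_le
  have hk := hE.one_le
  have hεa := h.le_div
  rintro ⟨x, hx, hx1 | hx1⟩
  · have h1 := hE.lower x hx
    have h2 : π / k ≤ π / (3 * n) := by gcongr
    have h3 : π / (3 * n) = π / n / 3 := by field_simp
    have h4 : 0 < π / n := by positivity
    have h6 : 0 ≤ 6 * ε / k := by positivity
    linarith [hx1.2]
  · have h1 := hE.upper x hx
    have h2 := (Nat.lt_floor_add_one k)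
    have h3 : 2 * π - 3 * (π / k) ≤ π * (2 * ⌊k⌋₊ - 1) / k := by
      rw [le_div_iff₀ (by positivity)]
      have e : (2 * π - 3 * (π / k)) * k = π * (2 * k - 3) := by field_simp
      rw [e]
      exact mul_le_mul_of_nonneg_left (by linarith) hpi.le
    have h4 : π / k ≤ π / (3 * n) := by gcongr
    have h5 : π / (3 * n) = π / n / 3 := by field_simp
    have h6 : 0 ≤ 6 * ε / k := by positivity
    have h7 : 0 < π / n := by positivity
    linarith [hx1.1]

/-- The estimates `E` of order `k` are accurate for the phases `Ph`. -/
def IsAccurate (Ph : Finset ℝ) (ε k : ℝ) (E : Finset ℝ) : Prop :=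
  (∀ φ ∈ Ph, ∃ x ∈ E, |x - φ| ≤ 2 * ε / k) ∧ ∀ x ∈ E, ∃ φ ∈ Ph, |x - φ| ≤ ε / k

/-- An old error `r/k` is magnified to `κr` at order `kκ` and joins the extraction error. In the two
directions this gives `κε + 2ε` and `2κε + ε`, both below the tolerance `2ε(1 + κ)`. -/
theorem IsAccurate.not_mismatch {Ph E Θ : Finset ℝ} {n : ℕ} {ε k κ : ℝ} (hε : 0 < ε) (hk : 1 ≤ k)
    (hκ2 : 2 ≤ κ) (hacc : IsAccurate Ph ε k E) (hext : IsExtracted Ph n ε (k * κ) Θ) :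
    ¬ Mismatch ε κ (k * κ) E Θ := by
  have hk'0 : 0 < k * κ := by positivity
  have hdist : ∀ x φ θ r s : ℝ, |x - φ| ≤ r / k → circNorm (k * κ * φ - θ) ≤ s →
      circNorm (k * κ * x - θ) ≤ κ * r + s := by
    intro x φ θ r s h1 h2
    refine (circNorm_sub_le _ (k * κ * φ) _).trans (add_le_add ?_ h2)
    refine (circNorm_le_abs _).trans ?_
    rw [← mul_sub, abs_mul, abs_of_pos hk'0]
    calc k * κ * |x - φ| ≤ k * κ * (r / k) := by gcongr
      _ = κ * r := by field_simp
  rintro (⟨x, hx, hfar⟩ | ⟨θ, hθ, hfar⟩)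
  · obtain ⟨φ, hφ, h1⟩ := hacc.2 x hx
    obtain ⟨θ, hθ, h2⟩ := hext.1 φ hφ
    have := hfar θ hθ
    nlinarith [hdist x φ θ _ _ h1 h2]
  · obtain ⟨φ, hφ, h1⟩ := hext.2.1 θ hθ
    obtain ⟨x, hx, h2⟩ := hacc.1 φ hφ
    have := hfar x hx
    nlinarith [hdist x φ θ _ _ h2 h1]

/-- An accurate old estimate singles out the integer `m` that unwraps `kκφ`; once the branch is
right, the new error is just the extraction error divided by `kκ`. -/
theorem IsAccurate.newEstimates {Ph E Θ : Finset ℝ} {n : ℕ} {A ε₀ ε k κ : ℝ}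
    (h : AdmissibleErrors n A ε₀ ε) (R : ChoiceRule n ε₀ ε) (hE : LoopInv n ε k E)
    (hκ : IsMultiplier n ε k E κ) (hΘ : ∀ θ ∈ Θ, θ ∈ Set.Ico 0 (2 * π))
    (hacc : IsAccurate Ph ε k E) (hext : IsExtracted Ph n ε (k * κ) Θ) :
    IsAccurate Ph ε (k * κ) (newEstimates R (k * κ) E Θ) := by
  have hk := hE.one_le
  have hκ2 := hκ.two_le
  have hε := h.pos
  have hk'0 : 0 < k * κ := by positivity
  have key : ∀ φ ∈ Ph, ∀ θ ∈ Θ, ∀ r ≤ 2 * ε, circNorm (k * κ * φ - θ) ≤ r →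
      |(θ + 2 * π * R.branch (k * κ) E θ) / (k * κ) - φ| ≤ r / (k * κ) := by
    intro φ hφ θ hθ r hr hc
    obtain ⟨m, hm⟩ := circNorm_le_iff.1 hc
    obtain ⟨x, hx, hxφ⟩ := hacc.1 φ hφ
    have hmx : |k * κ * x - θ - 2 * π * m| ≤ 2 * ε * (1 + κ) := by
      have e : k * κ * x - θ - 2 * π * m = k * κ * (x - φ) + (k * κ * φ - θ - 2 * π * m) := by ring
      rw [e]
      refine (abs_add_le _ _).trans ?_
      rw [abs_mul, abs_of_pos hk'0]
      have h1 : k * κ * |x - φ| ≤ k * κ * (2 * ε / k) := by gcongr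
      have h2 : k * κ * (2 * ε / k) = 2 * ε * κ := by field_simp
      linarith
    have e := mul_newEstimate_sub (y := φ) h R hE hκ hx (hΘ θ hθ) hmx
    rw [abs_sub_comm, le_div_iff₀ hk'0, mul_comm, ← abs_of_pos hk'0, ← abs_mul, abs_of_pos hk'0, e]
    exact hm
  refine ⟨fun φ hφ => ?_, fun z hz => ?_⟩
  · obtain ⟨θ, hθ, hc⟩ := hext.1 φ hφ
    exact ⟨_, Finset.mem_image_of_mem _ hθ, key φ hφ θ hθ _ le_rfl hc⟩
  · obtain ⟨θ, hθ, rfl⟩ := Finset.mem_image.1 hz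
    obtain ⟨φ, hφ, hc⟩ := hext.2.1 θ hθ
    exact ⟨φ, hφ, key φ hφ θ hθ _ (by linarith) hc⟩

/-- The multiplier chosen after round `d`. -/
noncomputable def ChoiceRule.multiplier {n : ℕ} {ε₀ ε : ℝ} (R : ChoiceRule n ε₀ ε) (d : ℕ) (k : ℝ)
    (E : Finset ℝ) : ℝ :=
  if d = 0 then R.first E else R.next d k E

/-- The counter, the order and the estimates at the start of a pass through the loop. -/
structure LoopState (n : ℕ) (ε δc : ℝ) (d : ℕ) (k : ℝ) (E : Finset ℝ) : Prop
    extends LoopInv n ε k E where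
  first : d = 0 → k = 1
  next : d ≠ 0 → 3 * (n : ℝ) ≤ k
  mul_le : k * δc ≤ π

theorem LoopState.isMultiplier {n : ℕ} {A ε₀ ε δc k : ℝ} {d : ℕ} (h : AdmissibleErrors n A ε₀ ε)
    (R : ChoiceRule n ε₀ ε) {E : Finset ℝ} (hE : LoopState n ε δc d k E) :
    IsMultiplier n ε k E (R.multiplier d k E) := by
  unfold ChoiceRule.multiplier
  split_ifs with hd
  · rw [hE.first hd]
    exact (R.first_valid E (exists_validFirst h hE.card_le)).isMultiplier h
  · have hk := hE.one_le
    exact (R.next_valid d k E (exists_validNext h hE.card_le (by linarith))).isMultiplier h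
      (hE.next hd)

/-! ### The loop: runwise bounds and mean square error. -/

section loop

variable (Q : SamplingParams) {N : ℕ} (S : QPESystem N) (I : AlgInput)
  (R : ChoiceRule I.n I.ε₀ I.ε) (χ : ℝ)

open Classical in
/-- The continuation of the loop after the extraction of `Θ` at order `k κ`. -/
noncomputable def loopStep (fuel d : ℕ) (k κ : ℝ) (E Θ : Finset ℝ) : PMF (Finset ℝ × ℝ) :=
  let c := extractionCost Q I.w (k * κ) I.ε (confidence I.α I.γ I.δc (k * κ))
  if Mismatch I.ε κ (k * κ) E Θ ∨ I.n < Θ.card then PMF.pure (E, c)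
  else
    if NearCut (k * κ) (newEstimates R (k * κ) E Θ) then PMF.pure (E, c)
    else (adaptiveLoop Q S I R χ fuel (d + 1) (k * κ) (newEstimates R (k * κ) E Θ)).map
      fun r => (r.1, c + r.2)

theorem adaptiveLoop_succ {fuel d : ℕ} {k : ℝ} {E : Finset ℝ} (hk : k < 2 * I.ε / I.δc) :
    adaptiveLoop Q S I R χ (fuel + 1) d k E =
      (extraction Q S I.A χ (k * R.multiplier d k E) I.ε
        (confidence I.α I.γ I.δc (k * R.multiplier d k E))).bind
          (loopStep Q S I R χ fuel d k (R.multiplier d k E) E) := by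
  rw [adaptiveLoop, if_pos hk]
  rfl

theorem adaptiveLoop_of_le {fuel d : ℕ} {k : ℝ} {E : Finset ℝ}
    (hk : 2 * I.ε / I.δc ≤ k) : adaptiveLoop Q S I R χ fuel d k E = PMF.pure (E, 0) := by
  cases fuel with
  | zero => rw [adaptiveLoop]
  | succ fuel => rw [adaptiveLoop, if_neg (not_lt.2 hk)]

end loop

theorem mem_of_mem_support_extraction {Q : SamplingParams} {N : ℕ} {S : QPESystem N}
    {A χ k ε p : ℝ} (hε : 0 < ε) (hL : ∃ L : ℕ, (L : ℝ) * ε = 2 * π) {Θ : Finset ℝ}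
    (hΘ : Θ ∈ (extraction Q S A χ k ε p).support) : ∀ θ ∈ Θ, θ ∈ Set.Ico 0 (2 * π) := by
  rw [extraction, PMF.mem_support_map_iff] at hΘ
  obtain ⟨x, -, rfl⟩ := hΘ
  exact fun θ hθ => extractPhases_mem hε hL hθ

/-- The loop condition gives `k'δc ≤ 2εκ`, which is small; this keeps the base `k'δc/π` of the
confidence at most `1`. -/
theorem LoopState.mul_multiplier_le {n : ℕ} {ε δc k κ : ℝ} {E : Finset ℝ} (hδ : 0 < δc)
    (hε : 0 < ε) (hκ : IsMultiplier n ε k E κ) (hk : k < 2 * ε / δc) : k * κ * δc ≤ π := by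
  have hpi := pi_pos
  have h1 := hκ.small
  have h2 := hκ.two_le
  rw [lt_div_iff₀ hδ] at hk
  have h3 : k * κ * δc ≤ 2 * ε * κ := by
    calc k * κ * δc = k * δc * κ := by ring
      _ ≤ 2 * ε * κ := by gcongr
  linarith

theorem LoopState.newEstimates {n : ℕ} {A ε₀ ε δc k κ : ℝ} {d : ℕ} (h : AdmissibleErrors n A ε₀ ε)
    (R : ChoiceRule n ε₀ ε) (hδ : 0 < δc) {E Θ : Finset ℝ} (hE : LoopState n ε δc d k E)
    (hκ : IsMultiplier n ε k E κ) (hΘ : ∀ θ ∈ Θ, θ ∈ Set.Ico 0 (2 * π)) (hk : k < 2 * ε / δc)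
    (hmis : ¬ Mismatch ε κ (k * κ) E Θ) (hcard : Θ.card ≤ n) :
    LoopState n ε δc (d + 1) (k * κ) (newEstimates R (k * κ) E Θ) where
  toLoopInv := hE.toLoopInv.newEstimates h R hκ hΘ hmis hcard
  first := fun h => absurd h (Nat.succ_ne_zero d)
  next := fun _ => hκ.three_mul_le
  mul_le := LoopState.mul_multiplier_le hδ h.pos hκ hk

/-- Properties of the loop that hold whatever the data: it returns a nonempty set of at most `n`
estimates close to the initial ones, and its cost is bounded by any potential that pays for the
extractions. -/
theorem adaptiveLoop_support (Q : SamplingParams) {N : ℕ} (S : QPESystem N) (I : AlgInput)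
    (h : AdmissibleErrors I.n I.A I.ε₀ I.ε) (hδ : 0 < I.δc) (R : ChoiceRule I.n I.ε₀ I.ε) (χ : ℝ)
    (J : ℝ → ℝ) (hJ0 : ∀ k, 1 ≤ k → k * I.δc ≤ π → 0 ≤ J k)
    (hJ : ∀ k k', 1 ≤ k → 2 * k ≤ k' → k' * I.δc ≤ π →
      extractionCost Q I.w k' I.ε (confidence I.α I.γ I.δc k') + J k' ≤ J k)
    (fuel : ℕ) : ∀ (d : ℕ) (k : ℝ) (E : Finset ℝ), LoopState I.n I.ε I.δc d k E →
      ∀ r ∈ (adaptiveLoop Q S I R χ fuel d k E).support,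
        r.1.Nonempty ∧ r.1.card ≤ I.n ∧ (∀ x ∈ E, ∃ y ∈ r.1, |x - y| ≤ 6 * I.ε / k) ∧
          r.2 ≤ J k := by
  induction fuel with
  | zero =>
    intro d k E hE r hr
    rw [adaptiveLoop, PMF.support_pure, Set.mem_singleton_iff] at hr
    subst hr
    have hε := h.pos
    have hk := hE.one_le
    exact ⟨hE.nonempty, hE.card_le, fun x hx => ⟨x, hx, by rw [sub_self, abs_zero]; positivity⟩,
      hJ0 k hk hE.mul_le⟩
  | succ fuel ih =>
    intro d k E hE r hr
    have hε := h.pos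
    have hk1 := hE.one_le
    have hclose : ∀ x ∈ E, ∃ y ∈ E, |x - y| ≤ 6 * I.ε / k := fun x hx =>
      ⟨x, hx, by rw [sub_self, abs_zero]; positivity⟩
    by_cases hk : k < 2 * I.ε / I.δc
    · rw [adaptiveLoop_succ Q S I R χ hk, PMF.mem_support_bind_iff] at hr
      obtain ⟨Θ, hΘs, hr⟩ := hr
      have hΘ := mem_of_mem_support_extraction hε h.tile hΘs
      have hκ := hE.isMultiplier h R
      set κ := R.multiplier d k E with hκdef
      have hκ2 := hκ.two_le
      have hk' := LoopState.mul_multiplier_le hδ hε hκ hk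
      have hcost := hJ k (k * κ) hk1 (by nlinarith) hk'
      have hJ' := hJ0 (k * κ) (by nlinarith) hk'
      unfold loopStep at hr
      simp only at hr
      split_ifs at hr with h1 h2
      · rw [PMF.support_pure, Set.mem_singleton_iff] at hr
        subst hr
        exact ⟨hE.nonempty, hE.card_le, hclose, by linarith⟩
      · rw [PMF.support_pure, Set.mem_singleton_iff] at hr
        subst hr
        exact ⟨hE.nonempty, hE.card_le, hclose, by linarith⟩
      · rw [PMF.mem_support_map_iff] at hr
        obtain ⟨r', hr', rfl⟩ := hr
        push Not at h1
        have hE' := hE.newEstimates h R hδ hκ hΘ hk h1.1 h1.2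
        obtain ⟨a1, a2, a3, a4⟩ := ih (d + 1) (k * κ) _ hE' r' hr'
        refine ⟨a1, a2, fun x hx => ?_, by simp only; linarith⟩
        obtain ⟨z, hz, hxz⟩ := (newEstimates_close h R hE.toLoopInv hκ hΘ h1.1).1 x hx
        obtain ⟨y, hy, hzy⟩ := a3 z hz
        refine ⟨y, hy, (abs_sub_le x z y).trans ?_⟩
        -- Half of the drift allowance is used by this round, and the rest covers the allowance of
        -- all later rounds.
        have h3 : 6 * I.ε / (k * κ) ≤ 3 * I.ε / k := by
          rw [div_le_div_iff₀ (by positivity) (by positivity)]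
          have : 0 ≤ I.ε * k := by positivity
          nlinarith
        have h4 : 6 * I.ε / k = 3 * I.ε / k + 3 * I.ε / k := by ring
        linarith
    · rw [adaptiveLoop_of_le Q S I R χ (not_lt.1 hk), PMF.support_pure,
        Set.mem_singleton_iff] at hr
      subst hr
      exact ⟨hE.nonempty, hE.card_le, hclose, hJ0 k hk1 hE.mul_le⟩

open Classical in
/-- The mean square error of the loop when it starts with accurate estimates. Here `β k` bounds the
failure probability of the extraction at order `k`, and `B` is a potential that pays for the
failures. -/
theorem adaptiveLoop_error (Q : SamplingParams) {N : ℕ} (S : QPESystem N) (I : AlgInput)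
    (h : AdmissibleErrors I.n I.A I.ε₀ I.ε) (hδ : 0 < I.δc) (R : ChoiceRule I.n I.ε₀ I.ε) (χ : ℝ)
    (J : ℝ → ℝ) (hJ0 : ∀ k, 1 ≤ k → k * I.δc ≤ π → 0 ≤ J k)
    (hJ : ∀ k k', 1 ≤ k → 2 * k ≤ k' → k' * I.δc ≤ π →
      extractionCost Q I.w k' I.ε (confidence I.α I.γ I.δc k') + J k' ≤ J k)
    (β B : ℝ → ℝ) (hβ0 : ∀ k, 1 ≤ k → 0 ≤ β k)
    (hβ : ∀ k, 1 ≤ k → k * I.δc ≤ π →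
      mean (extraction Q S I.A χ k I.ε (confidence I.α I.γ I.δc k))
        (fun Θ => if IsExtracted (shiftedPhases S χ) I.n I.ε k Θ then 0 else 1) ≤
          ENNReal.ofReal (β k))
    (hB0 : ∀ k, 1 ≤ k → k * I.δc ≤ π → I.δc ^ 2 ≤ B k)
    (hB : ∀ k κ, 1 ≤ k → 2 ≤ κ → κ * I.ε ≤ 1 → k * κ * I.δc ≤ π →
      B (k * κ) + (8 * I.ε / k) ^ 2 * β (k * κ) ≤ B k)
    {φ : ℝ} (hφ : φ ∈ shiftedPhases S χ)
    (fuel : ℕ) : ∀ (d : ℕ) (k : ℝ) (E : Finset ℝ), LoopState I.n I.ε I.δc d k E →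
      IsAccurate (shiftedPhases S χ) I.ε k E → 2 * I.ε / I.δc ≤ k * 2 ^ fuel →
      mean (adaptiveLoop Q S I R χ fuel d k E)
        (fun r => ENNReal.ofReal (closestError r.1 φ ^ 2)) ≤ ENNReal.ofReal (B k) := by
  have hε := h.pos
  have hsq : ∀ (E : Finset ℝ) (x c : ℝ), x ∈ E → |x - φ| ≤ c → closestError E φ ^ 2 ≤ c ^ 2 := by
    intro E x c hx hc
    exact pow_le_pow_left₀ (closestError_nonneg _ _)
      ((closestError_le hx φ).trans ((circNorm_le_abs _).trans hc)) 2
  have hterm : ∀ (fuel d : ℕ) (k : ℝ) (E : Finset ℝ), LoopState I.n I.ε I.δc d k E →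
      IsAccurate (shiftedPhases S χ) I.ε k E → 2 * I.ε / I.δc ≤ k →
      mean (adaptiveLoop Q S I R χ fuel d k E)
        (fun r => ENNReal.ofReal (closestError r.1 φ ^ 2)) ≤ ENNReal.ofReal (B k) := by
    intro fuel d k E hE hacc hk
    have hk1 := hE.one_le
    rw [adaptiveLoop_of_le Q S I R χ hk, mean_pure]
    refine ENNReal.ofReal_le_ofReal (le_trans ?_ (hB0 k hk1 hE.mul_le))
    obtain ⟨x, hx, hxφ⟩ := hacc.1 φ hφ
    refine hsq E x I.δc hx (hxφ.trans ?_)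
    rw [div_le_iff₀ hδ] at hk
    rw [div_le_iff₀ (by linarith)]
    linarith
  induction fuel with
  | zero =>
    intro d k E hE hacc hfuel
    rw [pow_zero, mul_one] at hfuel
    exact hterm 0 d k E hE hacc hfuel
  | succ fuel ih =>
    intro d k E hE hacc hfuel
    by_cases hk : k < 2 * I.ε / I.δc
    · have hk1 := hE.one_le
      have hκ := hE.isMultiplier h R
      have hsupp := adaptiveLoop_support Q S I h hδ R χ J hJ0 hJ (fuel + 1) d k E hE
      rw [adaptiveLoop_succ Q S I R χ hk] at hsupp ⊢
      set κ := R.multiplier d k E with hκdef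
      have hκ2 := hκ.two_le
      have hk' := LoopState.mul_multiplier_le hδ hε hκ hk
      have hk'1 : 1 ≤ k * κ := by nlinarith
      rw [mean_bind]
      have hBk' : 0 ≤ B (k * κ) := (sq_nonneg _).trans (hB0 _ hk'1 hk')
      -- On success the induction hypothesis applies. On failure, drift `6ε/k` and accuracy `2ε/k`
      -- at the last good order cap the error by `8ε/k`.
      refine (mean_le_add_mul _ (hβ (k * κ) hk'1 hk') (c₁ := ENNReal.ofReal (B (k * κ)))
        (c₂ := ENNReal.ofReal ((8 * I.ε / k) ^ 2)) (fun Θ hΘs hext => ?_)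
        (fun Θ hΘs => ?_)).trans ?_
      · have hΘ := mem_of_mem_support_extraction hε h.tile hΘs
        have hmis := hacc.not_mismatch hε hk1 hκ2 hext
        have hE' := hE.newEstimates h R hδ hκ hΘ hk hmis hext.2.2
        have hcut := hE'.toLoopInv.not_nearCut h hκ.three_mul_le
        have hacc' := hacc.newEstimates h R hE.toLoopInv hκ hΘ hext
        unfold loopStep
        simp only
        rw [if_neg (not_or.2 ⟨hmis, not_lt.2 hext.2.2⟩), if_neg hcut, mean_map]
        -- Every pass at least doubles the order, so one factor `2` moves from the fuel to the
        -- order; running out of fuel therefore means that the target order is reached.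
        refine ih (d + 1) (k * κ) _ hE' hacc' (hfuel.trans ?_)
        rw [pow_succ, mul_assoc k κ, mul_comm ((2 : ℝ) ^ fuel) 2]
        gcongr
      · refine mean_le_of_support fun r hr => ENNReal.ofReal_le_ofReal ?_
        obtain ⟨-, -, hdrift, -⟩ := hsupp r ((PMF.mem_support_bind_iff _ _ _).2 ⟨Θ, hΘs, hr⟩)
        obtain ⟨x, hx, hxφ⟩ := hacc.1 φ hφ
        obtain ⟨y, hy, hxy⟩ := hdrift x hx
        refine hsq r.1 y _ hy ((abs_sub_le y x φ).trans ?_)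
        rw [abs_sub_comm y x]
        have : 8 * I.ε / k = 6 * I.ε / k + 2 * I.ε / k := by ring
        linarith
      · rw [← ENNReal.ofReal_mul (sq_nonneg _), ← ENNReal.ofReal_add hBk'
          (mul_nonneg (sq_nonneg _) (hβ0 _ hk'1))]
        refine ENNReal.ofReal_le_ofReal (hB k κ hk1 hκ2 ?_ hk')
        have h1 := hκ.small
        have h2 := pi_lt_four
        linarith
    · exact hterm (fuel + 1) d k E hE hacc (not_lt.1 hk)

/-! ### Potentials for the error and the cost. -/

theorem abs_log_one_sub_confidence {α γ δc k : ℝ} (hα : 0 < α) (hγ : 0 < γ) (hk : 0 < k * δc)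
    (hkπ : k * δc ≤ π) :
    |log (1 - confidence α γ δc k)| = α - γ * log (k * δc / π) := by
  have hu : 0 < k * δc / π := div_pos hk pi_pos
  have hu1 : k * δc / π ≤ 1 := (div_le_one pi_pos).2 hkπ
  have hlog := Real.log_nonpos hu.le hu1
  rw [confidence, sub_sub_cancel, Real.log_mul (exp_pos _).ne' (rpow_pos_of_pos hu _).ne',
    Real.log_exp, Real.log_rpow hu, abs_of_nonpos (by nlinarith)]
  ring

theorem exp_neg_abs_log_one_sub_confidence_le {α γ δc k : ℝ} (hα : 0 < α) (hγ : 0 < γ)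
    (hk : 0 < k * δc) (hkπ : k * δc ≤ π) :
    exp (-|log (1 - confidence α γ δc k)|) ≤ (k * δc / π) ^ γ := by
  have hu : 0 < k * δc / π := div_pos hk pi_pos
  rw [abs_log_one_sub_confidence hα hγ hk hkπ, Real.rpow_def_of_pos hu, exp_le_exp]
  linarith

/-- The geometric potential. -/
theorem rpow_add_potential_le {s u u' : ℝ} (hs : 0 < s) (hu : 0 < u) (huu' : 2 * u ≤ u') :
    u' ^ s + (1 - u' ^ s) / (1 - (1 / 2 : ℝ) ^ s) ≤ (1 - u ^ s) / (1 - (1 / 2 : ℝ) ^ s) := by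
  have hq : (1 / 2 : ℝ) ^ s < 1 := Real.rpow_lt_one (by norm_num) (by norm_num) hs
  have h1 : u ^ s ≤ (1 / 2 : ℝ) ^ s * u' ^ s := by
    rw [← Real.mul_rpow (by norm_num) (by linarith)]
    exact Real.rpow_le_rpow hu.le (by linarith) hs.le
  have hq0 : 0 < 1 - (1 / 2 : ℝ) ^ s := by linarith
  rw [← sub_nonneg]
  have e : (1 - u ^ s) / (1 - (1 / 2 : ℝ) ^ s) -
      (u' ^ s + (1 - u' ^ s) / (1 - (1 / 2 : ℝ) ^ s)) =
      ((1 / 2 : ℝ) ^ s * u' ^ s - u ^ s) / (1 - (1 / 2 : ℝ) ^ s) := by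
    field_simp
    ring
  rw [e]
  exact div_nonneg (by linarith) hq0.le

theorem potential_nonneg {s u : ℝ} (hs : 0 < s) (hu : 0 ≤ u) (hu1 : u ≤ 1) :
    0 ≤ (1 - u ^ s) / (1 - (1 / 2 : ℝ) ^ s) := by
  have hq : (1 / 2 : ℝ) ^ s < 1 := Real.rpow_lt_one (by norm_num) (by norm_num) hs
  exact div_nonneg (sub_nonneg.2 (Real.rpow_le_one hu hu1 hs.le)) (by linarith)

theorem potential_le {s u : ℝ} (hs : 0 < s) (hu : 0 ≤ u) :
    (1 - u ^ s) / (1 - (1 / 2 : ℝ) ^ s) ≤ 1 / (1 - (1 / 2 : ℝ) ^ s) := by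
  have hq : (1 / 2 : ℝ) ^ s < 1 := Real.rpow_lt_one (by norm_num) (by norm_num) hs
  have : 0 ≤ u ^ s := Real.rpow_nonneg hu s
  have : 0 < 1 - (1 / 2 : ℝ) ^ s := by linarith
  gcongr
  linarith

/-- A potential that pays for the mean square errors of failing rounds. -/
theorem exists_error_potential {Cβ γ : ℝ} (hC : 0 < Cβ) (hγ : 2 < γ) : ∃ D : ℝ, 0 < D ∧
    ∀ ε δc : ℝ, 0 < ε → 0 < δc → δc < π → ∃ B : ℝ → ℝ,
      (∀ k, 1 ≤ k → k * δc ≤ π → δc ^ 2 ≤ B k) ∧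
      (∀ k κ, 1 ≤ k → 2 ≤ κ → κ * ε ≤ 1 → k * κ * δc ≤ π →
        B (k * κ) + (8 * ε / k) ^ 2 * (Cβ * (k * κ * δc / π) ^ γ) ≤ B k) ∧
      B 1 ≤ D * δc ^ 2 := by
  have hs : 0 < γ - 2 := by linarith
  have hpi := pi_pos
  set q := 1 - (1 / 2 : ℝ) ^ (γ - 2) with hq
  have hq0 : 0 < q := sub_pos.2 (Real.rpow_lt_one (by norm_num) (by norm_num) hs)
  refine ⟨1 + 64 * Cβ * (1 / q), by positivity, fun ε δc hε hδ hδπ => ?_⟩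
  -- The `1` is the error of a run without failures; the second term is the geometric potential of
  -- exponent `γ - 2` for failures still to come.
  refine ⟨fun k => δc ^ 2 * (1 + 64 * Cβ * ((1 - (k * δc / π) ^ (γ - 2)) / q)), ?_, ?_, ?_⟩
  · intro k hk hkπ
    have h1 := potential_nonneg hs (u := k * δc / π) (by positivity) ((div_le_one hpi).2 hkπ)
    exact le_mul_of_one_le_right (sq_nonneg _) (le_add_of_nonneg_right (by positivity))
  · intro k κ hk hκ hκε hkπ
    set u' := k * κ * δc / π with hu'
    have hu'0 : 0 < u' := by positivity
    have h1 := rpow_add_potential_le hs (u := k * δc / π) (u' := u') (by positivity) (by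
      rw [hu', ← mul_div_assoc]
      exact div_le_div_of_nonneg_right
        (by nlinarith [mul_pos (show 0 < k by linarith) hδ]) hpi.le)
    rw [← hq] at h1
    -- Two powers of `u'` cancel `k⁻²` and produce `δc²`, leaving exponent `γ - 2 > 0`.
    have h2 : (8 * ε / k) ^ 2 * (Cβ * u' ^ γ) ≤ δc ^ 2 * (64 * Cβ * u' ^ (γ - 2)) := by
      have e1 : u' ^ γ = u' ^ (γ - 2) * u' ^ 2 := by
        rw [← Real.rpow_natCast u' 2, ← Real.rpow_add hu'0]
        congr 1
        push_cast
        ring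
      have e2 : (8 * ε / k) ^ 2 * (Cβ * (u' ^ (γ - 2) * u' ^ 2)) =
          δc ^ 2 * (64 * Cβ * u' ^ (γ - 2)) * ((κ * ε) ^ 2 / π ^ 2) := by
        generalize u' ^ (γ - 2) = v
        rw [hu']
        field_simp
        ring
      rw [e1, e2]
      refine mul_le_of_le_one_right (by positivity) ?_
      rw [div_le_one (by positivity)]
      have : 0 ≤ κ * ε := by positivity
      gcongr
      linarith [pi_gt_three]
    have h3 : δc ^ 2 * (64 * Cβ * (u' ^ (γ - 2) + (1 - u' ^ (γ - 2)) / q)) ≤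
        δc ^ 2 * (64 * Cβ * ((1 - (k * δc / π) ^ (γ - 2)) / q)) := by gcongr
    linarith
  · have h1 := potential_le hs (u := 1 * δc / π) (by positivity)
    rw [← hq] at h1
    calc δc ^ 2 * (1 + 64 * Cβ * ((1 - (1 * δc / π) ^ (γ - 2)) / q))
        ≤ δc ^ 2 * (1 + 64 * Cβ * (1 / q)) := by gcongr
      _ = _ := mul_comm _ _

theorem samplingCost_le {w k : ℝ} (hk : 0 ≤ k) (K M : ℕ) :
    samplingCost w k K M ≤ 2 * M * (k * K ^ 2 + w * M * K) := by
  unfold samplingCost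
  calc ∑ i : Fin K, 2 * (M : ℝ) * (⌊k * ((i : ℕ) + 1)⌋₊ + w * M)
      ≤ ∑ i : Fin K, 2 * (M : ℝ) * (k * K + w * M) := by
        refine Finset.sum_le_sum fun i _ => ?_
        gcongr
        refine (Nat.floor_le (by positivity)).trans ?_
        gcongr
        exact_mod_cast i.2
    _ = 2 * M * (k * K ^ 2 + w * M * K) := by
        rw [Finset.sum_const, Finset.card_univ, Fintype.card_fin, nsmul_eq_mul]
        ring

theorem SamplingParams.signalLength_le (Q : SamplingParams) {ε : ℝ} (hε : 0 < ε) (hε1 : ε ≤ 1)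
    (hlog : 1 ≤ log ε⁻¹) : (Q.signalLength ε : ℝ) ≤ (Q.cK + 1) * ε⁻¹ * log ε⁻¹ ^ 2 := by
  have hcK := Q.cK_pos
  have h1 : (Q.signalLength ε : ℝ) < Q.cK * ε⁻¹ * log ε⁻¹ ^ 2 + 1 :=
    Nat.ceil_lt_add_one (by positivity)
  have h2 : 1 ≤ ε⁻¹ * log ε⁻¹ ^ 2 :=
    one_le_mul_of_one_le_of_one_le ((one_le_inv₀ hε).2 hε1) (one_le_pow₀ hlog)
  linarith

theorem SamplingParams.repetitions_le (Q : SamplingParams) {α ε p : ℝ} (hα : 0 < α)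
    (hp : α ≤ |log (1 - p)|) (hε : 0 < ε) (hε1 : ε ≤ 1) (hlog : 1 ≤ log ε⁻¹) :
    (Q.repetitions ε p : ℝ) ≤ (Q.cM + 1 / α) * |log (1 - p)| * ε⁻¹ ^ 4 * log ε⁻¹ ^ Q.b := by
  have hcM := Q.cM_pos
  have h1 : (Q.repetitions ε p : ℝ) <
      Q.cM * |log (1 - p)| * ε⁻¹ ^ 4 * log ε⁻¹ ^ Q.b + 1 :=
    Nat.ceil_lt_add_one (by positivity)
  have h2 : 1 ≤ 1 / α * |log (1 - p)| * (ε⁻¹ ^ 4 * log ε⁻¹ ^ Q.b) := by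
    refine one_le_mul_of_one_le_of_one_le ?_ (one_le_mul_of_one_le_of_one_le
      (one_le_pow₀ ((one_le_inv₀ hε).2 hε1)) (one_le_pow₀ hlog))
    rw [one_div, ← div_eq_inv_mul, one_le_div hα]
    exact hp
  calc (Q.repetitions ε p : ℝ) ≤ Q.cM * |log (1 - p)| * ε⁻¹ ^ 4 * log ε⁻¹ ^ Q.b +
        1 / α * |log (1 - p)| * (ε⁻¹ ^ 4 * log ε⁻¹ ^ Q.b) := by linarith
    _ = _ := by ring

/-- Whole applications number at most of order `kMK²`, hence `ε⁻⁶`; the overhead is of order `wM²K`,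
hence `ε⁻⁹` and the square of `|ln (1 - p)|`. Rounding up in `M` is absorbed by `1/α`, since `|ln (1
- p)| ≥ α`. -/
theorem extractionCost_le (Q : SamplingParams) {α w k ε p : ℝ} (hα : 0 < α) (hw : 0 ≤ w)
    (hk : 0 ≤ k) (hp : α ≤ |log (1 - p)|) (hε : 0 < ε) (hε1 : ε ≤ 1) (hlog : 1 ≤ log ε⁻¹) :
    extractionCost Q w k ε p ≤
      2 * (Q.cK + 1) * (Q.cM + 1 / α) * ((Q.cK + 1) + (Q.cM + 1 / α)) *
        ((ε⁻¹ ^ 6 + w * ε⁻¹ ^ 9) * log ε⁻¹ ^ (2 * Q.b + 4)) *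
        (k * |log (1 - p)| + |log (1 - p)| ^ 2) := by
  have hcM := Q.cM_pos
  have hcK := Q.cK_pos
  have hK := Q.signalLength_le hε hε1 hlog
  have hM := Q.repetitions_le hα hp hε hε1 hlog
  have hy : 0 < ε⁻¹ := inv_pos.2 hε
  set y := ε⁻¹
  set ℓ := log y
  set Λ := |log (1 - p)|
  have hΛ : 0 < Λ := hα.trans_le hp
  set c₁ := Q.cK + 1 with hc₁
  set c₂ := Q.cM + 1 / α with hc₂
  have hc₁0 : 0 < c₁ := by positivity
  have hc₂0 : 0 < c₂ := by positivity
  have hℓ0 : 0 < ℓ := by linarith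
  refine (samplingCost_le hk _ _).trans ?_
  have hp1 : ℓ ^ (Q.b + 4) ≤ ℓ ^ (2 * Q.b + 4) := pow_le_pow_right₀ hlog (by omega)
  have hp2 : ℓ ^ (2 * Q.b + 2) ≤ ℓ ^ (2 * Q.b + 4) := pow_le_pow_right₀ hlog (by omega)
  set P := ℓ ^ (2 * Q.b + 4)
  have hP : 0 < P := by positivity
  calc 2 * (Q.repetitions ε p : ℝ) * (k * (Q.signalLength ε : ℝ) ^ 2 +
        w * (Q.repetitions ε p : ℝ) * (Q.signalLength ε : ℝ))
      ≤ 2 * (c₂ * Λ * y ^ 4 * ℓ ^ Q.b) * (k * (c₁ * y * ℓ ^ 2) ^ 2 +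
        w * (c₂ * Λ * y ^ 4 * ℓ ^ Q.b) * (c₁ * y * ℓ ^ 2)) := by gcongr
    _ = 2 * c₁ * c₂ * (c₁ * (y ^ 6 * (ℓ ^ (Q.b + 4)) * (k * Λ)) +
        c₂ * (w * y ^ 9 * ℓ ^ (2 * Q.b + 2) * Λ ^ 2)) := by ring
    _ ≤ 2 * c₁ * c₂ * (c₁ * (y ^ 6 * P * (k * Λ)) + c₂ * (w * y ^ 9 * P * Λ ^ 2)) := by gcongr
    _ ≤ 2 * c₁ * c₂ * (c₁ * ((y ^ 6 + w * y ^ 9) * P * (k * Λ + Λ ^ 2)) +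
        c₂ * ((y ^ 6 + w * y ^ 9) * P * (k * Λ + Λ ^ 2))) := by
        gcongr
        · exact le_add_of_nonneg_right (by positivity)
        · exact le_add_of_nonneg_right (by positivity)
        · exact le_add_of_nonneg_left (by positivity)
        · exact le_add_of_nonneg_left (by positivity)
    _ = _ := by ring

/-- With `u = kδc/π`, the bound `√u |ln (1 - p)| ≤ α + 2γ` trades the logarithm for a square root.
The first term becomes `O(√u/δc)`, dominated by the last rounds; the second `O(1/u) = O(1/(kδc))`,
dominated by the first ones. -/
theorem mul_add_sq_log_le {α γ δc k : ℝ} (hα : 0 < α) (hγ : 0 < γ) (hδ : 0 < δc) (hk : 0 < k)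
    (hkπ : k * δc ≤ π) :
    k * |log (1 - confidence α γ δc k)| + |log (1 - confidence α γ δc k)| ^ 2 ≤
      (α + 2 * γ) * (1 + (α + 2 * γ)) * π / δc * ((k * δc / π) ^ (1 / 2 : ℝ) + 1 / k) := by
  have hpi := pi_pos
  rw [abs_log_one_sub_confidence hα hγ (by positivity) hkπ]
  set u := k * δc / π with hu
  have hu0 : 0 < u := by positivity
  have hu1 : u ≤ 1 := (div_le_one hpi).2 hkπ
  rw [← Real.sqrt_eq_rpow]
  have hs0 : 0 < √u := Real.sqrt_pos.2 hu0
  have hs1 : √u ≤ 1 := Real.sqrt_le_one.2 hu1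
  have hsq : √u ^ 2 = u := Real.sq_sqrt hu0.le
  set c := α + 2 * γ with hc
  have hc0 : 0 < c := by positivity
  set Λ := α - γ * log u with hΛ
  have hlogu : log u ≤ 0 := Real.log_nonpos hu0.le hu1
  have hΛ0 : 0 < Λ := by nlinarith
  have hsΛ : √u * Λ ≤ c := by
    have h1 : -log u ≤ 2 * (√u)⁻¹ := by
      have h2 := Real.log_le_sub_one_of_pos (inv_pos.2 hs0)
      rw [Real.log_inv, Real.log_sqrt hu0.le] at h2
      linarith
    calc √u * Λ = √u * α + γ * (√u * -log u) := by rw [hΛ]; ring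
      _ ≤ 1 * α + γ * (√u * (2 * (√u)⁻¹)) := by gcongr
      _ = c := by rw [hc]; field_simp
  have hΛle : Λ ≤ c / √u := by rw [le_div_iff₀ hs0]; linarith
  have h1 : k * Λ ≤ π / δc * (c * √u) := by
    have e : k = π / δc * u := by rw [hu]; field_simp
    rw [e, mul_assoc]
    refine mul_le_mul_of_nonneg_left ?_ (by positivity)
    calc u * Λ = √u * (√u * Λ) := by rw [← mul_assoc, ← sq, hsq]
      _ ≤ √u * c := by gcongr
      _ = c * √u := mul_comm _ _
  have h2 : Λ ^ 2 ≤ π / δc * (c ^ 2 * (1 / k)) := by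
    calc Λ ^ 2 ≤ (c / √u) ^ 2 := by gcongr
      _ = π / δc * (c ^ 2 * (1 / k)) := by
        rw [div_pow, hsq, hu]
        field_simp
  have h3 : 0 < π / δc := by positivity
  have h4 : 0 < 1 / k := by positivity
  calc k * Λ + Λ ^ 2 ≤ π / δc * (c * √u) + π / δc * (c ^ 2 * (1 / k)) := add_le_add h1 h2
    _ ≤ π / δc * (c * √u) + π / δc * (c ^ 2 * (1 / k)) +
        (π / δc * (c ^ 2 * √u) + π / δc * (c * (1 / k))) := le_add_of_nonneg_right (by positivity)
    _ = _ := by ring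

/-- A potential that pays for the extractions of all rounds. -/
theorem exists_cost_potential (Q : SamplingParams) {α γ : ℝ} (hα : 0 < α) (hγ : 0 < γ) :
    ∃ C : ℝ, 0 < C ∧ ∀ ε δc w : ℝ, 0 < ε → ε ≤ 1 → 1 ≤ log ε⁻¹ → 0 < δc → δc < π → 0 ≤ w →
      ∃ J : ℝ → ℝ, (∀ k, 1 ≤ k → k * δc ≤ π → 0 ≤ J k) ∧
        (∀ k k', 1 ≤ k → 2 * k ≤ k' → k' * δc ≤ π →
          extractionCost Q w k' ε (confidence α γ δc k') + J k' ≤ J k) ∧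
        extractionCost Q w 1 ε (confidence α γ δc 1) + J 1 ≤
          C * (ε⁻¹ ^ 6 + w * ε⁻¹ ^ 9) * log ε⁻¹ ^ (2 * Q.b + 4) / δc := by
  have hcM := Q.cM_pos
  have hcK := Q.cK_pos
  have hpi := pi_pos
  have hs : (0 : ℝ) < 1 / 2 := by norm_num
  set q := 1 - (1 / 2 : ℝ) ^ (1 / 2 : ℝ) with hq
  have hq0 : 0 < q := sub_pos.2 (Real.rpow_lt_one (by norm_num) (by norm_num) hs)
  set C₀ := 2 * (Q.cK + 1) * (Q.cM + 1 / α) * ((Q.cK + 1) + (Q.cM + 1 / α)) *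
    ((α + 2 * γ) * (1 + (α + 2 * γ)) * π) with hC₀
  have hC₀0 : 0 < C₀ := by positivity
  refine ⟨C₀ * (3 + 1 / q), by positivity, fun ε δc w hε hε1 hlog hδ hδπ hw => ?_⟩
  set Y := (ε⁻¹ ^ 6 + w * ε⁻¹ ^ 9) * log ε⁻¹ ^ (2 * Q.b + 4) with hY
  have hY0 : 0 ≤ Y := by
    have := hε.le
    have : 0 ≤ log ε⁻¹ := by linarith
    positivity
  set G := C₀ * Y / δc with hG
  have hG0 : 0 ≤ G := by positivity
  have hcost : ∀ k, 1 ≤ k → k * δc ≤ π → extractionCost Q w k ε (confidence α γ δc k) ≤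
      G * ((k * δc / π) ^ (1 / 2 : ℝ) + 1 / k) := by
    intro k hk hkπ
    have hk0 : 0 < k := by linarith
    have hp : α ≤ |log (1 - confidence α γ δc k)| := by
      rw [abs_log_one_sub_confidence hα hγ (by positivity) hkπ]
      have := Real.log_nonpos (x := k * δc / π) (by positivity) ((div_le_one hpi).2 hkπ)
      nlinarith
    refine (extractionCost_le Q hα hw hk0.le hp hε hε1 hlog).trans ?_
    rw [← hY]
    calc _ ≤ 2 * (Q.cK + 1) * (Q.cM + 1 / α) * ((Q.cK + 1) + (Q.cM + 1 / α)) * Y *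
          ((α + 2 * γ) * (1 + (α + 2 * γ)) * π / δc * ((k * δc / π) ^ (1 / 2 : ℝ) + 1 / k)) := by
          gcongr
          exact mul_add_sq_log_le hα hγ hδ hk0 hkπ
      _ = _ := by rw [hG, hC₀]; ring
  -- One summand pays for the growing series `√u`, the other for the decaying series `1/k`, using
  -- `1/k' + 1/k' ≤ 1/k`.
  refine ⟨fun k => G * ((1 - (k * δc / π) ^ (1 / 2 : ℝ)) / q + 1 / k), ?_, ?_, ?_⟩
  · intro k hk hkπ
    have h1 := potential_nonneg hs (u := k * δc / π) (by positivity) ((div_le_one hpi).2 hkπ)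
    have : 0 < k := by linarith
    exact mul_nonneg hG0 (add_nonneg h1 (by positivity))
  · intro k k' hk hkk' hkπ
    have h1 := rpow_add_potential_le hs (u := k * δc / π) (u' := k' * δc / π) (by positivity) (by
      rw [← mul_div_assoc, ← mul_assoc]
      gcongr)
    rw [← hq] at h1
    have h2 : 1 / k' + 1 / k' ≤ 1 / k := by
      rw [← add_div, div_le_div_iff₀ (by linarith) (by linarith)]
      linarith
    have h3 := hcost k' (by linarith) hkπ
    calc _ ≤ G * ((k' * δc / π) ^ (1 / 2 : ℝ) + 1 / k') +
          G * ((1 - (k' * δc / π) ^ (1 / 2 : ℝ)) / q + 1 / k') := by gcongr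
      _ = G * (((k' * δc / π) ^ (1 / 2 : ℝ) + (1 - (k' * δc / π) ^ (1 / 2 : ℝ)) / q) +
          (1 / k' + 1 / k')) := by ring
      _ ≤ G * ((1 - (k * δc / π) ^ (1 / 2 : ℝ)) / q + 1 / k) := by gcongr
  · have h1 := hcost 1 le_rfl (by linarith)
    have h2 := potential_le hs (u := 1 * δc / π) (by positivity)
    have h3 : (1 * δc / π) ^ (1 / 2 : ℝ) ≤ 1 :=
      Real.rpow_le_one (by positivity) ((div_le_one hpi).2 (by linarith)) hs.le
    rw [← hq] at h2
    calc _ ≤ G * ((1 * δc / π) ^ (1 / 2 : ℝ) + 1 / 1) +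
          G * ((1 - (1 * δc / π) ^ (1 / 2 : ℝ)) / q + 1 / 1) := by gcongr
      _ ≤ G * (1 + 1 / 1) + G * (1 / q + 1 / 1) := by gcongr
      _ = C₀ * (3 + 1 / q) * Y / δc := by rw [hG]; ring
      _ = _ := by rw [hY]; ring

/-! ### The initial round and the whole algorithm. -/

/-- The phases at the start of the loop: the shift places a largest gap around the branch cut. -/
theorem LoopState.initial {n : ℕ} {A ε₀ ε δc : ℝ} (h : AdmissibleErrors n A ε₀ ε)
    (R : ChoiceRule n ε₀ ε) (hδπ : δc ≤ π) {Φ : Finset ℝ} (hΦ : Φ.Nonempty) (hcard : Φ.card ≤ n) :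
    LoopState n ε δc 0 1 (Φ.image fun x =>
      circMod (x - (R.zeta Φ + gapAt Φ (R.zeta Φ) / 2 - 8 * ε₀))) := by
  have hn := h.one_le
  have hε := h.pos
  have hεn := h.le_div
  have hgap := pi_div_le_gapAt hΦ hcard (R.zeta_max Φ hΦ)
  generalize R.zeta Φ = ζ at hgap
  rw [h.eq]
  set g := gapAt Φ ζ
  have hπg : π / n ≤ g := (div_le_iff₀' (by linarith)).2 hgap
  have hy : ∀ x ∈ Φ, g / 2 + 8 * ε ≤ circMod (x - (ζ + g / 2 - 8 * ε)) ∧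
      circMod (x - (ζ + g / 2 - 8 * ε)) ≤ 2 * π - 3 / 2 * g + 8 * ε := by
    intro x hx
    obtain ⟨m, hm⟩ := exists_circMod_eq (x - (ζ + g / 2 - 8 * ε))
    obtain ⟨h0, h1⟩ := circMod_mem (x - (ζ + g / 2 - 8 * ε))
    set y := circMod (x - (ζ + g / 2 - 8 * ε))
    have hle := gapAt_le hx ζ
    -- The point `ζ` has two relevant representatives, `2π` apart. Being at distance at least `g`
    -- from each yields the lower and the upper margin.
    have e₁ := hle.trans (circNorm_le_abs_sub (x - ζ) (-m))
    have e₂ := hle.trans (circNorm_le_abs_sub (x - ζ) (-m + 1))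
    push_cast at e₁ e₂
    rw [show x - ζ - 2 * π * -(m : ℝ) = y + g / 2 - 8 * ε by rw [hm]; ring,
      abs_of_nonneg (by linarith)] at e₁
    rw [show x - ζ - 2 * π * (-(m : ℝ) + 1) = y + g / 2 - 8 * ε - 2 * π by rw [hm]; ring,
      le_abs'] at e₂
    constructor
    · linarith
    · rcases e₂ with e₂ | e₂ <;> linarith
  refine ⟨⟨le_rfl, hΦ.image _, Finset.card_image_le.trans hcard, ?_, ?_⟩, fun _ => rfl,
    fun h => absurd rfl h, by linarith⟩
  · rw [Finset.forall_mem_image]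
    intro x hx
    linarith [(hy x hx).1]
  · rw [Finset.forall_mem_image]
    intro x hx
    linarith [(hy x hx).2]

/-- The margins exceed `2ε`, so closeness on the circle to a shifted estimate is closeness on the
line, without wrapping at the cut. -/
theorem IsAccurate.initial {n N : ℕ} {A ε₀ ε δc χ : ℝ} (h : AdmissibleErrors n A ε₀ ε)
    {S : QPESystem N} {Φ : Finset ℝ}
    (hΦ : LoopState n ε δc 0 1 (Φ.image fun x => circMod (x - χ)))
    (hext : IsExtracted (shiftedPhases S 0) n ε 1 Φ) :
    IsAccurate (shiftedPhases S χ) ε 1 (Φ.image fun x => circMod (x - χ)) := by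
  have hε := h.pos
  have hεn := h.le_div
  have key : ∀ x θ r, θ ∈ Φ → r ≤ 2 * ε → circNorm (1 * circMod (x - 0) - θ) ≤ r →
      |circMod (θ - χ) - circMod (x - χ)| ≤ r / 1 := by
    intro x θ r hθ hr hx
    have hmem := Finset.mem_image_of_mem (fun x => circMod (x - χ)) hθ
    have hlo := hΦ.lower _ hmem
    have hhi := hΦ.upper _ hmem
    have hlt : 0 < π / n := div_pos pi_pos (by linarith [h.one_le])
    rw [div_one]
    rw [one_mul, circNorm_circMod_sub, sub_zero] at hx
    refine abs_sub_le_of_circNorm_le ?_ (Set.Ico_subset_Icc_self (circMod_mem _)) (by linarith)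
      (by linarith)
    rwa [circNorm_circMod_sub, circNorm_sub_circMod, sub_sub_sub_cancel_right, circNorm_sub_comm]
  obtain ⟨h1, h2, -⟩ := hext
  constructor
  · intro φ hφ
    obtain ⟨x, hx, rfl⟩ := Finset.mem_image.1 hφ
    obtain ⟨θ, hθ, hd⟩ := h1 _ (Finset.mem_image_of_mem _ hx)
    exact ⟨_, Finset.mem_image_of_mem _ hθ, key x θ _ hθ le_rfl hd⟩
  · rw [Finset.forall_mem_image]
    intro θ hθ
    obtain ⟨φ, hφ, hd⟩ := h2 θ hθ
    obtain ⟨x, hx, rfl⟩ := Finset.mem_image.1 hφ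
    exact ⟨_, Finset.mem_image_of_mem _ hx, key x θ _ hθ (by linarith) hd⟩

theorem closestError_image_circMod (E : Finset ℝ) (χ x : ℝ) :
    closestError (E.image fun y => circMod (y + χ)) x = closestError E (circMod (x - χ)) := by
  unfold closestError
  rw [Finset.coe_image, Set.image_image]
  congr 2
  funext y
  rw [circNorm_circMod_sub, circNorm_sub_circMod, add_sub_assoc, sub_sub_eq_add_sub, add_sub_assoc]

section algorithm

variable (Q : SamplingParams) {N : ℕ} (S : QPESystem N) (I : AlgInput)
  (R : ChoiceRule I.n I.ε₀ I.ε)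

/-- The shift of the phases. -/
noncomputable def ChoiceRule.shift {n : ℕ} {ε₀ ε : ℝ} (R : ChoiceRule n ε₀ ε) (Φ : Finset ℝ) : ℝ :=
  R.zeta Φ + gapAt Φ (R.zeta Φ) / 2 - 8 * ε₀

open Classical in
/-- The algorithm after the initial extraction. -/
noncomputable def afterInitial (Φ : Finset ℝ) : PMF (Finset ℝ × ℝ) :=
  let c := extractionCost Q I.w 1 I.ε₀ (confidence I.α I.γ I.δc 1)
  if Φ = ∅ ∨ I.n < Φ.card then PMF.pure ({0}, c)
  else
    (adaptiveLoop Q S I R (R.shift Φ) ⌈2 * I.ε / I.δc⌉₊ 0 1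
      (Φ.image fun x => circMod (x - R.shift Φ))).map
        fun r => (r.1.image fun x => circMod (x + R.shift Φ), c + r.2)

theorem adaptiveAlgorithm_eq : adaptiveAlgorithm Q S I R =
    (extraction Q S I.A 0 1 I.ε₀ (confidence I.α I.γ I.δc 1)).bind (afterInitial Q S I R) := rfl

/-- These bounds hold for every run, failures included. -/
theorem adaptiveAlgorithm_support (h : AdmissibleErrors I.n I.A I.ε₀ I.ε) (hδ : 0 < I.δc)
    (hδπ : I.δc ≤ π) (J : ℝ → ℝ) (hJ0 : ∀ k, 1 ≤ k → k * I.δc ≤ π → 0 ≤ J k)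
    (hJ : ∀ k k', 1 ≤ k → 2 * k ≤ k' → k' * I.δc ≤ π →
      extractionCost Q I.w k' I.ε (confidence I.α I.γ I.δc k') + J k' ≤ J k)
    {r : Finset ℝ × ℝ} (hr : r ∈ (adaptiveAlgorithm Q S I R).support) :
    r.1.Nonempty ∧ r.1.card ≤ I.n ∧
      r.2 ≤ extractionCost Q I.w 1 I.ε (confidence I.α I.γ I.δc 1) + J 1 := by
  have hJ1 := hJ0 1 le_rfl (by linarith)
  rw [adaptiveAlgorithm_eq, PMF.mem_support_bind_iff] at hr
  obtain ⟨Φ, -, hr⟩ := hr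
  unfold afterInitial at hr
  split_ifs at hr with hc
  · rw [PMF.support_pure, Set.mem_singleton_iff] at hr
    subst hr
    refine ⟨Finset.singleton_nonempty 0, ?_, ?_⟩
    · rw [Finset.card_singleton]
      exact_mod_cast h.one_le
    · rw [h.eq]
      exact le_add_of_nonneg_right hJ1
  · rw [not_or, not_lt, ← ne_eq, ← Finset.nonempty_iff_ne_empty] at hc
    rw [PMF.mem_support_map_iff] at hr
    obtain ⟨r', hr', rfl⟩ := hr
    obtain ⟨h1, h2, -, h4⟩ := adaptiveLoop_support Q S I h hδ R (R.shift Φ) J hJ0 hJ _ 0 1 _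
      (LoopState.initial h R hδπ hc.1 hc.2) r' hr'
    refine ⟨h1.image _, Finset.card_image_le.trans h2, ?_⟩
    change extractionCost Q I.w 1 I.ε₀ _ + r'.2 ≤ _
    rw [h.eq]
    gcongr

-- A failed initial extraction gives no control on the output beyond the diameter of the circle,
-- hence `π² β(1)`; otherwise the loop starts with accurate estimates.
open Classical in
theorem adaptiveAlgorithm_error (h : AdmissibleErrors I.n I.A I.ε₀ I.ε) (hδ : 0 < I.δc)
    (hδπ : I.δc ≤ π) (J : ℝ → ℝ) (hJ0 : ∀ k, 1 ≤ k → k * I.δc ≤ π → 0 ≤ J k)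
    (hJ : ∀ k k', 1 ≤ k → 2 * k ≤ k' → k' * I.δc ≤ π →
      extractionCost Q I.w k' I.ε (confidence I.α I.γ I.δc k') + J k' ≤ J k)
    (β B : ℝ → ℝ) (hβ0 : ∀ k, 1 ≤ k → 0 ≤ β k)
    (hβ : ∀ χ k, 1 ≤ k → k * I.δc ≤ π →
      mean (extraction Q S I.A χ k I.ε (confidence I.α I.γ I.δc k))
        (fun Θ => if IsExtracted (shiftedPhases S χ) I.n I.ε k Θ then 0 else 1) ≤
          ENNReal.ofReal (β k))
    (hB0 : ∀ k, 1 ≤ k → k * I.δc ≤ π → I.δc ^ 2 ≤ B k)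
    (hB : ∀ k κ, 1 ≤ k → 2 ≤ κ → κ * I.ε ≤ 1 → k * κ * I.δc ≤ π →
      B (k * κ) + (8 * I.ε / k) ^ 2 * β (k * κ) ≤ B k)
    {φ : ℝ} (hφ : φ ∈ S.phases) :
    mean (adaptiveAlgorithm Q S I R) (fun r => ENNReal.ofReal (closestError r.1 φ ^ 2)) ≤
      ENNReal.ofReal (B 1 + π ^ 2 * β 1) := by
  have hB1 : 0 ≤ B 1 := (sq_nonneg _).trans (hB0 1 le_rfl (by linarith))
  rw [adaptiveAlgorithm_eq, mean_bind, ENNReal.ofReal_add hB1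
    (mul_nonneg (sq_nonneg _) (hβ0 1 le_rfl)), ENNReal.ofReal_mul (sq_nonneg _), h.eq]
  refine mean_le_add_mul (fun Φ => IsExtracted (shiftedPhases S 0) I.n I.ε 1 Φ)
    (hβ 0 1 le_rfl (by linarith)) (fun Φ _ hG => ?_) (fun Φ _ => ?_)
  · have hne : Φ.Nonempty := by
      obtain ⟨θ, hθ, -⟩ := hG.1 _ (Finset.mem_image_of_mem _ hφ)
      exact ⟨θ, hθ⟩
    have hinit := LoopState.initial h R hδπ hne hG.2.2
    unfold afterInitial
    rw [if_neg (by rw [not_or, not_lt]; exact ⟨hne.ne_empty, hG.2.2⟩), mean_map]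
    simp_rw [Function.comp_def, closestError_image_circMod]
    refine adaptiveLoop_error Q S I h hδ R (R.shift Φ) J hJ0 hJ β B hβ0 (hβ _) hB0 hB
      (Finset.mem_image_of_mem _ hφ) _ 0 1 _ hinit (.initial h hinit hG) ?_
    rw [one_mul]
    -- The fuel `⌈2ε/δc⌉` is ample, because `m ≤ 2^m`.
    refine (Nat.le_ceil _).trans ?_
    exact_mod_cast Nat.lt_two_pow_self.le
  · refine mean_le_of_support fun r _ => ENNReal.ofReal_le_ofReal ?_
    exact pow_le_pow_left₀ (closestError_nonneg _ _) (closestError_le_pi _) 2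

end algorithm

/-! ### Polynomial dependence on the number of phases and the probability bound. -/

/-- Error parameters whose inverses are polynomial in `n` and `1 / A`. -/
theorem exists_admissibleErrors {n : ℕ} {A : ℝ} (hn : 1 ≤ n) (hA : 0 < A) :
    ∃ ε : ℝ, AdmissibleErrors n A ε ε ∧ ε⁻¹ ≤ 320 * ((n : ℝ) + A⁻¹) ^ 4 := by
  have hpi := pi_pos
  have hpi4 := pi_lt_four
  have hpi3 := pi_gt_three
  have hn' : (1 : ℝ) ≤ n := by exact_mod_cast hn
  -- The number of bins is fixed first, so that `ε = 2π/L` tiles the circle; `19/A` is enough for `ε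
  -- < A/3` because `2π < 19/3`.
  set L : ℕ := 300 * n ^ 4 + ⌈19 / A⌉₊ with hLdef
  have hLc : (L : ℝ) = 300 * (n : ℝ) ^ 4 + ⌈19 / A⌉₊ := by rw [hLdef]; push_cast; ring
  have hceil := Nat.le_ceil (19 / A)
  have hceil' := Nat.ceil_lt_add_one (show 0 ≤ 19 / A by positivity)
  have hc0 : (0 : ℝ) < 19 / A := by positivity
  have hn4 : (1 : ℝ) ≤ (n : ℝ) ^ 4 := one_le_pow₀ hn'
  have hL0 : (0 : ℝ) < L := by linarith
  have h4 : 2 * π / L ≤ 2 * π / (300 * (n : ℝ) ^ 4) := by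
    gcongr
    linarith
  have hlt : 2 * π / L < A / 3 := by
    rw [div_lt_iff₀ hL0]
    have : A / 3 * (19 / A) = 19 / 3 := by field_simp
    have : A / 3 * (19 / A) < A / 3 * L := by
      gcongr
      linarith
    have := pi_lt_d2
    linarith
  refine ⟨2 * π / L, ⟨by positivity, by positivity, h4, h4.trans ?_, hlt, hlt, rfl, L, ?_⟩, ?_⟩
  · gcongr
    norm_num
  · field_simp
  · have hA' : 0 < A⁻¹ := inv_pos.2 hA
    have h1 : (n : ℝ) ^ 4 ≤ (n + A⁻¹) ^ 4 := by
      gcongr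
      linarith
    have h2 : n + A⁻¹ ≤ (n + A⁻¹) ^ 4 := le_self_pow₀ (by linarith) (by norm_num)
    have h3 : (L : ℝ) ≤ 320 * (n + A⁻¹) ^ 4 := by
      have h5 : 19 / A = 19 * A⁻¹ := div_eq_mul_inv _ _
      linarith
    refine le_trans ?_ h3
    rw [inv_div]
    exact div_le_self hL0.le (by linarith)

theorem cost_le_pow {y w : ℝ} (hy : 1 ≤ y) (hw : 0 ≤ w) (m : ℕ) :
    (y ^ 6 + w * y ^ 9) * log y ^ m ≤ (1 + w) * y ^ (9 + m) := by
  have h0 := Real.log_nonneg hy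
  have h1 : log y ≤ y := by linarith [Real.log_le_sub_one_of_pos (show 0 < y by linarith)]
  have h2 : y ^ 6 ≤ y ^ 9 := pow_le_pow_right₀ hy (by norm_num)
  calc (y ^ 6 + w * y ^ 9) * log y ^ m ≤ (y ^ 9 + w * y ^ 9) * y ^ m := by gcongr
    _ = _ := by ring

end HeisenbergQPE

/-! ### Assembly of the constants. -/

open HeisenbergQPE in
theorem mainTheorem1 :
    ∃ (Q : SamplingParams) (m D : ℕ), ∀ α : ℝ, 0 < α → ∀ γ : ℝ, 2 < γ →
      ∃ C₁ C₂ C₃ : ℝ, 0 < C₁ ∧ 0 < C₂ ∧ 0 < C₃ ∧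
        (∀ (n : ℕ) (A ε₀ ε : ℝ), AdmissibleErrors n A ε₀ ε →
          ∀ (R : ChoiceRule n ε₀ ε) (N : ℕ) (S : QPESystem N), S.Promise A n →
          ∀ w : ℝ, 0 ≤ w → ∀ δc : ℝ, 0 < δc → δc < Real.pi →
            SolvesMEEP S n (C₁ * δc) (adaptiveAlgorithm Q S ⟨n, A, ε₀, ε, α, γ, δc, w⟩ R) ∧
            expectedCost (adaptiveAlgorithm Q S ⟨n, A, ε₀, ε, α, γ, δc, w⟩ R) ≤
              ENNReal.ofReal
                (C₂ * (ε⁻¹ ^ 6 + w * ε⁻¹ ^ 9) * Real.log ε⁻¹ ^ m / (C₁ * δc))) ∧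
        (∀ (n : ℕ) (A : ℝ), 1 ≤ n → 0 < A → (n : ℝ) * A ≤ 1 →
          ∃ ε₀ ε : ℝ, AdmissibleErrors n A ε₀ ε ∧
            ∀ w : ℝ, 0 ≤ w →
              C₂ * (ε⁻¹ ^ 6 + w * ε⁻¹ ^ 9) * Real.log ε⁻¹ ^ m ≤
                C₃ * (1 + w) * ((n : ℝ) + A⁻¹) ^ D) := by
  classical
  obtain ⟨Q, C, hC, hext⟩ := exists_samplingParams
  refine ⟨Q, 2 * Q.b + 4, 4 * (9 + (2 * Q.b + 4)), fun α hα γ hγ => ?_⟩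
  have hγ0 : 0 < γ := by linarith
  set Cβ := C * (1 + 1 / α) with hCβ
  have hCβ0 : 0 < Cβ := by positivity
  obtain ⟨D, hD, herr⟩ := exists_error_potential hCβ0 hγ
  obtain ⟨C', hC', hcost⟩ := exists_cost_potential Q hα hγ0
  have hs : 0 < √(D + Cβ) := Real.sqrt_pos.2 (by positivity)
  -- The mean square error is at most `(D + Cβ)δc²`, with `D` from the loop and `Cβ` from the
  -- initial round. The cost is stated per `δ = C₁δc`, so `C₂` carries an extra factor `C₁`.
  refine ⟨√(D + Cβ), √(D + Cβ) * C',
    √(D + Cβ) * C' * 320 ^ (9 + (2 * Q.b + 4)), hs, by positivity, by positivity, ?_, ?_⟩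
  · intro n A ε₀ ε h R N S hS w hw δc hδ hδπ
    have hpi := Real.pi_pos
    have hε1 : ε ≤ 1 := by linarith [h.le_pi_div, Real.pi_lt_four]
    obtain ⟨B, hB0, hB, hB1⟩ := herr ε δc h.pos hδ hδπ
    obtain ⟨J, hJ0, hJ, hJ1⟩ := hcost ε δc w h.pos hε1 h.one_le_log hδ hδπ hw
    have hsupp := fun r hr => adaptiveAlgorithm_support Q S ⟨n, A, ε₀, ε, α, γ, δc, w⟩ R h hδ
      hδπ.le J hJ0 hJ (r := r) hr
    refine ⟨⟨fun r hr => ⟨(hsupp r hr).1, (hsupp r hr).2.1⟩, fun φ hφ => ?_⟩, ?_⟩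
    · have hβ : ∀ χ k, 1 ≤ k → k * δc ≤ Real.pi →
          mean (extraction Q S A χ k ε (confidence α γ δc k))
            (fun Θ => if IsExtracted (shiftedPhases S χ) n ε k Θ then 0 else 1) ≤
              ENNReal.ofReal (Cβ * (k * δc / Real.pi) ^ γ) := by
        intro χ k hk hkπ
        have hk0 : 0 < k * δc := by positivity
        refine (hext α hα n A ε₀ ε h N S hS χ k _ ?_).trans (ENNReal.ofReal_le_ofReal ?_)
        · rw [abs_log_one_sub_confidence hα hγ0 hk0 hkπ]
          have := Real.log_nonpos (x := k * δc / Real.pi) (by positivity)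
            ((div_le_one hpi).2 hkπ)
          nlinarith
        · exact mul_le_mul_of_nonneg_left
            (exp_neg_abs_log_one_sub_confidence_le hα hγ0 hk0 hkπ) hCβ0.le
      have hmean := adaptiveAlgorithm_error Q S ⟨n, A, ε₀, ε, α, γ, δc, w⟩ R h hδ hδπ.le J hJ0 hJ
        (fun k => Cβ * (k * δc / Real.pi) ^ γ) B (fun k hk => by positivity) hβ hB0 hB hφ
      -- As `δc/π ≤ 1`, the exponent `γ` may be lowered to `2`, and `π²(δc/π)² = δc²`.
      have hsq : B 1 + Real.pi ^ 2 * (Cβ * (1 * δc / Real.pi) ^ γ) ≤ (√(D + Cβ) * δc) ^ 2 := by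
        have h1 : (1 * δc / Real.pi) ^ γ ≤ (1 * δc / Real.pi) ^ (2 : ℝ) :=
          Real.rpow_le_rpow_of_exponent_ge (by positivity) ((div_le_one hpi).2 (by linarith)) hγ.le
        rw [Real.rpow_two] at h1
        rw [mul_pow, Real.sq_sqrt (by positivity)]
        calc _ ≤ D * δc ^ 2 + Real.pi ^ 2 * (Cβ * (1 * δc / Real.pi) ^ 2) := by gcongr
          _ = _ := by field_simp
      calc rmsError _ φ ≤ (ENNReal.ofReal ((√(D + Cβ) * δc) ^ 2)) ^ (1 / 2 : ℝ) :=
            ENNReal.rpow_le_rpow (hmean.trans (ENNReal.ofReal_le_ofReal hsq)) (by norm_num)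
        _ = _ := by
          rw [ENNReal.ofReal_rpow_of_nonneg (sq_nonneg _) (by norm_num), ← Real.sqrt_eq_rpow,
            Real.sqrt_sq (by positivity)]
    -- The expected cost unfolds to a `mean`, so the bound valid on every run suffices.
    · refine mean_le_of_support fun r hr => ENNReal.ofReal_le_ofReal ?_
      refine ((hsupp r hr).2.2.trans hJ1).trans_eq ?_
      field_simp
  · intro n A hn hA _
    obtain ⟨ε, h, hε⟩ := exists_admissibleErrors hn hA
    refine ⟨ε, ε, h, fun w hw => ?_⟩
    have hε1 : ε ≤ 1 := by linarith [h.le_pi_div, Real.pi_lt_four]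
    have hy : 1 ≤ ε⁻¹ := (one_le_inv₀ h.pos).2 hε1
    calc √(D + Cβ) * C' * (ε⁻¹ ^ 6 + w * ε⁻¹ ^ 9) * Real.log ε⁻¹ ^ (2 * Q.b + 4)
        = √(D + Cβ) * C' * ((ε⁻¹ ^ 6 + w * ε⁻¹ ^ 9) * Real.log ε⁻¹ ^ (2 * Q.b + 4)) := by ring
      _ ≤ √(D + Cβ) * C' * ((1 + w) * ε⁻¹ ^ (9 + (2 * Q.b + 4))) := by
          exact mul_le_mul_of_nonneg_left (cost_le_pow hy hw _) (by positivity)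
      _ ≤ √(D + Cβ) * C' * ((1 + w) * (320 * ((n : ℝ) + A⁻¹) ^ 4) ^ (9 + (2 * Q.b + 4))) := by
          gcongr
      _ = _ := by rw [mul_pow, ← pow_mul]; ring
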